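/- A surface-link is given by a marked graph diagram: a link diagram in the plane which, besides crossings, may have 4-valent marked vertices; two diagrams are identified if they are related by planar isotopy and the Yoshikawa moves $\Gamma_1,\dots,\Gamma_8$ (for diagrams whose two resolutions are trivial links this is ambient isotopy of surface-links in $\mathbb{R}^4$). A marked graph $n$-mosaic is an $n\times n$ matrix of the following 13 tiles, whose connection points are midpoints of sides: the empty tile, the four quarter-circle arcs, the horizontal and the vertical segment, the two tiles with two disjoint quarter-circle arcs, the two crossings, and the two marked vertices. It is required to be suitably connected: every connection point of a tile touches a connection point of a contiguous tile. Such a mosaic is a picture of a marked graph diagram. The mosaic number $m(K)$ of a surface-link $K$ is the smallest $n$ such that $K$ is represented by a marked graph $n$-mosaic. Then the mosaic numbers of the 23 surface-links of ch-index at most $10$ in Yoshikawa's table (each given, up to mirror image, by a marked graph diagram with as many vertices as its ch-index) satisfy: - $m(0_1)=2$; - $m(2_1^{1})=m(2_1^{-1})=4$; - $m(6_1^{0,1})\in\{5,6\}$; - $m(K)=6$ for $K\in\{7_1^{0,-2},\ 8_1^{1,1},\ 8_1^{-1,-1},\ 10_2^{0,1}\}$; - $m(K)\in\{6,7\}$ for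 $K\in\{8_1,\ 9_1,\ 9_1^{0,1},\ 9_1^{1,-2},\ 10_1,\ 10_2,\ 10_1^{0,1},\ 10_1^{1,1},\ 10_2^{0,-2},\ 10_1^{-1,-1}\}$; - $m(K)\in\{6,7,8\}$ for $K\in\{10_3,\ 10_1^{1},\ 10_1^{0,0,1},\ 10_1^{0,-2},\ 10_1^{-2,-2}\}$. -/

import Mathlib

namespace MarkedGraph

/-! Link diagrams with marked vertices in the plane, read from top to bottom.

A generic planar diagram is cut by horizontal lines into elementary pieces.  Between two pieces
the horizontal line meets the diagram in finitely many strands, numbered `0, 1, 2, …` from left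
to right.  Planar isotopy and the Yoshikawa moves are then local replacements in the word of
pieces. -/

/-- The two kinds of 4-valent vertices.  A vertex has two upper legs (UL, UR) and two lower legs
(LL, LR).

* `crossing true`: the strand UL–LR passes over the strand UR–LL;
  `crossing false`: the strand UR–LL passes over the strand UL–LR.
* `marked true`: a marked vertex whose positive resolution joins UL–LL and UR–LR (and whose
  negative resolution joins UL–UR and LL–LR); `marked false`: the other marker. -/
inductive Vertex where
  | crossing (ulOver : Bool)
  | marked (marker : Bool)
  deriving DecidableEq

/-- The same vertex drawn after a rotation of the picture by a quarter turn. -/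
def Vertex.rot : Vertex → Vertex
  | .crossing b => .crossing (!b)
  | .marked b => .marked (!b)

/-- The elementary pieces: a local maximum (two new strands appear), a local minimum (two
neighbouring strands are joined), or a vertex on two neighbouring strands. -/
inductive Piece where
  | birth
  | join
  | vertex (x : Vertex)
  deriving DecidableEq

/-- The number of strands entering a piece from above. -/
def Piece.ins : Piece → ℕ
  | .birth => 0
  | .join => 2
  | .vertex _ => 2

/-- The number of strands leaving a piece below. -/
def Piece.outs : Piece → ℕ
  | .birth => 2
  | .join => 0
  | .vertex _ => 2

/-- A piece together with the number of strands to its left. -/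
structure Event where
  piece : Piece
  pos : ℕ
  deriving DecidableEq

abbrev birth (i : ℕ) : Event := ⟨.birth, i⟩
abbrev join (i : ℕ) : Event := ⟨.join, i⟩
abbrev vertex (x : Vertex) (i : ℕ) : Event := ⟨.vertex x, i⟩

/-- Move a piece `k` strands to the right. -/
def Event.shift (k : ℕ) (e : Event) : Event := ⟨e.piece, k + e.pos⟩

/-- Run through a word starting with `n` strands; the result is the final number of strands, or
`none` if some piece does not find the strands it needs. -/
def run : List Event → ℕ → Option ℕ
  | [], n => some n
  | e :: w, n =>
    if e.pos + e.piece.ins ≤ n then run w (n - e.piece.ins + e.piece.outs) else none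

/-- A marked graph diagram. -/
structure Diagram where
  word : List Event
  closed : run word 0 = some 0

/-- The local replacements.  The first six generate planar isotopy, the others are the
Reidemeister moves and the moves involving marked vertices. -/
inductive LocalMove : List Event → List Event → Prop
  /-- Pieces with disjoint strands may be passed in height: `e` with `d` strands between it and
  the piece `f` on its right. -/
  | slide (e f : Piece) (d : ℕ) :
      LocalMove [⟨e, 0⟩, ⟨f, e.outs + d⟩] [⟨f, e.ins + d⟩, ⟨e, 0⟩]
  /-- A strand may be bent into an S or into its mirror image. -/
  | zigzag_left : LocalMove [] [birth 1, join 0]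
  | zigzag_right : LocalMove [] [birth 0, join 1]
  /-- A vertex may be turned by a quarter turn. -/
  | turn_join (x : Vertex) : LocalMove [vertex x 1, join 0] [vertex x.rot 0, join 1]
  | turn_birth (x : Vertex) : LocalMove [birth 0, vertex x 1] [birth 1, vertex x.rot 0]
  /-- `Γ₁`: removing a kink with a crossing. -/
  | gamma1 (a : Bool) : LocalMove [vertex (.crossing a) 0, join 0] [join 0]
  /-- `Γ₂`: separating two arcs, one of which lies over the other. -/
  | gamma2 (a : Bool) : LocalMove [vertex (.crossing a) 0, vertex (.crossing !a) 0] []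
  /-- `Γ₃`: three strands, at different heights; the condition excludes exactly the two
  cyclic (non-layered) patterns. -/
  | gamma3 (a b c : Bool) (h : a = b ∨ b = c) :
      LocalMove [vertex (.crossing a) 0, vertex (.crossing b) 1, vertex (.crossing c) 0]
        [vertex (.crossing c) 1, vertex (.crossing b) 0, vertex (.crossing a) 1]
  /-- `Γ₄`, `Γ₄'`: a strand passes over or under a marked vertex. -/
  | gamma4 (m a : Bool) :
      LocalMove [vertex (.marked m) 0, vertex (.crossing a) 1, vertex (.crossing a) 0]
        [vertex (.crossing a) 1, vertex (.crossing a) 0, vertex (.marked m) 1]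
  /-- `Γ₅`: a marked vertex is turned over, moving a crossing of two of its legs to the
  opposite pair of legs. -/
  | gamma5 (m a : Bool) :
      LocalMove [vertex (.marked m) 0, vertex (.crossing a) 0]
        [vertex (.crossing a) 0, vertex (.marked m) 0]
  /-- `Γ₆`, `Γ₆'`: removing a kink with a marked vertex, for both markers. -/
  | gamma6 (m : Bool) : LocalMove [vertex (.marked m) 0, join 0] [join 0]
  /-- `Γ₇`: two marked vertices with different markers exchange their order along a strand. -/
  | gamma7 (m : Bool) :
      LocalMove [vertex (.marked m) 0, vertex (.marked !m) 1]
        [vertex (.marked !m) 1, vertex (.marked m) 0]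
  /-- `Γ₈`: a pair of strands ending in a marked vertex lies over, or under, a second pair of
  strands ending in a marked vertex with the other marker. -/
  | gamma8 (m : Bool) :
      LocalMove
        [vertex (.crossing true) 1, vertex (.crossing true) 0, vertex (.crossing true) 2,
          vertex (.crossing true) 1, vertex (.marked m) 0, vertex (.marked !m) 2]
        [vertex (.crossing false) 1, vertex (.crossing false) 0, vertex (.crossing false) 2,
          vertex (.crossing false) 1, vertex (.marked m) 0, vertex (.marked !m) 2]

/-- One local replacement inside a diagram.  Both sides are required to be diagrams, so a
strand is present wherever the replacement needs one. -/
def Diagram.Move (D E : Diagram) : Prop :=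
  ∃ (u l r w : List Event) (k : ℕ), LocalMove l r ∧
    D.word = u ++ l.map (Event.shift k) ++ w ∧ E.word = u ++ r.map (Event.shift k) ++ w

/-- Marked graph diagrams up to planar isotopy and Yoshikawa moves; the classes of diagrams both
of whose resolutions are trivial links are the surface-links in 4-space up to ambient isotopy.
`Quot` passes to the equivalence relation generated by the moves. -/
def LinkClass : Type := Quot Diagram.Move

def Diagram.toLink (D : Diagram) : LinkClass := Quot.mk _ D

/-- The thirteen mosaic tiles; the connection points are the midpoints of the four sides. -/
inductive Tile where
  | empty
  | leftBottom
  | rightBottom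
  | rightTop
  | leftTop
  | horizontal
  | vertical
  /-- two arcs: left–top and right–bottom -/
  | twoArcs₁
  /-- two arcs: left–bottom and right–top -/
  | twoArcs₂
  /-- `crossing true`: the horizontal strand is over; `crossing false`: the vertical one -/
  | crossing (horizontalOver : Bool)
  /-- `marked true`: the positive resolution is `twoArcs₂` and the negative one `twoArcs₁`;
  `marked false`: the other way round -/
  | marked (marker : Bool)

def Tile.hasLeft : Tile → Bool
  | .empty | .rightBottom | .rightTop | .vertical => false
  | _ => true

def Tile.hasRight : Tile → Bool
  | .empty | .leftBottom | .leftTop | .vertical => false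
  | _ => true

def Tile.hasTop : Tile → Bool
  | .empty | .leftBottom | .rightBottom | .horizontal => false
  | _ => true

def Tile.hasBottom : Tile → Bool
  | .empty | .rightTop | .leftTop | .horizontal => false
  | _ => true

/-- An `n`-mosaic; rows are counted from the top and columns from the left. -/
abbrev Mosaic (n : ℕ) : Type := Matrix (Fin n) (Fin n) Tile

/-- Every connection point of every tile touches a connection point of a contiguous tile. -/
def Mosaic.SuitablyConnected {n : ℕ} (M : Mosaic n) : Prop :=
  ∀ r c : Fin n,
    ((M r c).hasLeft = true → ∃ c' : Fin n, c'.val + 1 = c.val ∧ (M r c').hasRight = true) ∧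
    ((M r c).hasRight = true → ∃ c' : Fin n, c'.val = c.val + 1 ∧ (M r c').hasLeft = true) ∧
    ((M r c).hasTop = true → ∃ r' : Fin n, r'.val + 1 = r.val ∧ (M r' c).hasBottom = true) ∧
    ((M r c).hasBottom = true → ∃ r' : Fin n, r'.val = r.val + 1 ∧ (M r' c).hasTop = true)

/-- The picture on a tile as a word.  The mosaic is turned clockwise by 45 degrees, so that the
left, top, bottom and right sides become upper left, upper right, lower left and lower right. -/
def Tile.word : Tile → List Event
  | .leftTop => [join 0]
  | .rightBottom => [birth 0]
  | .twoArcs₁ => [join 0, birth 0]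
  | .crossing b => [vertex (.crossing b) 0]
  | .marked b => [vertex (.marked b) 0]
  | _ => []

/-- The number of strands to the left of the tile in row `r` and column `c` when the mosaic is
read row by row: they leave the tiles of the same row to the left of it through their bottom
sides. -/
def Mosaic.strandsBefore {n : ℕ} (M : Mosaic n) (r c : Fin n) : ℕ :=
  (Finset.univ.filter fun c' : Fin n => c' < c ∧ (M r c').hasBottom = true).card

/-- The marked graph diagram drawn on a mosaic, read row by row, each row from left to right. -/
def Mosaic.word {n : ℕ} (M : Mosaic n) : List Event :=
  (List.finRange n).flatMap fun r => (List.finRange n).flatMap fun c =>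
    (M r c).word.map (Event.shift (M.strandsBefore r c))

/-- The mosaic `M` represents the class `K`. -/
def Mosaic.Represents {n : ℕ} (M : Mosaic n) (K : LinkClass) : Prop :=
  M.SuitablyConnected ∧ ∃ D : Diagram, D.word = M.word ∧ D.toLink = K

/-- The mosaic number: the smallest `n` such that `K` is represented by an `n`-mosaic. -/
noncomputable def mosaicNumber (K : LinkClass) : ℕ :=
  sInf {n : ℕ | ∃ M : Mosaic n, M.Represents K}

/-- Names for the surface-links of ch-index at most ten in Yoshikawa's table: `kN_i_a_b` stands
for `N_i^{a,b}`, where `p` and `m` give the sign of an upper index. -/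
inductive Yoshikawa where
  | k0_1
  | k2_1_p1
  | k2_1_m1
  | k6_1_0_p1
  | k7_1_0_m2
  | k8_1
  | k8_1_p1_p1
  | k8_1_m1_m1
  | k9_1
  | k9_1_0_p1
  | k9_1_p1_m2
  | k10_1
  | k10_2
  | k10_3
  | k10_1_p1
  | k10_1_0_p1
  | k10_2_0_p1
  | k10_1_p1_p1
  | k10_1_0_0_p1
  | k10_1_0_m2
  | k10_2_0_m2
  | k10_1_m1_m1
  | k10_1_m2_m2
  deriving DecidableEq

namespace Table

/-- Local maximum. -/
abbrev b (i : ℕ) : Event := birth i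
/-- Local minimum. -/
abbrev j (i : ℕ) : Event := join i
/-- Crossing with the strand UL–LR over. -/
abbrev p (i : ℕ) : Event := vertex (.crossing true) i
/-- Crossing with the strand UR–LL over. -/
abbrev n (i : ℕ) : Event := vertex (.crossing false) i
/-- Marked vertex whose positive resolution consists of two vertical strands. -/
abbrev v (i : ℕ) : Event := vertex (.marked true) i
/-- Marked vertex whose negative resolution consists of two vertical strands. -/
abbrev h (i : ℕ) : Event := vertex (.marked false) i

end Table

section

open Table

/-- A diagram with the minimal number of vertices (the ch-index, which is the main number in the
name) for each surface-link in the table, up to mirror image. -/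
def Yoshikawa.word : Yoshikawa → List Event
  -- trivial 2-sphere
  | .k0_1 => [b 0, j 0]
  -- standard torus
  | .k2_1_p1 => [b 0, b 1, v 0, h 0, j 1, j 0]
  -- standard projective plane
  | .k2_1_m1 => [b 0, b 1, p 0, v 0, j 1, j 0]
  -- sphere and torus: spun Hopf link
  | .k6_1_0_p1 => [b 0, b 2, p 1, p 1, b 1, v 0, h 2, j 1, n 1, n 1, j 0, j 0]
  -- sphere and Klein bottle
  | .k7_1_0_m2 => [b 0, b 0, n 1, b 0, n 1, n 2, p 1, v 0, h 0, p 1, j 2, j 1, j 0]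
  -- sphere: spun trefoil
  | .k8_1 => [b 0, b 2, p 1, p 1, p 1, b 1, v 0, h 2, j 1, n 1, n 1, n 1, j 0, j 0]
  -- two tori: Hopf link spun off an axis disjoint from it
  | .k8_1_p1_p1 => [b 0, b 2, p 1, p 1, b 1, v 0, h 2, j 1, b 3, v 2, h 4, j 3, n 1, n 1, j 0, j 0]
  -- two projective planes
  | .k8_1_m1_m1 => [b 0, b 0, b 1, p 2, n 1, b 2, v 3, p 3, j 4, p 3, n 2, n 1, h 0, j 1, j 1, j 0]
  -- sphere
  | .k9_1 => [b 0, b 0, v 1, n 0, v 2, b 0, n 1, n 2, p 3, n 2, n 1, p 0, j 1, j 1, j 0]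
  -- sphere and torus
  | .k9_1_0_p1 => [b 0, b 0, p 1, n 0, b 1, p 2, n 1, h 0, v 0, p 2, n 1, n 1, j 2, j 1, j 0]
  -- torus and Klein bottle
  | .k9_1_p1_m2 => [b 0, b 0, v 1, n 0, v 2, b 0, n 1, p 0, b 1, h 2, v 2, j 3, n 2, p 1, j 2, j 1, j 0]
  -- sphere: spun figure-eight knot
  | .k10_1 => [b 0, b 2, p 1, p 1, n 0, p 1, b 1, v 0, h 2, j 1, n 1, p 0, n 1, n 1, j 0, j 0]
  -- sphere: 2-twist-spun trefoil
  | .k10_2 => [b 0, b 0, b 1, n 2, p 1, p 1, b 2, n 3, v 3, j 4, n 3, n 3, p 2, v 1, n 0, j 1, j 1, j 0]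
  -- sphere: 3-twist-spun trefoil
  | .k10_3 => [b 0, b 0, p 1, n 2, b 1, p 2, n 1, v 0, h 3, p 2, n 1, j 2, p 1, n 0, j 1, j 0]
  -- torus: trefoil spun off an axis disjoint from it
  | .k10_1_p1 => [b 0, b 2, p 1, p 1, p 1, b 1, v 0, h 2, j 1, b 3, v 2, h 4, j 3, n 1, n 1, n 1, j 0, j 0]
  -- sphere and torus: spun (2,4)-torus link
  | .k10_1_0_p1 => [b 0, b 0, b 1, n 2, n 2, n 2, n 2, n 3, h 2, h 1, p 0, p 0, p 0, j 2, j 1, j 0]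
  -- sphere and torus
  | .k10_2_0_p1 => [b 0, b 0, v 1, v 2, b 0, n 1, p 0, n 2, p 1, p 1, p 0, p 0, p 1, j 2, j 1, j 0]
  -- two tori
  | .k10_1_p1_p1 => [b 0, b 0, b 1, b 2, p 3, v 4, p 3, v 2, p 3, j 4, h 3, p 2, h 1, p 0, n 1, j 2, j 1, j 0]
  -- two spheres and a torus
  | .k10_1_0_0_p1 => [b 0, b 0, b 1, p 2, b 2, n 3, n 3, p 4, v 5, n 4, p 3, n 2, p 1, v 0, j 3, j 2, j 1, j 0]
  -- sphere and Klein bottle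
  | .k10_1_0_m2 => [b 0, b 0, v 1, v 0, n 2, b 0, p 1, p 1, p 2, p 2, j 3, n 2, p 1, n 0, j 1, j 0]
  -- sphere and Klein bottle
  | .k10_2_0_m2 => [b 0, b 0, b 1, b 2, v 3, n 4, p 3, n 2, p 3, j 4, v 3, p 2, n 1, p 0, n 1, j 2, j 1, j 0]
  -- two projective planes
  | .k10_1_m1_m1 => [b 0, b 0, b 1, b 2, v 3, n 4, p 3, n 2, p 3, j 4, n 3, p 2, n 1, h 0, n 1, j 2, j 1, j 0]
  -- two Klein bottles
  | .k10_1_m2_m2 => [b 0, b 0, b 1, h 2, n 1, h 1, b 2, n 3, n 3, j 4, n 3, h 3, h 2, p 1, n 0, j 1, j 1, j 0]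

end

/-- The table as a list of diagrams. -/
def Yoshikawa.diagram (K : Yoshikawa) : Diagram :=
  ⟨K.word, by cases K <;> decide⟩

/-- The mosaic number of a surface-link in the table. -/
noncomputable def Yoshikawa.m (K : Yoshikawa) : ℕ := mosaicNumber K.diagram.toLink

end MarkedGraph

/-! The upper bounds are explicit mosaics. A table diagram and the diagram on its mosaic are two
words of pieces. Turning each vertex of the first by a prescribed number of quarter turns, and then
sliding pieces past each other and straightening bent strands in both, leads to the same word. So
the two diagrams differ by planar isotopy only, and this is checked by computation
(`represents_mosaic`).

The lower bounds come from counting labellings of a diagram by a finite symmetric quandle with `q`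
labels. A marked vertex is either kept, in which case its four labels must agree up to `bar`, or
resolved in one of the two ways, so a quandle gives three counts. The Yoshikawa moves preserve all
of them, with one exception: a `Γ₆`-move removes a marked vertex and, in exactly one of the two
resolutions, a separate circle, which costs that count a factor `q` (`total_localMove`). Hence the
singular count is an invariant of the class, and the counts of the resolutions are invariants up to
powers of `q` whose exponents do not depend on the quandle (`SameCounts`). The exponents also record
the change in the number of marked vertices, so the trivial quandle sees the Euler characteristic.

For the bound 6, call a diagram forced if it passes the following test (`Forced`): whenever both
resolutions have the counts of trivial links for the 3-cycles of the alternating group of degree 4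
and for the dihedral quandle of order 3, the singular diagram also looks unknotted and unlinked to
these quandles. Being forced depends only on the class. All the table diagrams except the first
three fail the test (`isComplicated_word`), while every diagram on a 5-mosaic passes it
(`forcedWord_of_stacked`); smaller mosaics are padded with empty tiles.

The statement about 5-mosaics is a finite search made feasible by meeting in the middle. The
labellings below the upper rows form a multiset, and so do those above the lower rows, because a
word read upside down has the transposed matrix of label counts (`app_ind`). The count of the closed
diagram is the inner product of the two multisets (`app_eq_inner`). So only the distinct multisets
are kept, for three upper and for two lower rows, and all pairs are tested. Common factors `q` are
divided out, and on the upper side labellings are replaced by representatives under quandle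
automorphisms; neither affects the test.

For the bound 4, the trivial quandle shows that a connected surface on a 3-mosaic has Euler
characteristic 2 (`isSpherical_of_stacked`), unlike the torus and the projective plane. For the
bound 2, a 1-mosaic is empty and has one labelling instead of three. -/

noncomputable section

namespace MarkedGraph

/-! ### Symmetric quandles and sums over labellings -/

/-- A finite symmetric quandle on the labels `0, …, q - 1`; `bar` is the good involution. -/
structure SymQuandle (q : ℕ) where
  act : Fin q → Fin q → Fin q
  bar : Fin q → Fin q
  act_self : ∀ a, act a a = a
  bar_bar : ∀ a, bar (bar a) = a
  act_bar : ∀ a c, act a (bar c) = bar (act a c)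
  bar_act_act : ∀ a c, act (bar a) (act a c) = c
  act_act : ∀ a c d, act a (act c d) = act (act a c) (act a d)

/-- What is done at the marked vertices: they are kept, or resolved in one of the two ways. -/
inductive Smoothing where
  | singular
  | positive
  | negative

/-- The pieces that remain after the marked vertices have been treated; `glue` is a vertex at which
the four labels are required to agree. -/
inductive Op where
  | birth
  | join
  | cross (b : Bool)
  | glue

/-- The pieces left of an event. -/
def Smoothing.resolve (κ : Smoothing) (e : Event) : List (Op × ℕ) :=
  match e.piece, κ with
  | .birth, _ => [(.birth, e.pos)]
  | .join, _ => [(.join, e.pos)]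
  | .vertex (.crossing b), _ => [(.cross b, e.pos)]
  | .vertex (.marked _), .singular => [(.glue, e.pos)]
  | .vertex (.marked true), .positive => []
  | .vertex (.marked false), .positive => [(.join, e.pos), (.birth, e.pos)]
  | .vertex (.marked true), .negative => [(.join, e.pos), (.birth, e.pos)]
  | .vertex (.marked false), .negative => []

namespace SymQuandle

variable {q : ℕ} (Q : SymQuandle q)

theorem act_bar_act (a c : Fin q) : Q.act a (Q.act (Q.bar a) c) = c := by
  simpa only [Q.bar_bar] using Q.bar_act_act (Q.bar a) c

theorem act_right_injective {a c d : Fin q} (h : Q.act a c = Q.act a d) : c = d := by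
  rw [← Q.bar_act_act a c, h, Q.bar_act_act]

theorem act_self_bar (a : Fin q) : Q.act a (Q.bar a) = Q.bar a := by
  rw [Q.act_bar, Q.act_self]

/-- The labellings below a piece on the leftmost strands that extend a labelling above it. -/
def loc : Op → List (Fin q) → List (List (Fin q))
  | .birth, s => (List.finRange q).map fun x => x :: Q.bar x :: s
  | .join, a :: c :: s => if c = Q.bar a then [s] else []
  | .cross true, a :: c :: s => [Q.act a c :: a :: s]
  | .cross false, a :: c :: s => [c :: Q.act (Q.bar c) a :: s]
  | .glue, a :: c :: s => if c = Q.bar a then [a :: c :: s] else []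
  | _, _ => []

/-- The labellings below a piece that extend a labelling above it. -/
def ev (x : Op × ℕ) (s : List (Fin q)) : List (List (Fin q)) :=
  (Q.loc x.1 (s.drop x.2)).map (s.take x.2 ++ ·)

/-- The sum of `f` over the labellings below a word that extend a labelling above it. -/
def app : List (Op × ℕ) → (List (Fin q) → ℕ) → List (Fin q) → ℕ
  | [], f, s => f s
  | x :: w, f, s => ((Q.ev x s).map (app w f)).sum

theorem app_append (u w : List (Op × ℕ)) (f : List (Fin q) → ℕ) (s : List (Fin q)) :
    Q.app (u ++ w) f s = Q.app u (Q.app w f) s := by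
  induction u generalizing s with
  | nil => rfl
  | cons x u ih => simp only [List.cons_append, app]; congr 2; funext t; exact ih t

/-- The same for a word of events. -/
def total (κ : Smoothing) (w : List Event) : (List (Fin q) → ℕ) → List (Fin q) → ℕ :=
  Q.app (w.flatMap κ.resolve)

variable (κ : Smoothing)

theorem total_append (u w : List Event) (f : List (Fin q) → ℕ) :
    Q.total κ (u ++ w) f = Q.total κ u (Q.total κ w f) := by
  funext s; simp only [total, List.flatMap_append, app_append]

theorem total_cons (e : Event) (w : List Event) (f : List (Fin q) → ℕ) :
    Q.total κ (e :: w) f = Q.total κ [e] (Q.total κ w f) := Q.total_append κ [e] w f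

/-- The strands `p` to the left of all pieces are spectators, so they can be absorbed into the
function that is summed. -/
theorem app_shift (k : ℕ) (w : List (Op × ℕ)) (f : List (Fin q) → ℕ) (p s : List (Fin q))
    (hp : p.length = k) :
    Q.app (w.map fun x => (x.1, k + x.2)) f (p ++ s) = Q.app w (fun t => f (p ++ t)) s := by
  induction w generalizing s with
  | nil => rfl
  | cons x w ih =>
    subst hp
    simp only [List.map_cons, app, ev, List.drop_append, List.take_append, List.map_map,
      Nat.add_sub_cancel_left, List.take_of_length_le (Nat.le_add_right _ _),
      List.drop_eq_nil_of_le (Nat.le_add_right _ _), List.nil_append]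
    congr 2
    funext t
    simp only [Function.comp, List.append_assoc, ih]

theorem resolve_shift (k : ℕ) (e : Event) :
    κ.resolve (e.shift k) = (κ.resolve e).map fun x => (x.1, k + x.2) := by
  rcases e with ⟨_ | _ | _ | m, i⟩ <;> rcases κ <;> first | rfl | (cases m <;> rfl)

theorem total_shift (k : ℕ) (w : List Event) (f : List (Fin q) → ℕ) (p s : List (Fin q))
    (hp : p.length = k) :
    Q.total κ (w.map (Event.shift k)) f (p ++ s) = Q.total κ w (fun t => f (p ++ t)) s := by
  rw [total, total, ← Q.app_shift k _ f p s hp]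
  congr 1
  simp only [List.flatMap_map, resolve_shift, List.map_flatMap]

/-- Only the labellings of the right length matter. -/
theorem total_congr {w : List Event} {n m : ℕ} (h : run w n = some m) {f g : List (Fin q) → ℕ}
    (hfg : ∀ t, t.length = m → f t = g t) {s : List (Fin q)} (hs : s.length = n) :
    Q.total κ w f s = Q.total κ w g s := by
  induction w generalizing n s with
  | nil => simp only [run, Option.some.injEq] at h; exact hfg _ (hs.trans h)
  | cons e w ih =>
    rw [total_cons, Q.total_cons κ e w g]
    simp only [run] at h
    split at h
    · rename_i hle
      have key : ∀ F G : List (Fin q) → ℕ,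
          (∀ t, t.length = n - e.piece.ins + e.piece.outs → F t = G t) →
          Q.total κ [e] F s = Q.total κ [e] G s := by
        intro F G hFG
        obtain ⟨p, i⟩ := e
        obtain ⟨a, b, rfl, ha⟩ : ∃ a b, s = a ++ b ∧ a.length = i :=
          ⟨s.take i, s.drop i, (List.take_append_drop _ _).symm, by
            simp only at hle ⊢; rw [List.length_take]; omega⟩
        have hsh : [(⟨p, i⟩ : Event)] = [(⟨p, 0⟩ : Event)].map (Event.shift i) := by
          simp [Event.shift]
        rw [hsh, Q.total_shift κ i _ _ a b ha, Q.total_shift κ i _ _ a b ha]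
        simp only [List.length_append] at hs
        rcases p with _ | _ | x | m
        · simp only [total, Smoothing.resolve, List.flatMap_cons, List.flatMap_nil, List.append_nil,
            app, ev, loc, List.map_map, List.take_zero, List.drop_zero, List.nil_append]
          congr 2; funext x
          exact hFG _ (by simp [Piece.ins, Piece.outs]; omega)
        all_goals
          obtain ⟨x₁, x₂, b, rfl⟩ : ∃ x y c, b = x :: y :: c := by
            rcases b with _ | ⟨x, _ | ⟨y, c⟩⟩
            · simp [Piece.ins] at hle hs; omega
            · simp [Piece.ins] at hle hs; omega
            · exact ⟨x, y, c, rfl⟩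
          simp only [List.length_cons, Piece.ins, Piece.outs] at hs hFG
        · simp only [total, Smoothing.resolve, List.flatMap_cons, List.flatMap_nil, List.append_nil,
            app, ev, loc, List.map_map, List.take_zero, List.drop_zero]
          split
          · simp; exact hFG _ (by simp; omega)
          · rfl
        · rcases x with _ | _ <;>
          · simp [total, Smoothing.resolve, app, ev, loc]
            exact hFG _ (by simp; omega)
        · rcases κ with _ | _ | _
          · simp only [total, Smoothing.resolve, List.flatMap_cons, List.flatMap_nil,
              List.append_nil, app, ev, loc, List.map_map, List.take_zero, List.drop_zero]
            split
            · simp; exact hFG _ (by simp; omega)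
            · rfl
          all_goals
            rcases m with _ | _ <;>
              simp only [total, Smoothing.resolve, List.flatMap_cons, List.flatMap_nil,
                List.append_nil, app, ev, loc, List.map_map, List.take_zero, List.drop_zero] <;>
              first
              | exact hFG _ (by simp; omega)
              | (split
                 · simp only [List.map_cons, List.map_nil, List.sum_cons, List.sum_nil,
                     List.nil_append, Nat.add_zero]
                   refine congrArg List.sum (List.map_congr_left fun x _ => ?_)
                   exact hFG _ (by simp; omega)
                 · rfl)
      exact key _ _ fun t ht => ih h ht
    · exact absurd h (by simp)

end SymQuandle

/-- The number of marked vertices. -/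
def marks (w : List Event) : ℕ :=
  w.countP fun e => match e.piece with
    | .vertex (.marked _) => true
    | _ => false

/-! ### Linearity of the sums, and sliding of pieces -/

namespace SymQuandle

variable {q : ℕ} (Q : SymQuandle q) (κ : Smoothing)

theorem sum_finRange (f : Fin q → ℕ) : ((List.finRange q).map f).sum = ∑ i, f i :=
  (Fin.sum_univ_def f).symm

theorem app_zero (v : List (Op × ℕ)) (s : List (Fin q)) : Q.app v (fun _ => 0) s = 0 := by
  induction v generalizing s with
  | nil => rfl
  | cons x v ih => simp [app, funext ih]

theorem app_add (v : List (Op × ℕ)) (f g : List (Fin q) → ℕ) (s : List (Fin q)) :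
    Q.app v (fun t => f t + g t) s = Q.app v f s + Q.app v g s := by
  induction v generalizing s with
  | nil => rfl
  | cons x v ih => simp only [app, funext ih, List.sum_map_add]

theorem app_mul (v : List (Op × ℕ)) (c : ℕ) (f : List (Fin q) → ℕ) (s : List (Fin q)) :
    Q.app v (fun t => c * f t) s = c * Q.app v f s := by
  induction v generalizing s with
  | nil => rfl
  | cons x v ih => simp only [app, funext ih, List.sum_map_mul_left]

theorem app_sum_map {α : Type} (v : List (Op × ℕ)) (l : List α) (F : α → List (Fin q) → ℕ)
    (s : List (Fin q)) :
    Q.app v (fun t => (l.map fun z => F z t).sum) s = (l.map fun z => Q.app v (F z) s).sum := by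
  induction l with
  | nil => exact Q.app_zero v s
  | cons z l ih => simp only [List.map_cons, List.sum_cons, app_add, ih]

/-- Fubini for two words acting on disjoint groups of strands; this is what makes sliding harmless.
-/
theorem app_comm (u v : List (Op × ℕ)) (F : List (Fin q) → List (Fin q) → ℕ)
    (s t : List (Fin q)) :
    Q.app u (fun x => Q.app v (F x) t) s = Q.app v (fun y => Q.app u (fun x => F x y) s) t := by
  induction u generalizing s with
  | nil => rfl
  | cons x u ih => simp only [app, funext ih, app_sum_map]

/-- A piece does not see the strands on its right. -/
theorem total_slide (e f : Piece) (d : ℕ) (g : List (Fin q) → ℕ) (s : List (Fin q))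
    (hs : e.ins + d + f.ins ≤ s.length) :
    Q.total κ [⟨e, 0⟩, ⟨f, e.outs + d⟩] g s = Q.total κ [⟨f, e.ins + d⟩, ⟨e, 0⟩] g s := by
  have key : ∀ (e : Piece) (F : List (Fin q) → ℕ) (a r : List (Fin q)), a.length = e.ins →
      Q.total κ [⟨e, 0⟩] F (a ++ r) = Q.total κ [⟨e, 0⟩] (fun t => F (t ++ r)) a := by
    intro e F a r ha
    rcases e with _ | _ | _ | m
    · rw [List.length_eq_zero_iff.1 ha]
      simp [total, Smoothing.resolve, app, ev, loc, Function.comp_def]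
    all_goals
      obtain ⟨x, y, rfl⟩ := List.length_eq_two.1 ha
    · simp only [total, Smoothing.resolve, List.flatMap_cons, List.flatMap_nil, List.append_nil,
        app, ev, loc, List.take_zero, List.drop_zero, List.cons_append, List.nil_append]
      split <;> simp
    · rename_i b; cases b <;> simp [total, Smoothing.resolve, app, ev, loc]
    · cases κ <;> cases m <;>
        simp only [total, Smoothing.resolve, List.flatMap_cons, List.flatMap_nil, List.append_nil,
          app, ev, loc, List.take_zero, List.drop_zero, List.cons_append, List.nil_append] <;>
        split <;> simp [Function.comp_def]
  obtain ⟨a, r, rfl, ha⟩ : ∃ a r, s = a ++ r ∧ a.length = e.ins :=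
    ⟨s.take e.ins, s.drop e.ins, (List.take_append_drop _ _).symm, by
      rw [List.length_take]; omega⟩
  obtain ⟨b, c, rfl, hb⟩ : ∃ b c, r = b ++ c ∧ b.length = d :=
    ⟨r.take d, r.drop d, (List.take_append_drop _ _).symm, by
      rw [List.length_take]; simp only [List.length_append] at hs; omega⟩
  have hsh : ∀ n, [(⟨f, n⟩ : Event)] = [(⟨f, 0⟩ : Event)].map (Event.shift n) := by
    simp [Event.shift]
  have hrun : run [⟨e, 0⟩] e.ins = some e.outs := by simp [run]
  calc
    _ = Q.total κ [⟨e, 0⟩] (fun t => Q.total κ [⟨f, 0⟩] (fun u => g (t ++ (b ++ u))) c) a := by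
      rw [total_cons, key _ _ _ _ ha]
      refine Q.total_congr κ hrun (fun t ht => ?_) ha
      rw [hsh, ← List.append_assoc, Q.total_shift κ _ _ _ (t ++ b) c (by simp [ht, hb])]
      simp only [List.append_assoc]
    _ = Q.total κ [⟨f, 0⟩] (fun u => Q.total κ [⟨e, 0⟩] (fun t => g (t ++ (b ++ u))) a) c :=
      Q.app_comm _ _ (fun t u => g (t ++ (b ++ u))) a c
    _ = _ := by
      rw [Q.total_cons κ ⟨f, e.ins + d⟩, hsh (e.ins + d), ← List.append_assoc,
        Q.total_shift κ _ _ _ (a ++ b) c (by simp [ha, hb])]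
      congr 1
      funext u
      rw [List.append_assoc, key _ _ _ _ ha]

end SymQuandle

/-! ### Label counts under the local moves -/

namespace SymQuandle
variable {q : ℕ} (Q : SymQuandle q) (κ : Smoothing)

theorem eq_bar_comm {a c : Fin q} : c = Q.bar a ↔ a = Q.bar c :=
  ⟨fun h => by rw [h, Q.bar_bar], fun h => by rw [h, Q.bar_bar]⟩

theorem act_eq_iff {a c d : Fin q} : Q.act a c = d ↔ c = Q.act (Q.bar a) d :=
  ⟨fun h => by rw [← h, Q.bar_act_act], fun h => by rw [h, Q.act_bar_act]⟩

theorem bar_act_bar (a : Fin q) : Q.act (Q.bar a) (Q.bar a) = Q.bar a := Q.act_self _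

theorem act_bijective (a : Fin q) : Function.Bijective (Q.act a) :=
  ⟨fun _ _ => Q.act_right_injective, fun c => ⟨_, Q.act_bar_act a c⟩⟩

theorem act_act_bar (a c d : Fin q) :
    Q.act (Q.bar (Q.act a c)) (Q.act a d) = Q.act a (Q.act (Q.bar c) d) := by
  rw [← Q.act_bar, ← Q.act_act]

/-- The action of a label is bijective and fixes the label and its `bar`. Hence two strands can be
joined after crossing each other exactly when they could be joined before; `Γ₁` and `Γ₅` rest on
this. -/
theorem bar_act_iff {a b : Fin q} : Q.act (Q.bar b) a = Q.bar b ↔ b = Q.bar a := by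
  rw [Q.act_eq_iff, Q.bar_bar, Q.act_self_bar, Q.eq_bar_comm]

theorem bar_act_iff' {a b : Fin q} : a = Q.bar (Q.act a b) ↔ b = Q.bar a := by
  rw [Q.eq_bar_comm, Q.act_eq_iff, Q.bar_act_bar]

theorem act_eq_bar_act {a b c : Fin q} : Q.act c b = Q.bar (Q.act c a) ↔ b = Q.bar a := by
  rw [← Q.act_bar]; exact ⟨Q.act_right_injective, congrArg _⟩

/-- Passing a newborn arc over or under another strand only permutes the labels over which the sum
runs. -/
theorem sum_act (a : Fin q) (F : Fin q → Fin q → ℕ) :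
    ∑ x, F (Q.act a x) (Q.act a (Q.bar x)) = ∑ x, F x (Q.bar x) :=
  Fintype.sum_bijective _ (Q.act_bijective a) _ _ fun x => by rw [Q.act_bar]

theorem sum_bar (F : Fin q → Fin q → ℕ) : ∑ x, F (Q.bar x) x = ∑ x, F x (Q.bar x) :=
  Fintype.sum_bijective Q.bar (Function.Involutive.bijective Q.bar_bar) _ _
    fun x => by rw [Q.bar_bar]

/-- The sum of `f` over the labellings below a piece. -/
def one (x : Op × ℕ) (f : List (Fin q) → ℕ) (s : List (Fin q)) : ℕ := ((Q.ev x s).map f).sum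

theorem app_cons (x : Op × ℕ) (w : List (Op × ℕ)) (f : List (Fin q) → ℕ) (s : List (Fin q)) :
    Q.app (x :: w) f s = Q.one x (Q.app w f) s := rfl

theorem app_nil (f : List (Fin q) → ℕ) (s : List (Fin q)) : Q.app [] f s = f s := rfl

theorem one_succ (o : Op) (i : ℕ) (f : List (Fin q) → ℕ) (a : Fin q) (s : List (Fin q)) :
    Q.one (o, i + 1) f (a :: s) = Q.one (o, i) (fun t => f (a :: t)) s := by
  simp [one, ev, Function.comp_def]

theorem one_one (o : Op) (f : List (Fin q) → ℕ) (a : Fin q) (s : List (Fin q)) :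
    Q.one (o, 1) f (a :: s) = Q.one (o, 0) (fun t => f (a :: t)) s := Q.one_succ o 0 f a s

theorem one_two (o : Op) (f : List (Fin q) → ℕ) (a b : Fin q) (s : List (Fin q)) :
    Q.one (o, 2) f (a :: b :: s) = Q.one (o, 0) (fun t => f (a :: b :: t)) s := by
  rw [Q.one_succ o 1, one_one]

theorem one_birth (f : List (Fin q) → ℕ) (s : List (Fin q)) :
    Q.one (.birth, 0) f s = ∑ x, f (x :: Q.bar x :: s) := by
  simp [one, ev, loc, sum_finRange, Function.comp_def]

theorem one_join (f : List (Fin q) → ℕ) (a c : Fin q) (s : List (Fin q)) :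
    Q.one (.join, 0) f (a :: c :: s) = if c = Q.bar a then f s else 0 := by
  simp only [one, ev, loc, List.take_zero, List.drop_zero]
  split <;> simp

theorem one_glue (f : List (Fin q) → ℕ) (a c : Fin q) (s : List (Fin q)) :
    Q.one (.glue, 0) f (a :: c :: s) = if c = Q.bar a then f (a :: c :: s) else 0 := by
  simp only [one, ev, loc, List.take_zero, List.drop_zero]
  split <;> simp

theorem one_cross_true (f : List (Fin q) → ℕ) (a c : Fin q) (s : List (Fin q)) :
    Q.one (.cross true, 0) f (a :: c :: s) = f (Q.act a c :: a :: s) := by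
  simp [one, ev, loc]

theorem one_cross_false (f : List (Fin q) → ℕ) (a c : Fin q) (s : List (Fin q)) :
    Q.one (.cross false, 0) f (a :: c :: s) = f (c :: Q.act (Q.bar c) a :: s) := by
  simp [one, ev, loc]

set_option linter.unusedSimpArgs false in
/-- How often a Γ₆-move closes a component of the smoothing `κ`. -/
theorem total_localMove {l r : List Event} (h : LocalMove l r) :
    ∃ ε : Smoothing → ℕ, ε .singular = 0 ∧
      marks l = marks r + ε .positive + ε .negative ∧
      ∀ (q : ℕ) (Q : SymQuandle q) (κ : Smoothing) (f : List (Fin q) → ℕ) (s : List (Fin q))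
        (m m' : ℕ), run l s.length = some m → run r s.length = some m' →
        Q.total κ l f s = q ^ ε κ * Q.total κ r f s := by
  -- `Γ₆` is the only move that changes a count, so it is treated apart; all others have the
  -- exponent zero.
  by_cases h6 : ∃ m, l = [vertex (.marked m) 0, join 0] ∧ r = [join 0]
  · obtain ⟨m, rfl, rfl⟩ := h6
    -- In one resolution the vertex becomes a join followed by a birth, and the following join
    -- closes this birth to a circle with a free label. The marker decides which resolution it is.
    refine ⟨fun κ => match κ, m with
      | .positive, false => 1 | .negative, true => 1 | _, _ => 0, rfl,
      by cases m <;> rfl, ?_⟩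
    intro q Q κ f s _ _ _ _
    rcases s with _ | ⟨a, _ | ⟨c, s⟩⟩
    · cases κ <;> cases m <;> simp [total, Smoothing.resolve, app, ev, loc]
    · cases κ <;> cases m <;> simp [total, Smoothing.resolve, app, ev, loc]
    · cases κ <;> cases m <;> by_cases hc : c = Q.bar a <;>
        simp [total, Smoothing.resolve, app, ev, loc, hc, Function.comp_def]
  · refine ⟨fun _ => 0, rfl, ?_, ?_⟩
    · cases h <;> first | rfl | (exfalso; exact h6 ⟨_, rfl, rfl⟩) | skip
      · rename_i e f d
        simp only [marks, List.countP_cons, List.countP_nil]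
        omega
      all_goals
        rename_i x
        cases x <;> rfl
    intro q Q κ f s m m' hl hr
    rw [pow_zero, one_mul]
    cases h with
    | slide e f d =>
      refine Q.total_slide κ e f d _ s ?_
      simp only [run] at hr
      split at hr <;> [skip; exact absurd hr (by simp)]
      omega
    | gamma6 m => exact absurd ⟨m, rfl, rfl⟩ h6
    | zigzag_left =>
      rcases s with _ | ⟨a, s⟩
      · simp [run, Piece.ins] at hr
      · simp only [total, Smoothing.resolve, List.flatMap_cons, List.flatMap_nil, List.append_nil,
          List.cons_append, List.nil_append, app_cons, app_nil, one_one, one_two, one_birth,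
          one_join, one_glue, one_cross_true, one_cross_false, Vertex.rot, Bool.not_true,
          Bool.not_false]
        simp [Q.bar_bar, apply_ite]
    | zigzag_right =>
      rcases s with _ | ⟨a, s⟩
      · simp [run, Piece.ins, Piece.outs] at hr
      · simp only [total, Smoothing.resolve, List.flatMap_cons, List.flatMap_nil, List.append_nil,
          List.cons_append, List.nil_append, app_cons, app_nil, one_one, one_two, one_birth,
          one_join, one_glue, one_cross_true, one_cross_false, Vertex.rot, Bool.not_true,
          Bool.not_false]
        simp [Q.bar_bar, eq_comm]
    | turn_join x =>
      rcases s with _ | ⟨a, _ | ⟨b, _ | ⟨c, s⟩⟩⟩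
      iterate 3 simp [run, Piece.ins, Piece.outs] at hl
      rcases x with x | x <;> cases x <;> cases κ <;>
        simp only [total, Smoothing.resolve, List.flatMap_cons, List.flatMap_nil, List.append_nil,
          List.cons_append, List.nil_append, app_cons, app_nil, one_one, one_two, one_birth,
          one_join, one_glue, one_cross_true, one_cross_false, Vertex.rot, Bool.not_true,
          Bool.not_false]
      all_goals first
        | (simp only [Q.act_eq_iff, Q.act_bar])
        | (split_ifs with h1 <;> simp_all [Q.bar_bar])
    | turn_birth x =>
      rcases s with _ | ⟨a, s⟩
      · simp [run, Piece.ins, Piece.outs] at hr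
      rcases x with x | x <;> cases x <;> cases κ <;>
        simp only [total, Smoothing.resolve, List.flatMap_cons, List.flatMap_nil, List.append_nil,
          List.cons_append, List.nil_append, app_cons, app_nil, one_one, one_two, one_birth,
          one_join, one_glue, one_cross_true, one_cross_false, Vertex.rot, Bool.not_true,
          Bool.not_false]
      -- For the crossing in which the old strand acts on the newborn one, the two sides differ by
      -- reindexing the newborn label.
      all_goals first
        | (refine Fintype.sum_bijective _ (Q.act_bijective (Q.bar a)) _ _ fun x => ?_
           simp [Q.act_bar_act, Q.act_bar])
        | (simp [Q.bar_bar])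
    | gamma1 x =>
      rcases s with _ | ⟨a, _ | ⟨b, s⟩⟩
      iterate 2 simp [run, Piece.ins, Piece.outs] at hl
      cases x <;>
        simp only [total, Smoothing.resolve, List.flatMap_cons, List.flatMap_nil, List.append_nil,
          List.cons_append, List.nil_append, app_cons, app_nil, one_one, one_two, one_birth,
          one_join, one_glue, one_cross_true, one_cross_false, Vertex.rot, Bool.not_true,
          Bool.not_false]
      · simp only [Q.bar_act_iff]
      · simp only [Q.bar_act_iff']
    | gamma2 x =>
      rcases s with _ | ⟨a, _ | ⟨b, s⟩⟩
      iterate 2 simp [run, Piece.ins, Piece.outs] at hl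
      cases x <;>
        simp only [total, Smoothing.resolve, List.flatMap_cons, List.flatMap_nil, List.append_nil,
          List.cons_append, List.nil_append, app_cons, app_nil, one_one, one_two, one_birth,
          one_join, one_glue, one_cross_true, one_cross_false, Vertex.rot, Bool.not_true,
          Bool.not_false]
      · rw [Q.act_bar_act]
      · rw [Q.bar_act_act]
    | gamma3 x y z hh =>
      rcases s with _ | ⟨a, _ | ⟨b, _ | ⟨c, s⟩⟩⟩
      iterate 3 simp [run, Piece.ins, Piece.outs] at hl
      cases x <;> cases y <;> cases z <;>
        simp only [total, Smoothing.resolve, List.flatMap_cons, List.flatMap_nil, List.append_nil,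
          List.cons_append, List.nil_append, app_cons, app_nil, one_one, one_two, one_birth,
          one_join, one_glue, one_cross_true, one_cross_false, Vertex.rot, Bool.not_true,
          Bool.not_false]
      -- The cyclic patterns contradict `hh`; the others are self-distributivity, for the action of
      -- a label or its inverse.
      all_goals first
        | (rcases hh with hh | hh <;> exact absurd hh (by decide))
        | (simp only [← Q.act_act, Q.act_act_bar])
        | rw [Q.act_act b, Q.act_bar_act]
        | (conv_rhs => rw [← Q.act_bar_act b a, Q.act_act_bar, Q.bar_act_act])
    | gamma4 m x =>
      rcases s with _ | ⟨a, _ | ⟨b, _ | ⟨c, s⟩⟩⟩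
      iterate 3 simp [run, Piece.ins, Piece.outs] at hl
      cases x <;> cases m <;> cases κ <;>
        simp only [total, Smoothing.resolve, List.flatMap_cons, List.flatMap_nil, List.append_nil,
          List.cons_append, List.nil_append, app_cons, app_nil, one_one, one_two, one_birth,
          one_join, one_glue, one_cross_true, one_cross_false, Vertex.rot, Bool.not_true,
          Bool.not_false]
      all_goals try
        simp only [Q.act_eq_bar_act, Q.bar_act_iff, Q.bar_act_iff', Q.act_bar_act, Q.bar_bar,
          Q.act_self, Q.act_self_bar]
      all_goals split_ifs <;> subst_vars <;> try
        simp_all only [Q.act_bar_act, Q.bar_act_act, Q.bar_bar, not_true_eq_false]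
      -- What remains are resolutions in which the arc born at the vertex passes under the strand
      -- labelled `c`.
      all_goals exact Q.sum_act (Q.bar c) fun x y => f (c :: x :: y :: s)
    | gamma5 m x =>
      rcases s with _ | ⟨a, _ | ⟨b, s⟩⟩
      iterate 2 simp [run, Piece.ins, Piece.outs] at hl
      cases x <;> cases m <;> cases κ <;>
        simp only [total, Smoothing.resolve, List.flatMap_cons, List.flatMap_nil, List.append_nil,
          List.cons_append, List.nil_append, app_cons, app_nil, one_one, one_two, one_birth,
          one_join, one_glue, one_cross_true, one_cross_false, Vertex.rot, Bool.not_true,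
          Bool.not_false]
      all_goals try
        simp only [Q.act_eq_bar_act, Q.bar_act_iff, Q.bar_act_iff', Q.act_bar_act, Q.bar_bar,
          Q.act_self, Q.act_self_bar]
      all_goals split_ifs <;> subst_vars <;> try
        simp_all only [Q.act_bar_act, Q.bar_act_act, Q.bar_bar, not_true_eq_false]
      -- A crossing of the two ends of a newborn arc exchanges its labels `x` and `Q.bar x`.
      all_goals exact Q.sum_bar fun x y => f (x :: y :: s)
    | gamma7 m =>
      rcases s with _ | ⟨a, _ | ⟨b, _ | ⟨c, s⟩⟩⟩
      iterate 3 simp [run, Piece.ins, Piece.outs] at hl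
      cases m <;> cases κ <;>
        simp only [total, Smoothing.resolve, List.flatMap_cons, List.flatMap_nil, List.append_nil,
          List.cons_append, List.nil_append, app_cons, app_nil, one_one, one_two, one_birth,
          one_join, one_glue, one_cross_true, one_cross_false, Vertex.rot, Bool.not_true,
          Bool.not_false]
      all_goals split_ifs <;> subst_vars <;> try
        simp_all only [Q.act_bar_act, Q.bar_act_act, Q.bar_bar, not_true_eq_false]
    | gamma8 m =>
      rcases s with _ | ⟨a, _ | ⟨b, _ | ⟨c, _ | ⟨d, s⟩⟩⟩⟩
      iterate 4 simp [run, Piece.ins, Piece.outs] at hl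
      cases m <;> cases κ <;>
        simp only [total, Smoothing.resolve, List.flatMap_cons, List.flatMap_nil, List.append_nil,
          List.cons_append, List.nil_append, app_cons, app_nil, one_one, one_two, one_birth,
          one_join, one_glue, one_cross_true, one_cross_false, Vertex.rot, Bool.not_true,
          Bool.not_false]
      all_goals try
        simp only [Q.act_eq_bar_act, Q.bar_act_iff, Q.bar_act_iff', Q.act_bar_act, Q.bar_bar,
          Q.act_self, Q.act_self_bar]
      all_goals split_ifs <;> subst_vars <;> try
        simp_all only [Q.act_bar_act, Q.bar_act_act, Q.bar_bar, not_true_eq_false]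
end SymQuandle

/-! ### Comparing the counts of equivalent diagrams -/

theorem run_append (u w : List Event) (n : ℕ) : run (u ++ w) n = (run u n).bind (run w) := by
  induction u generalizing n with
  | nil => rfl
  | cons e u ih =>
    simp only [List.cons_append, run]
    split
    · exact ih _
    · rfl

theorem run_shift (k : ℕ) (w : List Event) (n : ℕ) :
    run (w.map (Event.shift k)) (k + n) = (run w n).map (k + ·) := by
  induction w generalizing n with
  | nil => rfl
  | cons e w ih =>
    simp only [List.map_cons, run, Event.shift]
    by_cases h : e.pos + e.piece.ins ≤ n
    · rw [if_pos h, if_pos (by omega), ← ih]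
      congr 1
      omega
    · rw [if_neg h, if_neg (by omega)]
      rfl

/-- A shifted word that can be run certifies that the strands on its left exist. -/
theorem le_of_run_shift {k : ℕ} {w : List Event} {n m : ℕ} (hw : w ≠ [])
    (h : run (w.map (Event.shift k)) n = some m) : k ≤ n := by
  rcases w with _ | ⟨e, w⟩
  · exact absurd rfl hw
  · simp only [List.map_cons, run, Event.shift] at h
    split at h
    · omega
    · exact absurd h (by simp)

theorem LocalMove.ne_nil {l r : List Event} (h : LocalMove l r) : l ≠ [] ∨ r ≠ [] := by
  cases h <;> simp

namespace SymQuandle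

variable {q : ℕ} (Q : SymQuandle q) (κ : Smoothing)

/-- The number of labellings of a closed word. -/
def count (w : List Event) : ℕ := Q.total κ w (fun t => if t = [] then 1 else 0) []

end SymQuandle

/-- The relation between the numbers of labellings of equivalent diagrams. -/
def SameCounts (v w : List Event) : Prop :=
  ∃ a b : Smoothing → ℕ, a .singular = 0 ∧ b .singular = 0 ∧
    marks v + a .positive + a .negative = marks w + b .positive + b .negative ∧
    ∀ (q : ℕ) (Q : SymQuandle q) (κ : Smoothing), q ^ a κ * Q.count κ v = q ^ b κ * Q.count κ w

theorem SameCounts.refl (v : List Event) : SameCounts v v :=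
  ⟨fun _ => 0, fun _ => 0, rfl, rfl, rfl, fun _ _ _ => rfl⟩

theorem SameCounts.symm {v w : List Event} (h : SameCounts v w) : SameCounts w v := by
  obtain ⟨a, b, ha, hb, hm, h⟩ := h
  exact ⟨b, a, hb, ha, hm.symm, fun q Q κ => (h q Q κ).symm⟩

theorem SameCounts.trans {u v w : List Event} (h : SameCounts u v) (h' : SameCounts v w) :
    SameCounts u w := by
  obtain ⟨a, b, ha, hb, hm, h⟩ := h
  obtain ⟨a', b', ha', hb', hm', h'⟩ := h'
  refine ⟨fun κ => a κ + a' κ, fun κ => b κ + b' κ, by simp [ha, ha'], by simp [hb, hb'],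
    by simp only; omega, fun q Q κ => ?_⟩
  calc
    _ = q ^ a' κ * (q ^ a κ * Q.count κ u) := by ring
    _ = q ^ b κ * (q ^ a' κ * Q.count κ v) := by rw [h]; ring
    _ = _ := by rw [h']; ring

theorem marks_append (v w : List Event) : marks (v ++ w) = marks v + marks w :=
  List.countP_append

theorem marks_shift (k : ℕ) (w : List Event) : marks (w.map (Event.shift k)) = marks w := by
  simp only [marks, List.countP_map]
  rfl

/-- The two diagrams share what comes before and after the replacement. The part after it is
absorbed into the summed function, and the factor produced by the replacement passes through the
part before it by linearity. -/
theorem Diagram.Move.sameCounts {D E : Diagram} (h : D.Move E) : SameCounts D.word E.word := by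
  obtain ⟨u, l, r, w, k, hlr, hD, hE⟩ := h
  obtain ⟨ε, h0, hm, hε⟩ := SymQuandle.total_localMove hlr
  refine ⟨fun _ => 0, ε, rfl, h0, ?_, fun q Q κ => ?_⟩
  · rw [hD, hE]
    simp only [marks_append, marks_shift, hm]
    omega
  have cD := D.closed
  have cE := E.closed
  rw [hD, List.append_assoc, run_append, Option.bind_eq_some_iff] at cD
  obtain ⟨n, hn, cD⟩ := cD
  rw [hE, List.append_assoc, run_append, hn, Option.bind_some] at cE
  rw [run_append, Option.bind_eq_some_iff] at cD cE
  obtain ⟨m, hm, -⟩ := cD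
  obtain ⟨m', hm', -⟩ := cE
  -- One of the two sides of a local move may be empty, but never both, so one of the runs gives the
  -- bound.
  have hk : k ≤ n := hlr.ne_nil.elim (le_of_run_shift · hm) (le_of_run_shift · hm')
  obtain ⟨d, rfl⟩ := Nat.exists_eq_add_of_le hk
  rw [run_shift, Option.map_eq_some_iff] at hm hm'
  obtain ⟨m, hm, -⟩ := hm
  obtain ⟨m', hm', -⟩ := hm'
  rw [pow_zero, one_mul, hD, hE]
  simp only [SymQuandle.count, List.append_assoc, Q.total_append κ u]
  rw [SymQuandle.total, ← Q.app_mul]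
  refine Q.total_congr κ hn (fun t ht => ?_) rfl
  obtain ⟨p, s, rfl, hp⟩ : ∃ p s, t = p ++ s ∧ p.length = k :=
    ⟨t.take k, t.drop k, (List.take_append_drop _ _).symm, by rw [List.length_take]; omega⟩
  have hs : s.length = d := by rw [List.length_append] at ht; omega
  rw [Q.total_append, Q.total_append, Q.total_shift κ k _ _ p s hp, Q.total_shift κ k _ _ p s hp]
  exact hε q Q κ _ s m m' (hs ▸ hm) (hs ▸ hm')

theorem sameCounts_of_toLink_eq {D E : Diagram} (h : D.toLink = E.toLink) :
    SameCounts D.word E.word := by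
  have := Quot.eqvGen_exact h
  induction this with
  | rel _ _ h' => exact Diagram.Move.sameCounts h'
  | refl => exact .refl _
  | symm _ _ _ ih => exact (ih (Quot.eqvGen_sound ‹_›)).symm
  | trans _ _ _ h1 h2 ih1 ih2 =>
    exact (ih1 (Quot.eqvGen_sound h1)).trans (ih2 (Quot.eqvGen_sound h2))

/-! ### Evaluation of label counts

The functions below are written with explicit recursors and in continuation passing style, so that
the kernel evaluates them eagerly. -/

namespace Sweep

/-- Evaluate `n` before passing it on. -/
def force {α : Type} (n : ℕ) (k : ℕ → α) : α := Nat.rec (k 0) (fun m _ => k (Nat.succ m)) n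

def forceList {α : Type} (l : List ℕ) : (List ℕ → α) → α :=
  List.rec (fun k => k []) (fun x _ ih k => force x fun x => ih fun l => k (x :: l)) l

def forceLists {α : Type} (l : List (List ℕ)) : (List (List ℕ) → α) → α :=
  List.rec (fun k => k []) (fun x _ ih k => forceList x fun x => ih fun l => k (x :: l)) l

/-- Collect the results of `f`. -/
def gather {α β γ : Type} (f : β → List γ → (List γ → α) → α) (l : List β) :
    List γ → (List γ → α) → α :=
  List.rec (fun t k => k t) (fun x _ ih t k => f x t fun t => ih t k) l

def nth {α : Type} (d : α) (l : List α) : ℕ → α :=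
  List.rec (fun _ => d) (fun x _ ih n => bif Nat.beq n 0 then x else ih (Nat.pred n)) l

/-- A symmetric quandle with at most eight labels as a table.  A pair of labels `a, c` is coded by
`a + 8 * c`, and a labelling `a, b, …` of all strands by `a + 8 * (b + 8 * (… + 8 * 1))`. -/
structure Tab where
  births : List ℕ
  pos : ℕ
  neg : ℕ
  glue : ℕ
  auts : List ℕ

/-- Here `P` is 8 to the number of strands on the left: `c % P` holds these strands, and the lowest
six bits of `c / P` hold the two strands of the crossing, which index a table with entries of six
bits. -/
def permOp {α : Type} (T P c : ℕ) (acc : List ℕ) (k : List ℕ → α) : α :=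
  force (Nat.div c P) fun r =>
  force (Nat.add (Nat.mod c P) (Nat.mul P (Nat.add
    (Nat.mod (Nat.shiftRight T (Nat.mul 6 (Nat.mod r 64))) 64)
    (Nat.mul 64 (Nat.div r 64))))) fun c => k (c :: acc)

def joinOp {α : Type} (J P c : ℕ) (acc : List ℕ) (k : List ℕ → α) : α :=
  force (Nat.div c P) fun r =>
  bif Nat.beq 1 (Nat.mod (Nat.shiftRight J (Nat.mod r 64)) 2) then
    force (Nat.add (Nat.mod c P) (Nat.mul P (Nat.div r 64))) fun c => k (c :: acc)
  else k acc

def glueOp {α : Type} (J P c : ℕ) (acc : List ℕ) (k : List ℕ → α) : α :=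
  bif Nat.beq 1 (Nat.mod (Nat.shiftRight J (Nat.mod (Nat.div c P) 64)) 2) then k (c :: acc)
  else k acc

def birthOp {α : Type} (B : List ℕ) (P c : ℕ) (acc : List ℕ) (k : List ℕ → α) : α :=
  force (Nat.mod c P) fun lo => force (Nat.mul 64 (Nat.div c P)) fun hi =>
    gather (fun y acc k => force (Nat.add lo (Nat.mul P (Nat.add y hi))) fun c => k (c :: acc))
      B acc k

/-- The effect of a piece on a list of labellings.  The letter `x + 8 * i` stands for a birth,
join, positive or negative crossing, or glued vertex (`x = 0, …, 4`) at the position `i`. -/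
def letterOp (T : Tab) (x : ℕ) (V : List ℕ) : List ℕ :=
  force (Nat.pow 8 (Nat.div x 8)) fun P => force (Nat.mod x 8) fun t =>
  bif Nat.beq t 0 then gather (birthOp T.births P) V [] fun V => V else
  bif Nat.beq t 1 then gather (joinOp T.glue P) V [] fun V => V else
  bif Nat.beq t 2 then gather (permOp T.pos P) V [] fun V => V else
  bif Nat.beq t 3 then gather (permOp T.neg P) V [] fun V => V else
  gather (glueOp T.glue P) V [] fun V => V

/-- The effect of a word; the last letter comes first. -/
def wordOp (T : Tab) (w : List ℕ) (V : List ℕ) : List ℕ :=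
  List.rec V (fun x _ ih => letterOp T x ih) w

/-! A multiset of codes is stored as a sum of the following numbers. The low word is there only to
give different multisets different hash values. -/

def bit (c : ℕ) : ℕ :=
  Nat.add (Nat.shiftLeft 18446744073709551616 (Nat.mul 14 c)) (Nat.pow c 3)

def len (V : List ℕ) : ℕ → ℕ := List.rec (fun n => n) (fun _ _ ih n => force n fun n => ih (Nat.succ n)) V

def toBits (V : List ℕ) : ℕ → ℕ :=
  List.rec (fun n => n) (fun c _ ih n => force (Nat.add n (bit c)) fun n => ih n) V

def replicateOp {α : Type} (c n : ℕ) : List ℕ → (List ℕ → α) → α :=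
  Nat.rec (fun acc k => k acc) (fun _ ih acc k => ih (c :: acc) k) n

/-- The digits of `b` at the positions from `c` on, `2 ^ n` of them. -/
def digitsOp {α : Type} (n : ℕ) : ℕ → ℕ → List ℕ → (List ℕ → α) → α :=
  Nat.rec (fun c b acc k => replicateOp c b acc k)
    (fun n ih c b acc k => bif Nat.beq b 0 then k acc else
      force (Nat.shiftLeft 1 n) fun h => force (Nat.mul 14 h) fun e =>
      force (Nat.shiftRight b e) fun hi => force (Nat.sub b (Nat.shiftLeft hi e)) fun lo =>
      force (Nat.add c h) fun c' => ih c' hi acc fun acc => ih c lo acc k) n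

def ofBits (b : ℕ) : List ℕ := digitsOp 13 0 (Nat.shiftRight b 64) [] fun V => V

def applyAut (A : ℕ) : ℕ → ℕ :=
  Nat.rec (fun c => c) (fun _ ih c => bif Nat.ble 8 c then
    Nat.add (Nat.mod (Nat.shiftRight A (Nat.mul 3 (Nat.mod c 8))) 8)
      (Nat.mul 8 (ih (Nat.div c 8))) else c) 16

/-- Apply to each labelling the automorphism chosen by its first label. -/
def canonOp (T : Tab) (V : List ℕ) : List ℕ :=
  List.rec V (fun _ _ _ => gather (fun c acc k => force (nth 0 T.auts (Nat.mod c 8)) fun A =>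
    force (applyAut A c) fun c => k (c :: acc)) V [] fun V => V) T.auts

/-- The multiset below the word `w`, given the multiset above it; `0` if it is too large, and
otherwise increased by one. -/
def rowOp (T : Tab) (w : List ℕ) (b : ℕ) : ℕ :=
  (fun V => bif Nat.ble (Nat.succ (len V 0)) 16384 then Nat.succ (toBits V 0) else 0)
    (canonOp T (wordOp T w (ofBits b)))

def orFail (n : ℕ) (k : ℕ → Bool) : Bool := Nat.rec false (fun b _ => k b) n

/-- Each of the 8192 digits in the base `2 ^ 14` is 14336, which consists of the three leading bits
of a digit. A number without common bits with it has digits below `2 ^ 11` and can be multiplied by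
8 without carries. -/
def mask : ℕ := Nat.mul 14336 (Nat.div (Nat.sub (Nat.pow 16384 8192) 1) 16383)

/-- `b` is `q` times the multiset `b'`. -/
def isMul (q b b' : ℕ) : Bool :=
  bif Nat.beq (Nat.mul q b') b then
    bif Nat.beq (Nat.land (Nat.shiftRight b' 64) mask) 0 then
      Nat.ble (Nat.succ (Nat.mul q (Nat.mod b' 18446744073709551616))) 18446744073709551616
    else false
  else false

/-- Divide by `q` as often as possible. -/
def thin {α : Type} (q : ℕ) (b : ℕ) (k : ℕ → α) : α :=
  Nat.rec (fun b => k b) (fun _ ih b => force (Nat.div b q) fun b' =>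
    bif isMul q b b' then ih b' else k b) 6 b

/-- Divide both by `q` as often as possible. -/
def thin₂ {α : Type} (q : ℕ) (b c : ℕ) (k : ℕ → ℕ → α) : α :=
  Nat.rec (fun b c => k b c) (fun _ ih b c => force (Nat.div b q) fun b' =>
    force (Nat.div c q) fun c' =>
    bif isMul q b b' then bif isMul q c c' then ih b' c' else k b c else k b c) 6 b c

/-- The eight 3-cycles of the alternating group of degree 4. -/
def tabA : Tab := ⟨[8, 1, 34, 51, 20, 61, 30, 47],
  39255232717630998361662067517696850878653744129046052242147848944458856079953429014816239577317576582885272251625984,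
  39014683645341760371809029713160323458450155873314488408108262511782136982488198574855395928990143818099792743170560,
  2308235564770394370,
  [16434824, 5135809, 13734973, 8745331, 7802452, 3959522, 10724126, 571823]⟩

/-- In an inner product only one side may be replaced by representatives under automorphisms. The
lower rows therefore use the table without automorphisms. -/
def tabA' : Tab := ⟨tabA.births, tabA.pos, tabA.neg, tabA.glue, []⟩

/-- The three transpositions of the symmetric group of degree 3. -/
def tabR : Tab :=
  ⟨[0, 9, 18], 5881978013221517296718906665276032, 5852267452278650880520883231818752, 262657, []⟩

/-- Three labels with the trivial action. -/
def tabT : Tab :=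
  ⟨[0, 9, 18], 5892198446185858548908503465001472, 5892198446185858548908503465001472, 262657, []⟩

/-- A word is given as `[[k], w₀, w₁, w₂]`, where `k` is the number of strands below it, and `w₀`,
`w₁`, `w₂` are its smoothings, the last letter first.  A state is a number of strands followed by
nine multisets. -/
def stateOp (A : Tab) (w : List (List ℕ)) (s : List ℕ) (k : List ℕ → Bool) : Bool :=
  orFail (rowOp A (nth [] w 1) (nth 0 s 1)) fun a₀ =>
  orFail (rowOp A (nth [] w 2) (nth 0 s 2)) fun a₁ =>
  orFail (rowOp A (nth [] w 3) (nth 0 s 3)) fun a₂ =>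
  orFail (rowOp tabR (nth [] w 1) (nth 0 s 4)) fun r₀ =>
  orFail (rowOp tabT (nth [] w 1) (nth 0 s 5)) fun t₀ =>
  orFail (rowOp tabR (nth [] w 2) (nth 0 s 6)) fun r₁ =>
  orFail (rowOp tabT (nth [] w 2) (nth 0 s 7)) fun t₁ =>
  orFail (rowOp tabR (nth [] w 3) (nth 0 s 8)) fun r₂ =>
  orFail (rowOp tabT (nth [] w 3) (nth 0 s 9)) fun t₂ =>
  thin 8 a₀ fun a₀ => thin 8 a₁ fun a₁ => thin 8 a₂ fun a₂ =>
  thin₂ 3 r₀ t₀ fun r₀ t₀ => thin₂ 3 r₁ t₁ fun r₁ t₁ => thin₂ 3 r₂ t₂ fun r₂ t₂ =>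
  k [nth 0 (nth [] w 0) 0, a₀, a₁, a₂, r₀, t₀, r₁, t₁, r₂, t₂]

/-! Search trees, used as sets of lists. -/

inductive Tree where
  | leaf
  | node (l : Tree) (x : List ℕ) (r : Tree)

/-- Continue with `a`, `e` or `c` if `l` is smaller than, equal to or greater than `l'`. -/
def cmp {α : Type} (l : List ℕ) : List ℕ → α → α → α → α :=
  List.rec (fun l' a e _ => List.rec e (fun _ _ _ => a) l')
    (fun x _ ih l' a e c => List.rec c (fun y l' _ =>
      bif Nat.beq x y then ih l' a e c else bif Nat.ble x y then a else c) l') l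

def Tree.ins {α : Type} (x : List ℕ) (t : Tree) : (Tree → α) → α :=
  Tree.rec (fun k => k (.node .leaf x .leaf))
    (fun l y r ihl ihr k => cmp x y (ihl fun l => k (.node l y r)) (k (.node l y r))
      (ihr fun r => k (.node l y r))) t

def Tree.toList (t : Tree) : List (List ℕ) → List (List ℕ) :=
  Tree.rec (fun acc => acc) (fun _ x _ ihl ihr acc => ihl (x :: ihr acc)) t

def collect {α β : Type} (f : β → Tree → (Tree → α) → α) (l : List β) : Tree → (Tree → α) → α :=
  List.rec (fun t k => k t) (fun x _ ih t k => f x t fun t => ih t k) l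

/-! ### The words of the rows of a mosaic

While a row is read from left to right, its state is the number `((w * 8 + p) * 8 + u) * 2 + r`:
`w` is the word so far, coded with the base 64 and a leading 1, `p` and `u` are the numbers of
bottom and top sides passed, and `r` tells whether the last tile has a connection point on its
right side. -/

/-- For the tiles without left connection point: right, top, bottom, and how to extend the word. -/
def tilesOff : List (List ℕ) :=
  [[0, 0, 0, 1, 0, 0], [1, 0, 1, 64, 0, 8], [1, 1, 0, 1, 0, 0], [0, 1, 1, 1, 0, 0]]

/-- The same for the tiles with left connection point. -/
def tilesOn : List (List ℕ) :=
  [[0, 0, 1, 1, 0, 0], [0, 1, 0, 64, 1, 8], [1, 0, 0, 1, 0, 0], [1, 1, 1, 4096, 64, 520],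
    [1, 1, 1, 1, 0, 0], [1, 1, 1, 64, 2, 8], [1, 1, 1, 64, 3, 8], [1, 1, 1, 64, 4, 8],
    [1, 1, 1, 64, 5, 8]]

/-- A hash value, to keep the search trees balanced. -/
def mix (x : ℕ) : ℕ := Nat.mod (Nat.mul x 11400714819323198485) 2305843009213693951

def tileOp {α : Type} (s : List ℕ) (t : Tree) (k : Tree → α) : α :=
  force (nth 0 s 1) fun x => force (Nat.mod (Nat.div x 2) 8) fun u =>
  force (Nat.mod (Nat.div x 16) 8) fun p => force (Nat.div x 128) fun w =>
  collect (fun c t k => force (Nat.add u (nth 0 c 1)) fun u => force (Nat.add p (nth 0 c 2)) fun p' =>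
    bif Nat.ble u 4 then bif Nat.ble p' 4 then
      force (Nat.add (nth 0 c 0) (Nat.mul 2 (Nat.add u (Nat.mul 8 (Nat.add p' (Nat.mul 8
        (Nat.add (Nat.mul w (nth 0 c 3)) (Nat.add (nth 0 c 4) (Nat.mul p (nth 0 c 5)))))))))) fun x =>
      force (mix x) fun h => Tree.ins [h, x] t k
    else k t else k t) (bif Nat.beq (Nat.mod x 2) 0 then tilesOff else tilesOn) t k

def tilesOp {α : Type} (n : ℕ) : List (List ℕ) → (List (List ℕ) → α) → α :=
  Nat.rec (fun L k => k L) (fun _ ih L k => collect tileOp L .leaf fun t =>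
    forceLists (t.toList []) fun L => ih L k) n

/-- The letters of a word, the last letter first. -/
def letters {α : Type} (n : ℕ) : ℕ → (List ℕ → α) → α :=
  Nat.rec (fun _ k => k []) (fun _ ih w k => bif Nat.ble w 1 then k [] else
    force (Nat.mod w 64) fun x => force (Nat.div w 64) fun w => ih w fun l => k (x :: l)) n

/-- The letters 4 and 5 stand for the two markers.  They are kept (`κ = 0`) or resolved. -/
def smooth {α : Type} (κ : ℕ) (w : List ℕ) : (List ℕ → α) → α :=
  List.rec (fun k => k []) (fun x _ ih k => ih fun l =>
    force (Nat.mod x 8) fun t => force (Nat.sub x t) fun y =>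
    bif Nat.ble 4 t then
      bif Nat.beq κ 0 then force (Nat.add y 4) fun x => k (x :: l) else
      bif Nat.beq (Nat.add t κ) 6 then force (Nat.succ y) fun z => k (y :: z :: l) else k l
    else force x fun x => k (x :: l)) w

def smooths {α : Type} (p : ℕ) (w : List ℕ) (k : List (List ℕ) → α) : α :=
  smooth 0 w fun w₀ => smooth 1 w fun w₁ => smooth 2 w fun w₂ => k [[p], w₀, w₁, w₂]

def wordsFrom {α : Type} (u : ℕ) (L : List (List ℕ)) (k : List (List (List ℕ)) → α) : α :=
  gather (fun s t k => force (nth 0 s 1) fun x => bif Nat.beq (Nat.mod x 16) (Nat.mul 2 u) then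
    letters 16 (Nat.div x 128) fun w => force (Nat.mod (Nat.div x 16) 8) fun p =>
    smooths p w fun e => k (e :: t) else k t) L [] k

/-- The words of the rows with 0, 2 and 4 strands above them. -/
def rowWords {α : Type} (n : ℕ)
    (k : List (List (List ℕ)) → List (List (List ℕ)) → List (List (List ℕ)) → α) : α :=
  tilesOp n [[0, 128]] fun L => wordsFrom 0 L fun R₀ => wordsFrom 2 L fun R₂ =>
    wordsFrom 4 L fun R₄ => k R₀ R₂ R₄

/-- Birth and join have the codes 0 and 1, the two crossings 2 and 3, so turning upside down flips
the last bit; a glued vertex is its own reflection. -/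
def dualLetter (x : ℕ) : ℕ :=
  bif Nat.ble 4 (Nat.mod x 8) then x else
  bif Nat.beq (Nat.mod x 2) 0 then Nat.succ x else Nat.pred x

def dualWord (w : List ℕ) : List ℕ → List ℕ :=
  List.rec (fun acc => acc) (fun x _ ih acc => ih (dualLetter x :: acc)) w

/-- The word upside down, with `p` strands below it afterwards. -/
def dual {α : Type} (p : ℕ) (w : List (List ℕ)) (k : List (List ℕ) → α) : α :=
  forceList (dualWord (nth [] w 1) []) fun w₀ => forceList (dualWord (nth [] w 2) []) fun w₁ =>
  forceList (dualWord (nth [] w 3) []) fun w₂ => k [[p], w₀, w₁, w₂]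

def dualsFrom {α : Type} (u : ℕ) (R₀ R₂ R₄ : List (List (List ℕ)))
    (k : List (List (List ℕ)) → α) : α :=
  gather (fun w t k => bif Nat.beq (nth 0 (nth [] w 0) 0) u then dual 0 w fun w => k (w :: t)
    else k t) R₀ [] fun t =>
  gather (fun w t k => bif Nat.beq (nth 0 (nth [] w 0) 0) u then dual 2 w fun w => k (w :: t)
    else k t) R₂ t fun t =>
  gather (fun w t k => bif Nat.beq (nth 0 (nth [] w 0) 0) u then dual 4 w fun w => k (w :: t)
    else k t) R₄ t k

/-! ### The states of a mosaic -/

def select (R₀ R₂ R₄ : List (List (List ℕ))) (k : ℕ) : List (List (List ℕ)) :=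
  bif Nat.beq k 0 then R₀ else bif Nat.beq k 2 then R₂ else R₄

/-- All states below a row. -/
def rowsOp (A : Tab) (R₀ R₂ R₄ : List (List (List ℕ))) (L : List (List ℕ))
    (k : List (List ℕ) → Bool) : Bool :=
  collect (fun s t k => collect (fun w t k => stateOp A w s fun s => Tree.ins s t k)
    (select R₀ R₂ R₄ (nth 0 s 0)) t k) L .leaf fun t => forceLists (t.toList []) k

/-- The inner product of two multisets. -/
def inner (a b : ℕ) : ℕ :=
  List.rec (fun n => n) (fun c _ ih n => force (Nat.add n
    (Nat.mod (Nat.shiftRight a (Nat.add 64 (Nat.mul 14 c))) 16384)) fun n => ih n) (ofBits b) 0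

/-- Whether `n < 8 ^ 20` is a power of 8. -/
def isPow (n : ℕ) : Bool :=
  bif Nat.beq (Nat.mod 1152921504606846976 n) 0 then Nat.beq (Nat.mod n 7) 1 else false

def all {β : Type} (f : β → Bool) (l : List β) : Bool :=
  List.rec true (fun x _ ih => bif f x then ih else false) l

/-- If both resolutions look trivial, then so does the diagram. -/
def pairOp (s u : List ℕ) : Bool :=
  bif Nat.beq (nth 0 s 0) (nth 0 u 0) then
    force (inner (nth 0 s 2) (nth 0 u 2)) fun a₁ => bif isPow a₁ then
    force (inner (nth 0 s 3) (nth 0 u 3)) fun a₂ => bif isPow a₂ then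
    bif Nat.beq (inner (nth 0 s 6) (nth 0 u 6)) (inner (nth 0 s 7) (nth 0 u 7)) then
    bif Nat.beq (inner (nth 0 s 8) (nth 0 u 8)) (inner (nth 0 s 9) (nth 0 u 9)) then
    bif Nat.beq (inner (nth 0 s 4) (nth 0 u 4)) (inner (nth 0 s 5) (nth 0 u 5)) then
    force (inner (nth 0 s 1) (nth 0 u 1)) fun a₀ => bif Nat.beq a₀ 0 then true else isPow a₀
    else false else true else true else true else true
  else true

def start : List ℕ :=
  [0, bit 1, bit 1, bit 1, bit 1, bit 1, bit 1, bit 1, bit 1, bit 1]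

/-- Three rows are added from the top and two, upside down, from the bottom. Every 5-mosaic then
appears as a pair of an upper and a lower state. -/
def check : Bool := rowWords 5 fun R₀ R₂ R₄ => forceList start fun i =>
  rowsOp tabA R₀ R₂ R₄ [i] fun L => rowsOp tabA R₀ R₂ R₄ L fun L => rowsOp tabA R₀ R₂ R₄ L fun L =>
  dualsFrom 0 R₀ R₂ R₄ fun D₀ => dualsFrom 2 R₀ R₂ R₄ fun D₂ => dualsFrom 4 R₀ R₂ R₄ fun D₄ =>
  rowsOp tabA' D₀ D₂ D₄ [i] fun B => rowsOp tabA' D₀ D₂ D₄ B fun B =>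
  all (fun s => all (pairOp s) B) L

end Sweep

-- This evaluation is the whole search over 5-mosaics; its meaning is extracted in
-- `forcedWord_of_check`.
set_option maxRecDepth 100000 in
theorem check_eq_true : Sweep.check = true := by decide +kernel

/-! ### Words read upside down -/

namespace Op

def ins : Op → ℕ
  | .birth => 0
  | _ => 2

def outs : Op → ℕ
  | .join => 0
  | _ => 2

/-- The piece upside down. -/
def dual : Op → Op
  | .birth => .join
  | .join => .birth
  | .cross b => .cross !b
  | .glue => .glue

/-- The code of a piece in a letter. -/
def code : Op → ℕ
  | .birth => 0
  | .join => 1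
  | .cross true => 2
  | .cross false => 3
  | .glue => 4

end Op

/-- The word leads from `n` strands to `m` strands. -/
def Leads : List (Op × ℕ) → ℕ → ℕ → Prop
  | [], n, m => n = m
  | x :: w, n, m => ∃ k, n = x.2 + x.1.ins + k ∧ Leads w (x.2 + x.1.outs + k) m

theorem Leads.append {u w : List (Op × ℕ)} {n m l : ℕ} (hu : Leads u n m) (hw : Leads w m l) :
    Leads (u ++ w) n l := by
  induction u generalizing n with
  | nil => cases hu; exact hw
  | cons x u ih => obtain ⟨k, hk, h⟩ := hu; exact ⟨k, hk, ih h⟩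

def dualOps (w : List (Op × ℕ)) : List (Op × ℕ) := (w.map fun x => (x.1.dual, x.2)).reverse

theorem dualOps_cons (x : Op × ℕ) (w : List (Op × ℕ)) :
    dualOps (x :: w) = dualOps w ++ [(x.1.dual, x.2)] := by simp [dualOps]

theorem dualOps_append (u w : List (Op × ℕ)) : dualOps (u ++ w) = dualOps w ++ dualOps u := by
  simp [dualOps]

theorem Leads.dual {w : List (Op × ℕ)} {n m : ℕ} (h : Leads w n m) : Leads (dualOps w) m n := by
  induction w generalizing n with
  | nil => exact h.symm
  | cons x w ih =>
    obtain ⟨k, hk, h⟩ := h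
    rw [dualOps_cons]
    refine (ih h).append ⟨k, ?_, ?_⟩
    · rcases x with ⟨_ | _ | _ | _, i⟩ <;> rfl
    · subst hk; rcases x with ⟨_ | _ | _ | _, i⟩ <;> rfl

namespace SymQuandle

variable {q : ℕ} (Q : SymQuandle q)

theorem length_of_mem_ev {x : Op × ℕ} {k : ℕ} {s t : List (Fin q)}
    (hs : s.length = x.2 + x.1.ins + k) (ht : t ∈ Q.ev x s) :
    t.length = x.2 + x.1.outs + k := by
  obtain ⟨o, i⟩ := x
  obtain ⟨a, b, rfl, ha⟩ : ∃ a b, s = a ++ b ∧ a.length = i :=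
    ⟨s.take i, s.drop i, (List.take_append_drop _ _).symm, by
      simp only at hs; rw [List.length_take]; omega⟩
  subst ha
  simp only [ev, List.drop_left, List.take_left, List.mem_map] at ht
  obtain ⟨r, hr, rfl⟩ := ht
  simp only [List.length_append, Nat.add_assoc, Nat.add_left_cancel_iff] at hs ⊢
  rcases o with _ | _ | e | _
  · simp only [loc, List.mem_map] at hr
    obtain ⟨x, -, rfl⟩ := hr
    simp [Op.ins, Op.outs] at hs ⊢; omega
  all_goals
    obtain ⟨x, y, c, rfl⟩ : ∃ x y c, b = x :: y :: c := by
      rcases b with _ | ⟨x, _ | ⟨y, c⟩⟩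
      · simp [Op.ins] at hs; omega
      · simp [Op.ins] at hs; omega
      · exact ⟨x, y, c, rfl⟩
  · simp only [loc] at hr
    split at hr
    · simp at hr; subst hr; simp [Op.ins, Op.outs] at hs ⊢; omega
    · simp at hr
  · cases e <;> (simp [loc] at hr; subst hr; simp [Op.ins, Op.outs] at hs ⊢; omega)
  · simp only [loc] at hr
    split at hr
    · simp at hr; subst hr; simp [Op.ins, Op.outs] at hs ⊢; omega
    · simp at hr

theorem app_congr {w : List (Op × ℕ)} {n m : ℕ} (h : Leads w n m) {f g : List (Fin q) → ℕ}
    (hfg : ∀ t, t.length = m → f t = g t) {s : List (Fin q)} (hs : s.length = n) :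
    Q.app w f s = Q.app w g s := by
  induction w generalizing n s with
  | nil => cases h; exact hfg s hs
  | cons x w ih =>
    obtain ⟨k, rfl, h⟩ := h
    simp only [app]
    exact congrArg List.sum (List.map_congr_left fun t ht => ih h (Q.length_of_mem_ev hs ht))

/-- The indicator function of a labelling. -/
def ind (t s : List (Fin q)) : ℕ := if s = t then 1 else 0

theorem ind_comm (t s : List (Fin q)) : ind t s = ind s t := by simp only [ind, eq_comm]

theorem ind_append_of_length {a b s t : List (Fin q)} (h : a.length = b.length) :
    ind (a ++ s) (b ++ t) = ind a b * ind s t := by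
  have : b ++ t = a ++ s ↔ b = a ∧ t = s :=
    ⟨fun e => List.append_inj e h.symm, fun e => by rw [e.1, e.2]⟩
  simp only [ind, this, ite_and, ite_mul, one_mul, zero_mul]

/-- Both sides ask for `y = Q.bar x` and for equality of the remaining strands. -/
theorem sum_loc_birth (x y : Fin q) (c s : List (Fin q)) :
    ((Q.loc .birth s).map (ind (x :: y :: c))).sum =
      ((Q.loc .join (x :: y :: c)).map (ind s)).sum := by
  simp only [loc, List.map_map, sum_finRange, Function.comp_def, ind, List.cons.injEq, ite_and,
    Finset.sum_ite_eq', Finset.mem_univ, if_true, eq_comm (a := Q.bar x)]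
  by_cases h : y = Q.bar x <;> simp [h, ind, eq_comm]

/-- The two crossings act by inverse bijections on pairs of labels, so their permutation matrices
are transposes of each other. -/
theorem sum_loc_cross (x y x' y' : Fin q) (c c' : List (Fin q)) :
    ((Q.loc (.cross true) (x :: y :: c)).map (ind (x' :: y' :: c'))).sum =
      ((Q.loc (.cross false) (x' :: y' :: c')).map (ind (x :: y :: c))).sum := by
  simp only [loc, List.map_cons, List.map_nil, List.sum_singleton, ind, List.cons.injEq,
    Q.act_eq_iff (a := x)]
  refine if_congr ⟨?_, ?_⟩ rfl rfl
  · rintro ⟨rfl, rfl, rfl⟩; simp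
  · rintro ⟨rfl, rfl, rfl⟩; simp

theorem sum_loc_ind (o : Op) {s t : List (Fin q)} {k : ℕ} (hs : s.length = o.ins + k)
    (ht : t.length = o.outs + k) :
    ((Q.loc o s).map (ind t)).sum = ((Q.loc o.dual t).map (ind s)).sum := by
  have two : ∀ {s : List (Fin q)}, s.length = 2 + k → ∃ x y c, s = x :: y :: c := by
    intro s hs
    rcases s with _ | ⟨x, _ | ⟨y, c⟩⟩
    · simp at hs; omega
    · simp at hs; omega
    · exact ⟨x, y, c, rfl⟩
  rcases o with _ | _ | e | _
  · obtain ⟨x, y, c, rfl⟩ := two ht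
    exact Q.sum_loc_birth x y c s
  · obtain ⟨x, y, c, rfl⟩ := two hs
    exact (Q.sum_loc_birth x y c t).symm
  · obtain ⟨x, y, c, rfl⟩ := two hs
    obtain ⟨x', y', c', rfl⟩ := two ht
    cases e
    · exact (Q.sum_loc_cross x' y' x y c' c).symm
    · exact Q.sum_loc_cross x y x' y' c c'
  · obtain ⟨x, y, c, rfl⟩ := two hs
    obtain ⟨x', y', c', rfl⟩ := two ht
    simp only [loc, Op.dual]
    by_cases h : x' :: y' :: c' = x :: y :: c
    · obtain ⟨rfl, rfl, rfl⟩ : x' = x ∧ y' = y ∧ c' = c := by simpa using h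
      rfl
    · split <;> split <;> simp [ind, h, Ne.symm h]

theorem sum_ev_ind (x : Op × ℕ) {s t : List (Fin q)} {k : ℕ} (hs : s.length = x.2 + x.1.ins + k)
    (ht : t.length = x.2 + x.1.outs + k) :
    ((Q.ev x s).map (ind t)).sum = ((Q.ev (x.1.dual, x.2) t).map (ind s)).sum := by
  obtain ⟨o, i⟩ := x
  have cut : ∀ {s : List (Fin q)}, i ≤ s.length → ∃ a b, s = a ++ b ∧ a.length = i := fun {s} h =>
    ⟨s.take i, s.drop i, (List.take_append_drop _ _).symm, by rw [List.length_take]; omega⟩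
  obtain ⟨a, s, rfl, ha⟩ := cut (s := s) (by simp only at hs; omega)
  obtain ⟨b, t, rfl, hb⟩ := cut (s := t) (by simp only at ht; omega)
  simp only [ev, List.map_map, Function.comp_def, List.drop_left' ha, List.take_left' ha,
    List.drop_left' hb, List.take_left' hb, ind_append_of_length (ha.trans hb.symm),
    ind_append_of_length (hb.trans ha.symm), List.sum_map_mul_left, ind_comm a b]
  rw [Q.sum_loc_ind o (k := k)]
  · simp only [List.length_append] at hs; omega
  · simp only [List.length_append] at ht; omega

/-- The labellings above and below index a matrix for each piece. The matrix of the piece turned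
upside down is the transpose, and transposition reverses products. -/
theorem app_ind {w : List (Op × ℕ)} {n m : ℕ} (h : Leads w n m) {s t : List (Fin q)}
    (hs : s.length = n) (ht : t.length = m) :
    Q.app w (ind t) s = Q.app (dualOps w) (ind s) t := by
  induction w generalizing n s with
  | nil => exact ind_comm _ _
  | cons x w ih =>
    obtain ⟨k, rfl, h⟩ := h
    rw [dualOps_cons, app_append]
    have e1 : Q.app (x :: w) (ind t) s =
        ((Q.ev x s).map fun r => Q.app (dualOps w) (ind r) t).sum :=
      congrArg List.sum (List.map_congr_left fun r hr => ih h (Q.length_of_mem_ev hs hr))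
    rw [e1, ← app_sum_map]
    refine Q.app_congr h.dual (fun r hr => ?_) ht
    simp only [app, ← Q.sum_ev_ind x hs hr, ind_comm]

end SymQuandle

/-! ### Invariance under quandle automorphisms -/

namespace SymQuandle

variable {q : ℕ} (Q : SymQuandle q)

structure IsAut (σ : Fin q → Fin q) : Prop where
  bijective : Function.Bijective σ
  act : ∀ a c, σ (Q.act a c) = Q.act (σ a) (σ c)
  bar : ∀ a, σ (Q.bar a) = Q.bar (σ a)

def Invariant (f : List (Fin q) → ℕ) : Prop :=
  ∀ σ, Q.IsAut σ → ∀ s, f (s.map σ) = f s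

variable {Q}

/-- All labelling rules are stated in terms of `act` and `bar`, with which an automorphism commutes.
At a birth it permutes the possible labels. -/
theorem Invariant.one {f : List (Fin q) → ℕ} (hf : Q.Invariant f) (x : Op × ℕ) :
    Q.Invariant fun s => ((Q.ev x s).map f).sum := by
  intro σ hσ s
  have e : ∀ t, f (s.take x.2 |>.map σ |>.append (t.map σ)) = f (s.take x.2 ++ t) := fun t => by
    rw [← hf σ hσ (s.take x.2 ++ t), List.map_append]; rfl
  have i : ∀ {a c : Fin q}, σ c = Q.bar (σ a) ↔ c = Q.bar a := by
    intro a c; rw [← hσ.bar, hσ.bijective.injective.eq_iff]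
  simp only [ev, List.map_map, Function.comp_def, ← List.map_take, ← List.map_drop]
  generalize s.drop x.2 = r
  have short : ∀ {r : List (Fin q)}, (∀ a c d, r ≠ a :: c :: d) → r = [] ∨ ∃ a, r = [a] := by
    intro r h
    rcases r with _ | ⟨a, _ | ⟨c, d⟩⟩
    · exact .inl rfl
    · exact .inr ⟨a, rfl⟩
    · exact absurd rfl (h a c d)
  rcases x with ⟨_ | _ | b | _, k⟩
  · simp only [loc, List.map_map, sum_finRange, Function.comp_def]
    refine (Fintype.sum_bijective σ hσ.bijective _ _ fun a => ?_).symm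
    rw [← e]; simp [hσ.bar]
  all_goals
    rcases r with _ | ⟨a, _ | ⟨c, d⟩⟩
    · first | rfl | (cases b <;> rfl)
    · first | rfl | (cases b <;> rfl)
  · simp only [loc, List.map_cons, i]
    split
    · simpa using e d
    · rfl
  · cases b
    · simpa [loc, hσ.bar, hσ.act] using e (c :: Q.act (Q.bar c) a :: d)
    · simpa [loc, hσ.bar, hσ.act] using e (Q.act a c :: a :: d)
  · simp only [loc, List.map_cons, i]
    split
    · simpa using e (a :: c :: d)
    · rfl

theorem Invariant.app {f : List (Fin q) → ℕ} (hf : Q.Invariant f) (w : List (Op × ℕ)) :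
    Q.Invariant (Q.app w f) := by
  induction w with
  | nil => exact hf
  | cons x w ih => exact ih.one x

theorem invariant_ind_nil : Q.Invariant (ind []) := by
  intro σ hσ s; simp [ind]

end SymQuandle

/-! ### Correctness of the evaluation on codes -/

namespace Sweep

variable {q : ℕ}

@[simp] theorem force_eq {α : Type} (n : ℕ) (k : ℕ → α) : force n k = k n := by
  cases n <;> rfl

@[simp] theorem forceList_eq {α : Type} (l : List ℕ) (k : List ℕ → α) : forceList l k = k l := by
  induction l generalizing k with
  | nil => rfl
  | cons x l ih =>
    change force x (fun x => forceList l fun l => k (x :: l)) = _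
    rw [force_eq, ih]

@[simp] theorem forceLists_eq {α : Type} (l : List (List ℕ)) (k : List (List ℕ) → α) :
    forceLists l k = k l := by
  induction l generalizing k with
  | nil => rfl
  | cons x l ih =>
    change forceList x (fun x => forceLists l fun l => k (x :: l)) = _
    rw [forceList_eq, ih]

/-- The result list `r` does not depend on the continuation; only its multiset is described, since
the order of accumulation is irrelevant. -/
theorem gather_spec {β γ : Type} {f : ∀ {α : Type}, β → List γ → (List γ → α) → α}
    {g : β → Multiset γ} {l : List β}
    (h : ∀ x ∈ l, ∀ acc : List γ, ∃ r : List γ, (r : Multiset γ) = g x + acc ∧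
      ∀ (α : Type) (k : List γ → α), f x acc k = k r) (acc : List γ) :
    ∃ r : List γ, (r : Multiset γ) = (l : Multiset β).bind g + acc ∧
      ∀ (α : Type) (k : List γ → α), gather f l acc k = k r := by
  induction l generalizing acc with
  | nil => exact ⟨acc, by simp, fun _ _ => rfl⟩
  | cons x l ih =>
    obtain ⟨r, hr, hk⟩ := h x (by simp) acc
    obtain ⟨r', hr', hk'⟩ := ih (fun y hy => h y (by simp [hy])) r
    refine ⟨r', ?_, fun α k => ?_⟩
    · rw [hr', hr, ← Multiset.cons_coe, Multiset.cons_bind]; abel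
    · change f x acc (fun t => gather f l t k) = _
      rw [hk, hk']

/-- The code of a labelling. -/
def enc : List (Fin q) → ℕ
  | [] => 1
  | a :: s => a + 8 * enc s

/-- The contribution of an initial segment of strands to a code, without the end marker 1 that `enc`
puts after the last strand. -/
def low : List (Fin q) → ℕ
  | [] => 0
  | a :: s => a + 8 * low s

theorem enc_append (a s : List (Fin q)) : enc (a ++ s) = low a + 8 ^ a.length * enc s := by
  induction a with
  | nil => simp [low]
  | cons x a ih => simp only [List.cons_append, enc, low, ih, List.length_cons, pow_succ]; ring

theorem low_lt (hq : q ≤ 8) (a : List (Fin q)) : low a < 8 ^ a.length := by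
  induction a with
  | nil => simp [low]
  | cons x a ih => simp only [low, List.length_cons, pow_succ]; omega

theorem enc_pos (s : List (Fin q)) : 0 < enc s := by
  induction s with
  | nil => simp [enc]
  | cons x s ih => simp only [enc]; omega

theorem enc_lt (hq : q ≤ 8) (s : List (Fin q)) : enc s < 2 * 8 ^ s.length := by
  induction s with
  | nil => simp [enc]
  | cons x s ih => simp only [enc, List.length_cons, pow_succ]; omega

theorem enc_injective (hq : q ≤ 8) : Function.Injective (enc (q := q)) := by
  intro s
  induction s with
  | nil =>
    intro t h
    cases t with
    | nil => rfl
    | cons y t => have := enc_pos t; simp only [enc] at h; omega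
  | cons x s ih =>
    intro t h
    cases t with
    | nil => have := enc_pos s; simp only [enc] at h; omega
    | cons y t =>
      simp only [enc] at h
      rw [Fin.ext (by omega : (x : ℕ) = y), ih (by omega : enc s = enc t)]

/-- The table describes the quandle. -/
structure Tab.Models (T : Tab) (Q : SymQuandle q) : Prop where
  le : q ≤ 8
  births : T.births = (List.finRange q).map fun a : Fin q => (a : ℕ) + 8 * (Q.bar a : ℕ)
  pos : ∀ a c : Fin q, (T.pos >>> (6 * ((a : ℕ) + 8 * c))) % 64 = (Q.act a c : ℕ) + 8 * a
  neg : ∀ a c : Fin q, (T.neg >>> (6 * ((a : ℕ) + 8 * c))) % 64 = (c : ℕ) + 8 * (Q.act (Q.bar c) a : ℕ)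
  glue : ∀ a c : Fin q, (T.glue >>> ((a : ℕ) + 8 * c)) % 2 = if c = Q.bar a then 1 else 0
  auts : T.auts = [] ∨ ∀ a : Fin q, ∃ σ, Q.IsAut σ ∧
    ∀ c : Fin q, (nth 0 T.auts a >>> (3 * (c : ℕ))) % 8 = (σ c : ℕ)

variable {T : Tab} {Q : SymQuandle q}

theorem div_enc (hq : q ≤ 8) (a s : List (Fin q)) : enc (a ++ s) / 8 ^ a.length = enc s := by
  rw [enc_append, Nat.add_mul_div_left _ _ (by positivity), Nat.div_eq_of_lt (low_lt hq a), zero_add]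

theorem mod_enc (hq : q ≤ 8) (a s : List (Fin q)) : enc (a ++ s) % 8 ^ a.length = low a := by
  rw [enc_append, Nat.add_mul_mod_self_left, Nat.mod_eq_of_lt (low_lt hq a)]

theorem enc_cons_cons_mod (hq : q ≤ 8) (a c : Fin q) (s : List (Fin q)) :
    enc (a :: c :: s) % 64 = a + 8 * c := by simp only [enc]; omega

theorem enc_cons_cons_div (hq : q ≤ 8) (a c : Fin q) (s : List (Fin q)) :
    enc (a :: c :: s) / 64 = enc s := by simp only [enc]; omega

/-- The letter of a piece. -/
def opLetter (x : Op × ℕ) : ℕ := x.1.code + 8 * x.2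

theorem letterOp_spec (hT : T.Models Q) (x : Op × ℕ) {k : ℕ} {S : Multiset (List (Fin q))}
    (hS : ∀ s ∈ S, s.length = x.2 + x.1.ins + k) {V : List ℕ} (hV : (V : Multiset ℕ) = S.map enc) :
    (letterOp T (opLetter x) V : Multiset ℕ) =
      (S.bind fun s => (Q.ev x s : Multiset (List (Fin q)))).map enc := by
  classical
  have main : ∀ {f : ∀ {α : Type}, ℕ → List ℕ → (List ℕ → α) → α},
      (∀ s ∈ S, ∀ acc : List ℕ, ∃ r : List ℕ, (r : Multiset ℕ) = (Q.ev x s : Multiset (List (Fin q))).map enc + acc ∧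
        ∀ (α : Type) (k : List ℕ → α), f (enc s) acc k = k r) →
      ((gather f V [] (fun V => V) : List ℕ) : Multiset ℕ) =
        (S.bind fun s => (Q.ev x s : Multiset (List (Fin q)))).map enc := by
    intro f hf
    obtain ⟨r, hr, hk⟩ := gather_spec (f := f) (l := V)
      -- On a code, `g` decodes by choosing a preimage; injectivity of `enc` identifies the choice
      -- afterwards.
      (g := fun c => if h : ∃ s ∈ S, enc s = c then (Q.ev x h.choose : Multiset (List (Fin q))).map enc else 0)
      (fun c hc acc => by
        have h : ∃ s ∈ S, enc s = c := by
          rw [← Multiset.mem_coe, hV] at hc; exact Multiset.mem_map.1 hc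
        simp only [h, dite_true]
        obtain ⟨h1, h2⟩ := h.choose_spec
        obtain ⟨r, hr, hk⟩ := hf _ h1 acc
        rw [h2] at hk
        exact ⟨r, hr, hk⟩) []
    rw [hk, hr, hV, Multiset.bind_map, Multiset.map_bind]
    simp only [Multiset.coe_nil, add_zero]
    refine Multiset.bind_congr fun s hs => ?_
    have h : ∃ s' ∈ S, enc s' = enc s := ⟨s, hs, rfl⟩
    rw [dif_pos h, enc_injective hT.le h.choose_spec.2]
  have cut : ∀ s ∈ S, ∃ a b, s = a ++ b ∧ a.length = x.2 ∧ b.length = x.1.ins + k := fun s hs =>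
    ⟨s.take x.2, s.drop x.2, (List.take_append_drop _ _).symm, by
      rw [List.length_take, hS s hs]; omega, by rw [List.length_drop, hS s hs]; omega⟩
  have two : ∀ {s : List (Fin q)}, s.length = 2 + k → ∃ x y c, s = x :: y :: c := by
    intro s hs
    rcases s with _ | ⟨x, _ | ⟨y, c⟩⟩
    · simp at hs; omega
    · simp at hs; omega
    · exact ⟨x, y, c, rfl⟩
  have hd : Nat.div (opLetter x) 8 = x.2 := by
    obtain ⟨_ | _ | ⟨_ | _⟩ | _, i⟩ := x <;> change opLetter _ / 8 = _ <;>
      simp only [opLetter, Op.code] <;> omega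
  have hm : Nat.mod (opLetter x) 8 = x.1.code := by
    obtain ⟨_ | _ | ⟨_ | _⟩ | _, i⟩ := x <;> change opLetter _ % 8 = _ <;>
      simp only [opLetter, Op.code] <;> omega
  have ev_eq : ∀ (o : Op) (a b : List (Fin q)),
      Q.ev (o, a.length) (a ++ b) = (Q.loc o b).map (a ++ ·) := by
    intro o a b; simp only [SymQuandle.ev, List.drop_left, List.take_left]
  have single : ∀ (t : List (Fin q)) (acc : List ℕ), ((enc t :: acc : List ℕ) : Multiset ℕ) =
      (([t] : List (List (Fin q))) : Multiset (List (Fin q))).map enc + acc := fun t acc => rfl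
  have none : ∀ acc : List ℕ, (acc : Multiset ℕ) =
      (([] : List (List (Fin q))) : Multiset (List (Fin q))).map enc + acc := fun acc => by simp
  simp only [letterOp, force_eq, hd, hm]
  obtain ⟨o, i⟩ := x
  rcases o with _ | _ | b | _
  · change ((gather (birthOp T.births (Nat.pow 8 i)) V [] (fun V => V) : List ℕ) : Multiset ℕ) = _
    refine main (f := fun {_} => birthOp T.births (Nat.pow 8 i)) fun s hs acc => ?_
    obtain ⟨a, b, rfl, rfl, hb⟩ := cut s hs
    obtain ⟨r, hr, hk⟩ := gather_spec (γ := ℕ) (l := T.births)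
      (f := fun y acc k => force (Nat.add (low a) (Nat.mul (Nat.pow 8 a.length)
        (Nat.add y (Nat.mul 64 (enc b))))) fun c => k (c :: acc))
      (g := fun y => {low a + 8 ^ a.length * (y + 64 * enc b)})
      (fun y _ acc => ⟨_, rfl, fun α k => force_eq _ _⟩) acc
    refine ⟨r, ?_, fun α k => ?_⟩
    · rw [hr, hT.births, ev_eq]
      simp only [SymQuandle.loc, List.map_map, Multiset.bind_singleton, Multiset.map_coe,
        Function.comp_def, enc_append, enc]
      congr 3
      funext y
      ring
    · have e1 : Nat.div (enc (a ++ b)) (Nat.pow 8 a.length) = _ := div_enc hT.le a _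
      have e2 : Nat.mod (enc (a ++ b)) (Nat.pow 8 a.length) = _ := mod_enc hT.le a _
      simp only [birthOp, e1, e2, force_eq] at hk ⊢
      exact hk α k
  all_goals
    have key : ∀ (a : List (Fin q)) (x y : Fin q) (c : List (Fin q)),
        Nat.div (enc (a ++ x :: y :: c)) (Nat.pow 8 a.length) = enc (x :: y :: c) ∧
        Nat.mod (enc (a ++ x :: y :: c)) (Nat.pow 8 a.length) = low a ∧
        Nat.mod (enc (x :: y :: c)) 64 = x + 8 * y ∧ Nat.div (enc (x :: y :: c)) 64 = enc c :=
      fun a x y c => ⟨div_enc hT.le a _, mod_enc hT.le a _, enc_cons_cons_mod hT.le x y c,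
        enc_cons_cons_div hT.le x y c⟩
  · change ((gather (joinOp T.glue (Nat.pow 8 i)) V [] (fun V => V) : List ℕ) : Multiset ℕ) = _
    refine main (f := fun {_} => joinOp T.glue (Nat.pow 8 i)) fun s hs acc => ?_
    obtain ⟨a, b, rfl, rfl, hb⟩ := cut s hs
    obtain ⟨x, y, c, rfl⟩ := two hb
    obtain ⟨e1, e2, e3, e4⟩ := key a x y c
    have e5 : Nat.mod (Nat.shiftRight T.glue (x + 8 * y)) 2 = _ := hT.glue x y
    simp only [joinOp, force_eq, e1, e2, e3, e4, e5, ev_eq, SymQuandle.loc]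
    split
    · exact ⟨_, single (a ++ c) acc, fun α k => by rw [enc_append]; rfl⟩
    · exact ⟨_, none acc, fun α k => rfl⟩
  · have cross : ∀ (P : ℕ) (f : Fin q → Fin q → List (Fin q)),
        (∀ x y c, Q.loc (.cross b) (x :: y :: c) = [f x y ++ c]) →
        (∀ x y, low (f x y) = Nat.mod (Nat.shiftRight P (Nat.mul 6 (x + 8 * y))) 64) →
        (∀ x y, (f x y).length = 2) →
        ((gather (permOp P (Nat.pow 8 i)) V [] (fun V => V) : List ℕ) : Multiset ℕ) =
          (S.bind fun s => (Q.ev (.cross b, i) s : Multiset (List (Fin q)))).map enc := by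
      intro P f h1 h2 h3
      refine main (f := fun {_} => permOp P (Nat.pow 8 i)) fun s hs acc => ?_
      obtain ⟨a, b, rfl, rfl, hb⟩ := cut s hs
      obtain ⟨x, y, c, rfl⟩ := two hb
      obtain ⟨e1, e2, e3, e4⟩ := key a x y c
      simp only [permOp, force_eq, e1, e2, e3, e4, ev_eq, h1, ← h2]
      exact ⟨_, single (a ++ (f x y ++ c)) acc, fun α k => by
        rw [enc_append, enc_append, h3]; rfl⟩
    cases b
    · exact cross T.neg (fun x y => [y, Q.act (Q.bar y) x]) (fun _ _ _ => rfl)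
        (fun x y => (hT.neg x y).symm) fun _ _ => rfl
    · exact cross T.pos (fun x y => [Q.act x y, x]) (fun _ _ _ => rfl)
        (fun x y => (hT.pos x y).symm) fun _ _ => rfl
  · change ((gather (glueOp T.glue (Nat.pow 8 i)) V [] (fun V => V) : List ℕ) : Multiset ℕ) = _
    refine main (f := fun {_} => glueOp T.glue (Nat.pow 8 i)) fun s hs acc => ?_
    obtain ⟨a, b, rfl, rfl, hb⟩ := cut s hs
    obtain ⟨x, y, c, rfl⟩ := two hb
    obtain ⟨e1, e2, e3, e4⟩ := key a x y c
    have e5 : Nat.mod (Nat.shiftRight T.glue (x + 8 * y)) 2 = _ := hT.glue x y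
    simp only [glueOp, e1, e3, e5, ev_eq, SymQuandle.loc]
    split
    · exact ⟨_, single (a ++ x :: y :: c) acc, fun α k => rfl⟩
    · exact ⟨_, none acc, fun α k => rfl⟩

end Sweep

namespace Sweep

variable {q : ℕ} {T : Tab} {Q : SymQuandle q}

theorem wordOp_append (T : Tab) (u w V : List ℕ) :
    wordOp T (u ++ w) V = wordOp T u (wordOp T w V) := by
  induction u with
  | nil => rfl
  | cons x u ih => exact congrArg (letterOp T x) ih

/-- The letters of a word, the last letter first. -/
def opLetters (w : List (Op × ℕ)) : List ℕ := (w.map opLetter).reverse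

theorem opLetters_cons (x : Op × ℕ) (w : List (Op × ℕ)) :
    opLetters (x :: w) = opLetters w ++ [opLetter x] := by simp [opLetters]

/-- The multiset `S'` consists of the labellings below the word with their multiplicities. The
identity for all `f` is the property that survives the later reductions. -/
theorem wordOp_spec (hT : T.Models Q) {w : List (Op × ℕ)} {n m : ℕ} (hw : Leads w n m)
    {S : Multiset (List (Fin q))} (hS : ∀ s ∈ S, s.length = n) {V : List ℕ}
    (hV : (V : Multiset ℕ) = S.map enc) :
    ∃ S' : Multiset (List (Fin q)), (wordOp T (opLetters w) V : Multiset ℕ) = S'.map enc ∧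
      (∀ s ∈ S', s.length = m) ∧ ∀ f, (S.map (Q.app w f)).sum = (S'.map f).sum := by
  induction w generalizing n S V with
  | nil => cases hw; exact ⟨S, hV, hS, fun f => rfl⟩
  | cons x w ih =>
    obtain ⟨k, rfl, hw⟩ := hw
    obtain ⟨S', h1, h2, h3⟩ := ih hw (S := S.bind fun s => (Q.ev x s : Multiset (List (Fin q))))
      (fun t ht => by
        obtain ⟨s, hs, ht⟩ := Multiset.mem_bind.1 ht
        exact Q.length_of_mem_ev (hS s hs) ht) (letterOp_spec hT x hS hV)
    refine ⟨S', ?_, h2, fun f => ?_⟩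
    · rw [opLetters_cons, wordOp_append]; exact h1
    · rw [← h3, Multiset.map_bind, Multiset.sum_bind]
      congr 1

theorem applyAut_spec {σ : Fin q → Fin q} (hq : q ≤ 8) {A : ℕ}
    (hA : ∀ c : Fin q, (A >>> (3 * (c : ℕ))) % 8 = (σ c : ℕ)) {s : List (Fin q)}
    (hs : s.length ≤ 16) : applyAut A (enc s) = enc (s.map σ) := by
  have main : ∀ (n : ℕ) (s : List (Fin q)), s.length ≤ n →
      Nat.rec (motive := fun _ => ℕ → ℕ) (fun c => c) (fun _ ih c => bif Nat.ble 8 c then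
        Nat.add (Nat.mod (Nat.shiftRight A (Nat.mul 3 (Nat.mod c 8))) 8)
          (Nat.mul 8 (ih (Nat.div c 8))) else c) n (enc s) = enc (s.map σ) := by
    intro n
    induction n with
    | zero => intro s hs; rw [List.length_eq_zero_iff.1 (Nat.le_zero.1 hs)]; rfl
    | succ n ih =>
      intro s hs
      rcases s with _ | ⟨a, s⟩
      · rfl
      · have h1 : Nat.ble 8 (enc (a :: s)) = true := by
          have := enc_pos s; rw [Nat.ble_eq]; simp only [enc]; omega
        have h2 : Nat.mod (enc (a :: s)) 8 = a := by
          change enc (a :: s) % 8 = a; simp only [enc]; omega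
        have h3 : Nat.div (enc (a :: s)) 8 = enc s := by
          change enc (a :: s) / 8 = _; simp only [enc]; omega
        have h4 : Nat.mod (Nat.shiftRight A (Nat.mul 3 a)) 8 = σ a := hA a
        simp only [h1, h2, h3, h4, cond_true, List.map_cons]
        rw [ih s (by simpa using hs)]
        rfl
  exact main 16 s hs

/-- Each labelling may be moved by its own automorphism, since an invariant `f` is summed termwise.
With an empty list of automorphisms nothing is moved, and no invariance is needed. -/
theorem canonOp_spec (hT : T.Models Q) {S : Multiset (List (Fin q))}
    (hS : ∀ s ∈ S, s.length ≤ 16) {V : List ℕ} (hV : (V : Multiset ℕ) = S.map enc) :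
    ∃ S' : Multiset (List (Fin q)), (canonOp T V : Multiset ℕ) = S'.map enc ∧
      (∀ n, (∀ s ∈ S, s.length = n) → ∀ s ∈ S', s.length = n) ∧
      ∀ f, (T.auts = [] ∨ Q.Invariant f) → (S.map f).sum = (S'.map f).sum := by
  rcases hT.auts with h | h
  · refine ⟨S, ?_, fun n h => h, fun f _ => rfl⟩
    simp only [canonOp, h]
    exact hV
  · by_cases h0 : T.auts = []
    · refine ⟨S, ?_, fun n h => h, fun f _ => rfl⟩
      simp only [canonOp, h0]
      exact hV
    have e : canonOp T V = gather (fun c acc k => force (nth 0 T.auts (Nat.mod c 8)) fun A =>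
        force (applyAut A c) fun c => k (c :: acc)) V [] fun V => V := by
      have : ∀ (L W : List ℕ), L ≠ [] →
          List.rec (motive := fun _ => List ℕ) V (fun _ _ _ => W) L = W := by
        rintro (_ | ⟨A, L⟩) W h
        · exact absurd rfl h
        · rfl
      exact this _ _ h0
    choose σ hσ hA using h
    -- The empty labelling has no first label to choose an automorphism, and every automorphism
    -- fixes it.
    let g : List (Fin q) → List (Fin q)
      | [] => []
      | a :: s => (a :: s).map (σ a)
    obtain ⟨r, hr, hk⟩ := gather_spec (γ := ℕ) (l := V)
      (f := fun c acc k => force (nth 0 T.auts (Nat.mod c 8)) fun A =>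
        force (applyAut A c) fun c => k (c :: acc))
      (g := fun c => {applyAut (nth 0 T.auts (Nat.mod c 8)) c})
      (fun y _ acc => ⟨_, rfl, fun α k => by simp only [force_eq]; rfl⟩) []
    refine ⟨S.map g, ?_, fun n hn s hs => ?_, fun f hf => ?_⟩
    · rw [e, hk, hr, hV, Multiset.bind_singleton, Multiset.map_map, Multiset.map_map,
        Multiset.coe_nil, add_zero]
      refine Multiset.map_congr rfl fun s hs => ?_
      rcases s with _ | ⟨a, s⟩
      · rfl
      · have h2 : Nat.mod (enc (a :: s)) 8 = a := by
          have := hT.le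
          change enc (a :: s) % 8 = a; simp only [enc]; omega
        simp only [Function.comp, h2]
        exact applyAut_spec hT.le (hA a) (hS _ hs)
    · obtain ⟨t, ht, rfl⟩ := Multiset.mem_map.1 hs
      rw [← hn t ht]
      rcases t with _ | ⟨a, t⟩
      · rfl
      · simp only [g, List.length_map]
    · rw [Multiset.map_map]
      refine congrArg Multiset.sum (Multiset.map_congr rfl fun s _ => ?_)
      rcases s with _ | ⟨a, s⟩
      · rfl
      · exact ((hf.resolve_left h0) (σ a) (hσ a) (a :: s)).symm

/-! ### Multisets of codes as numbers -/

/-- The number with the digits `d 0, …, d (m - 1)` in the base `2 ^ 14`. -/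
def val (d : ℕ → ℕ) (m : ℕ) : ℕ := ∑ i ∈ Finset.range m, d i * 16384 ^ i

theorem val_lt {d : ℕ → ℕ} {m : ℕ} (h : ∀ i < m, d i < 16384) : val d m < 16384 ^ m := by
  induction m with
  | zero => simp [val]
  | succ m ih =>
    have h1 := ih fun i hi => h i (by omega)
    have h2 := Nat.mul_le_mul_right (16384 ^ m) (Nat.le_sub_one_of_lt (h m (by omega)))
    rw [val, Finset.sum_range_succ, ← val, pow_succ]
    omega

theorem val_add (d : ℕ → ℕ) (m n : ℕ) :
    val d (m + n) = val d m + 16384 ^ m * val (fun i => d (m + i)) n := by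
  simp only [val, Finset.sum_range_add, Finset.mul_sum, pow_add]
  congr 1
  exact Finset.sum_congr rfl fun i _ => by ring

theorem val_div_mod {d : ℕ → ℕ} {m c : ℕ} (h : ∀ i < m, d i < 16384) (hc : c < m) :
    val d m / 16384 ^ c % 16384 = d c := by
  obtain ⟨n, rfl⟩ := Nat.exists_eq_add_of_lt hc
  rw [Nat.add_assoc, val_add, Nat.add_mul_div_left _ _ (by positivity),
    Nat.div_eq_of_lt (val_lt fun i hi => h i (by omega)), zero_add, Nat.add_comm n, val_add,
    pow_one, Nat.add_mul_mod_self_left]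
  simpa [val] using h c hc

theorem eq_val {N m : ℕ} (h : N < 16384 ^ m) : N = val (fun c => N / 16384 ^ c % 16384) m := by
  induction m generalizing N with
  | zero => simpa [val] using h
  | succ m ih =>
    have h1 : N / 16384 ^ m < 16384 := Nat.div_lt_of_lt_mul (by rwa [pow_succ] at h)
    have h2 := ih (N := N % 16384 ^ m) (Nat.mod_lt _ (by positivity))
    rw [val, Finset.sum_range_succ, ← val, Nat.mod_eq_of_lt h1]
    conv_lhs => rw [← Nat.mod_add_div N (16384 ^ m), h2, mul_comm]
    congr 1
    refine Finset.sum_congr rfl fun i hi => ?_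
    rw [Finset.mem_range] at hi
    obtain ⟨e, rfl⟩ := Nat.exists_eq_add_of_lt hi
    beta_reduce
    rw [Nat.add_assoc, pow_add, Nat.mod_mul_right_div_self, pow_succ,
      Nat.mod_mul_left_mod]

theorem val_mul (k : ℕ) (d : ℕ → ℕ) (m : ℕ) : k * val d m = val (fun i => k * d i) m := by
  simp only [val, Finset.mul_sum, mul_assoc]

/-- The multiset with given multiplicities. -/
def ofCounts (d : ℕ → ℕ) (c m : ℕ) : Multiset ℕ :=
  ∑ i ∈ Finset.range m, Multiset.replicate (d (c + i)) (c + i)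

theorem ofCounts_add (d : ℕ → ℕ) (c m n : ℕ) :
    ofCounts d c (m + n) = ofCounts d c m + ofCounts d (c + m) n := by
  simp only [ofCounts, Finset.sum_range_add, Nat.add_assoc]

theorem replicateOp_spec {α : Type} (c n : ℕ) (acc : List ℕ) (k : List ℕ → α) :
    replicateOp c n acc k = k (List.replicate n c ++ acc) := by
  induction n generalizing acc with
  | zero => rfl
  | succ n ih =>
    change replicateOp c n (c :: acc) k = _
    rw [ih, List.replicate_succ', List.append_assoc]
    rfl

/-- The block of digits is halved at each step. A block with value zero has only zero digits, so the
search may stop there. -/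
theorem digitsOp_spec (n c : ℕ) {d : ℕ → ℕ} (h : ∀ i < 2 ^ n, d (c + i) < 16384) (acc : List ℕ) :
    ∃ r : List ℕ, (r : Multiset ℕ) = ofCounts d c (2 ^ n) + acc ∧
      ∀ (α : Type) (k : List ℕ → α),
        digitsOp n c (val (fun i => d (c + i)) (2 ^ n)) acc k = k r := by
  induction n generalizing c acc with
  | zero =>
    refine ⟨List.replicate (d c) c ++ acc, ?_, fun α k => ?_⟩
    · simp [ofCounts, ← Multiset.coe_add, Multiset.coe_replicate]
    · refine Eq.trans ?_ (replicateOp_spec c (d c) acc k)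
      simp [val, digitsOp]
  | succ n ih =>
    obtain ⟨r₁, h1, hk1⟩ := ih (c + 2 ^ n) (fun i hi => by
      rw [Nat.add_assoc]; exact h _ (by rw [pow_succ]; omega)) acc
    obtain ⟨r₂, h2, hk2⟩ := ih c (fun i hi => h _ (by rw [pow_succ]; omega)) r₁
    by_cases h0 : val (fun i => d (c + i)) (2 ^ (n + 1)) = 0
    · refine ⟨acc, ?_, fun α k => ?_⟩
      · have : ofCounts d c (2 ^ (n + 1)) = 0 := by
          refine Finset.sum_eq_zero fun i hi => ?_
          have := (Finset.sum_eq_zero_iff.1 h0) i hi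
          simp at this
          simp [this]
        rw [this, zero_add]
      · rw [h0]; rfl
    · refine ⟨r₂, ?_, fun α k => ?_⟩
      · rw [h2, h1, pow_succ, mul_two, ofCounts_add]; abel
      · have hsh : Nat.shiftLeft 1 n = 2 ^ n := by
          change 1 <<< n = _; rw [Nat.shiftLeft_eq, one_mul]
        have hB : 2 ^ (14 * 2 ^ n) = 16384 ^ (2 ^ n) := by rw [pow_mul]; norm_num
        have e1 : val (fun i => d (c + i)) (2 ^ (n + 1)) = val (fun i => d (c + i)) (2 ^ n) +
            16384 ^ 2 ^ n * val (fun i => d (c + 2 ^ n + i)) (2 ^ n) := by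
          rw [pow_succ, mul_two, val_add]; simp only [Nat.add_assoc]
        have e2 : Nat.shiftRight (val (fun i => d (c + i)) (2 ^ (n + 1))) (Nat.mul 14 (2 ^ n)) =
            val (fun i => d (c + 2 ^ n + i)) (2 ^ n) := by
          change _ >>> (14 * 2 ^ n) = _
          rw [Nat.shiftRight_eq_div_pow, hB, e1, Nat.add_mul_div_left _ _ (by positivity),
            Nat.div_eq_of_lt (val_lt fun i hi => h _ (by rw [pow_succ]; omega)), zero_add]
        have e3 : Nat.sub (val (fun i => d (c + i)) (2 ^ (n + 1))) (Nat.shiftLeft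
            (val (fun i => d (c + 2 ^ n + i)) (2 ^ n)) (Nat.mul 14 (2 ^ n))) =
            val (fun i => d (c + i)) (2 ^ n) := by
          change _ - _ <<< (14 * 2 ^ n) = _
          rw [Nat.shiftLeft_eq, hB, e1, mul_comm]; omega
        have h0' : Nat.beq (val (fun i => d (c + i)) (2 ^ (n + 1))) 0 = false := by
          exact Bool.eq_false_iff.2 fun h => h0 (Nat.eq_of_beq_eq_true h)
        change (bif Nat.beq _ 0 then k acc else
          force (Nat.shiftLeft 1 n) fun h => force (Nat.mul 14 h) fun e =>
          force (Nat.shiftRight _ e) fun hi => force (Nat.sub _ (Nat.shiftLeft hi e)) fun lo =>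
          force (Nat.add c h) fun c' => digitsOp n c' hi acc fun acc => digitsOp n c lo acc k) = _
        rw [h0', cond_false]
        simp only [force_eq, hsh, e2, e3]
        exact (hk1 _ _).trans (hk2 _ _)

end Sweep

namespace Sweep

variable {q : ℕ} {T : Tab} {Q : SymQuandle q}

theorem ofCounts_count {V : Multiset ℕ} {m : ℕ} (h : ∀ c ∈ V, c < m) :
    ofCounts (fun c => V.count c) 0 m = V := by
  ext a
  simp only [ofCounts, zero_add, Multiset.count_sum', Multiset.count_replicate]
  rw [Finset.sum_ite_eq']
  split
  · rfl
  · rename_i ha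
    exact (Multiset.count_eq_zero.2 fun h' => ha (Finset.mem_range.2 (h a h'))).symm

theorem val_count {V : Multiset ℕ} {m : ℕ} (h : ∀ c ∈ V, c < m) :
    val (fun c => V.count c) m = (V.map fun c => 16384 ^ c).sum := by
  rw [Finset.sum_multiset_map_count, val]
  refine (Finset.sum_subset (fun c hc => Finset.mem_range.2 (h c (Multiset.mem_toFinset.1 hc)))
    fun c _ hc => ?_).symm
  rw [Multiset.count_eq_zero.2 (mt Multiset.mem_toFinset.2 hc), zero_mul]

def bits (V : Multiset ℕ) : ℕ :=
  18446744073709551616 * (V.map fun c => 16384 ^ c).sum + (V.map fun c => c ^ 3).sum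

theorem toBits_eq (V : List ℕ) (n : ℕ) : toBits V n = n + bits V := by
  induction V generalizing n with
  | nil => simp [toBits, bits]
  | cons c V ih =>
    have e : bit c = 18446744073709551616 * 16384 ^ c + c ^ 3 := by
      change 18446744073709551616 <<< (14 * c) + c ^ 3 = _
      rw [Nat.shiftLeft_eq, pow_mul]; norm_num
    change force (n + bit c) (fun n => toBits V n) = _
    rw [force_eq, ih, e]
    simp only [bits, ← Multiset.cons_coe, Multiset.map_cons, Multiset.sum_cons]
    ring

theorem len_eq (V : List ℕ) (n : ℕ) : len V n = n + V.length := by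
  induction V generalizing n with
  | nil => rfl
  | cons c V ih =>
    change force n (fun n => len V (n + 1)) = _
    rw [force_eq, ih, List.length_cons]; ring

/-- Fewer than `2 ^ 14` codes below `2 ^ 13` have cubes adding up to less than `2 ^ 53`, so the hash
in the low 64 bits never reaches the multiplicities. -/
theorem cubes_lt {V : Multiset ℕ} (h : ∀ c ∈ V, c < 8192) (hV : V.card < 16384) :
    (V.map fun c => c ^ 3).sum < 18446744073709551616 := by
  have : (V.map fun c => c ^ 3).sum ≤ (V.map fun c => c ^ 3).card • 8192 ^ 3 :=
    Multiset.sum_le_card_nsmul _ _ fun x hx => by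
      obtain ⟨c, hc, rfl⟩ := Multiset.mem_map.1 hx
      exact Nat.pow_le_pow_left (h c hc).le 3
  rw [Multiset.card_map, smul_eq_mul] at this
  omega

theorem bits_shiftRight {V : Multiset ℕ} (h : ∀ c ∈ V, c < 8192) (hV : V.card < 16384) :
    bits V >>> 64 = val (fun c => V.count c) 8192 := by
  rw [val_count h, Nat.shiftRight_eq_div_pow, bits, Nat.mul_add_div (by norm_num),
    Nat.div_eq_of_lt (cubes_lt h hV), add_zero]

theorem ofBits_bits {V : Multiset ℕ} (h : ∀ c ∈ V, c < 8192) (hV : V.card < 16384) :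
    (ofBits (bits V) : Multiset ℕ) = V := by
  obtain ⟨r, hr, hk⟩ := digitsOp_spec 13 0 (d := fun c => V.count c)
    (fun i _ => (Multiset.count_le_card _ _).trans_lt hV) []
  have e : Nat.shiftRight (bits V) 64 = _ := bits_shiftRight h hV
  rw [ofBits, e]
  simp only [zero_add] at hk
  erw [hk]
  rw [hr, Multiset.coe_nil, add_zero]
  exact ofCounts_count h

/-- The number `b` stands for the multiset `S` of labellings of `n` strands. -/
structure Rep (b : ℕ) (S : Multiset (List (Fin q))) (n : ℕ) : Prop where
  eq : b = bits (S.map enc)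
  card_lt : S.card < 16384
  length : ∀ s ∈ S, s.length = n

theorem Rep.lt {b n : ℕ} {S : Multiset (List (Fin q))} (h : Rep b S n) (hq : q ≤ 8) (hn : n ≤ 4) :
    ∀ c ∈ S.map enc, c < 8192 := by
  intro c hc
  obtain ⟨s, hs, rfl⟩ := Multiset.mem_map.1 hc
  refine (enc_lt hq s).trans_le ?_
  rw [h.length s hs]
  exact (Nat.mul_le_mul_left 2 (Nat.pow_le_pow_right (by norm_num) hn)).trans (by norm_num)

theorem Rep.ofBits {b n : ℕ} {S : Multiset (List (Fin q))} (h : Rep b S n) (hq : q ≤ 8)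
    (hn : n ≤ 4) : (ofBits b : Multiset ℕ) = S.map enc := by
  rw [h.eq, ofBits_bits (h.lt hq hn) (by rw [Multiset.card_map]; exact h.card_lt)]

theorem rowOp_spec (hT : T.Models Q) {w : List (Op × ℕ)} {n m b b' : ℕ} (hw : Leads w n m)
    (hn : n ≤ 4) (hm : m ≤ 4) {S : Multiset (List (Fin q))} (hS : Rep b S n)
    (h : rowOp T (opLetters w) b = b' + 1) :
    ∃ S' : Multiset (List (Fin q)), Rep b' S' m ∧
      ∀ f, (T.auts = [] ∨ Q.Invariant f) → (S.map (Q.app w f)).sum = (S'.map f).sum := by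
  obtain ⟨S₁, h1, h2, h3⟩ := wordOp_spec hT hw hS.length (hS.ofBits hT.le hn)
  obtain ⟨S₂, h4, h5, h6⟩ := canonOp_spec hT (fun s hs => by rw [h2 s hs]; omega) h1
  simp only [rowOp, len_eq, toBits_eq, zero_add] at h
  have hc : S₂.card < 16384 ∧ bits (S₂.map enc) = b' := by
    rw [← h4, ← Multiset.card_map enc S₂, ← h4, Multiset.coe_card]
    cases h7 : Nat.ble (Nat.succ (canonOp T (wordOp T (opLetters w) (ofBits b))).length) 16384
    · rw [h7] at h; cases h
    · rw [h7] at h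
      exact ⟨Nat.le_of_ble_eq_true h7, Nat.succ.inj h⟩
  exact ⟨S₂, ⟨hc.2.symm, hc.1, h5 m h2⟩, fun f hf => (h3 f).trans (h6 f hf)⟩

theorem val_const (m : ℕ) :
    Nat.mul 14336 (Nat.div (Nat.sub (Nat.pow 16384 m) 1) 16383) = val (fun _ => 14336) m := by
  rw [val, ← Finset.mul_sum, Nat.geomSum_eq (m := 16384) (by norm_num) m]
  rfl

theorem mask_eq : mask = val (fun _ => 14336) 8192 := by
  unfold mask
  -- With a variable exponent the geometric sum is handled symbolically and the huge numeral is
  -- never computed.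
  generalize 8192 = m
  exact val_const m

theorem mask_digit {c : ℕ} (hc : c < 8192) : mask / 16384 ^ c % 16384 = 14336 :=
  mask_eq ▸ val_div_mod (d := fun _ => 14336) (fun _ _ => by norm_num) hc

/-- Bitwise conjunction acts digit by digit because the base is a power of two, and 14336 is `7 * 2
^ 11`. -/
theorem digit_lt {N c : ℕ} (h : N &&& mask = 0) (hc : c < 8192) : N / 16384 ^ c % 16384 < 2048 := by
  have hB : 16384 ^ c = 2 ^ (14 * c) := by rw [pow_mul]; norm_num
  have h1 : (N / 16384 ^ c % 16384) &&& 14336 = 0 := by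
    rw [← mask_digit hc, show 16384 = 2 ^ 14 by norm_num, ← Nat.and_mod_two_pow,
      show (2 ^ 14) ^ c = 2 ^ (14 * c) by rw [pow_mul], ← Nat.shiftRight_eq_div_pow,
      ← Nat.shiftRight_eq_div_pow, ← Nat.shiftRight_and_distrib, h]
    simp
  have h2 : N / 16384 ^ c % 16384 < 16384 := Nat.mod_lt _ (by norm_num)
  generalize N / 16384 ^ c % 16384 = x at *
  have h3 : (x >>> 11) &&& 7 = 0 := by
    have := congrArg (· >>> 11) h1
    simpa [Nat.shiftRight_and_distrib] using this
  rw [show 7 = 2 ^ 3 - 1 by norm_num, Nat.and_two_pow_sub_one_eq_mod, Nat.shiftRight_eq_div_pow] at h3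
  omega

theorem exists_nsmul {α : Type} [DecidableEq α] {k : ℕ} {S : Multiset α}
    (h : ∀ a ∈ S, k ∣ S.count a) : ∃ S', S = k • S' := by
  refine ⟨∑ a ∈ S.toFinset, Multiset.replicate (S.count a / k) a, ?_⟩
  conv_lhs => rw [← Multiset.toFinset_sum_count_nsmul_eq S]
  rw [Finset.smul_sum]
  refine Finset.sum_congr rfl fun a ha => ?_
  rw [← Multiset.nsmul_singleton, smul_smul, Nat.mul_div_cancel' (h a (Multiset.mem_toFinset.1 ha))]

/-- The test excludes carries, both between the digits and out of the low word. Multiplication by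
`k` is therefore multiplication of every multiplicity, and the equality of numbers becomes an
equality of multisets. -/
theorem isMul_spec (hq : q ≤ 8) {k n b b' : ℕ} (hk : 0 < k) (hk' : k ≤ 8) (hn : n ≤ 4)
    {S : Multiset (List (Fin q))} (hS : Rep b S n) (h : isMul k b b' = true) :
    ∃ S', S = k • S' ∧ Rep b' S' n := by
  have hlt := hS.lt hq hn
  have hcard : (S.map enc).card < 16384 := by rw [Multiset.card_map]; exact hS.card_lt
  obtain ⟨h1, h2, h3⟩ : k * b' = b ∧ (b' >>> 64) &&& mask = 0 ∧
      k * (b' % 18446744073709551616) < 18446744073709551616 := by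
    unfold isMul at h
    cases h1 : Nat.beq (Nat.mul k b') b
    · rw [h1] at h; cases h
    cases h2 : Nat.beq (Nat.land (Nat.shiftRight b' 64) mask) 0
    · rw [h1, h2] at h; cases h
    rw [h1, h2] at h
    exact ⟨Nat.eq_of_beq_eq_true h1, Nat.eq_of_beq_eq_true h2, Nat.le_of_ble_eq_true h⟩
  have h4 : k * (b' >>> 64) = val (fun c => (S.map enc).count c) 8192 := by
    rw [← bits_shiftRight hlt hcard, ← hS.eq, ← h1, Nat.shiftRight_eq_div_pow,
      Nat.shiftRight_eq_div_pow, show (2 : ℕ) ^ 64 = 18446744073709551616 by norm_num]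
    conv_rhs => rw [← Nat.mod_add_div b' 18446744073709551616, Nat.mul_add, mul_left_comm,
      Nat.add_mul_div_left _ _ (by norm_num), Nat.div_eq_of_lt h3, zero_add]
  have h5 : b' >>> 64 < 16384 ^ 8192 :=
    (Nat.le_mul_of_pos_left _ hk).trans_lt (h4 ▸ val_lt fun i _ =>
      (Multiset.count_le_card _ _).trans_lt hcard)
  -- Both sides of `h4` are expansions with digits below 16384, so they can be compared digit by
  -- digit.
  have h6 : ∀ c < 8192, k ∣ (S.map enc).count c := by
    intro c hc
    have e := h4
    rw [eq_val h5, val_mul] at e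
    have := congrArg (fun N => N / 16384 ^ c % 16384) e
    beta_reduce at this
    rw [val_div_mod (fun i hi => ?_) hc,
      val_div_mod (fun i _ => (Multiset.count_le_card _ _).trans_lt hcard) hc] at this
    · exact ⟨_, this.symm⟩
    · exact (Nat.mul_le_mul hk' (Nat.le_pred_of_lt (digit_lt h2 hi))).trans_lt (by norm_num)
  obtain ⟨S', rfl⟩ := exists_nsmul (S := S) fun s hs => by
    have := h6 (enc s) (hlt _ (Multiset.mem_map_of_mem _ hs))
    rwa [Multiset.count_map_eq_count' _ _ (enc_injective hq)] at this
  refine ⟨S', rfl, ?_, ?_, ?_⟩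
  · have := hS.eq
    rw [← h1, Multiset.map_nsmul, bits] at this
    simp only [Multiset.map_nsmul, Multiset.sum_nsmul, smul_eq_mul] at this
    refine Nat.eq_of_mul_eq_mul_left hk (this.trans ?_)
    rw [bits]; ring
  · have := hS.card_lt
    rw [Multiset.card_nsmul] at this
    exact (Nat.le_mul_of_pos_left _ hk).trans_lt this
  · intro s hs
    exact hS.length s (Multiset.mem_nsmul.2 ⟨hk.ne', hs⟩)

end Sweep

/-! ### The three quandles and their tables -/

namespace Sweep

/-- The quandle of the eight 3-cycles of the alternating group of degree 4. -/
def quandleA : SymQuandle 8 where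
  act := ![![0, 1, 5, 4, 7, 6, 2, 3], ![0, 1, 6, 7, 3, 2, 5, 4], ![7, 5, 2, 0, 4, 6, 1, 3],
    ![7, 5, 1, 3, 0, 2, 6, 4], ![3, 6, 2, 7, 4, 1, 5, 0], ![3, 6, 1, 4, 0, 5, 2, 7],
    ![4, 2, 5, 3, 7, 1, 6, 0], ![4, 2, 6, 0, 3, 5, 1, 7]]
  bar := ![1, 0, 4, 6, 2, 7, 3, 5]
  act_self := by decide +kernel
  bar_bar := by decide +kernel
  act_bar := by decide +kernel
  bar_act_act := by decide +kernel
  act_act := by decide +kernel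

/-- The dihedral quandle of order 3. -/
def quandleR : SymQuandle 3 where
  act a c := 2 * a - c
  bar := id
  act_self := by decide +kernel
  bar_bar := by decide +kernel
  act_bar := by decide +kernel
  bar_act_act := by decide +kernel
  act_act := by decide +kernel

/-- The trivial quandle of order 3. -/
def quandleT : SymQuandle 3 where
  act _ c := c
  bar := id
  act_self := by decide +kernel
  bar_bar := by decide +kernel
  act_bar := by decide +kernel
  bar_act_act := by decide +kernel
  act_act := by decide +kernel

/-- Automorphisms of the quandle; the one with the number `a` maps `a` to `0`. -/
def autA : Fin 8 → Fin 8 → Fin 8 :=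
  ![![0, 1, 2, 3, 4, 5, 6, 7], ![1, 0, 7, 6, 5, 4, 3, 2], ![5, 7, 0, 2, 1, 3, 4, 6],
    ![3, 6, 5, 0, 7, 2, 1, 4], ![4, 2, 1, 7, 0, 6, 5, 3], ![2, 4, 3, 5, 6, 0, 7, 1],
    ![6, 3, 4, 1, 2, 7, 0, 5], ![7, 5, 6, 4, 3, 1, 2, 0]]

theorem isAut_autA (a : Fin 8) : quandleA.IsAut (autA a) where
  bijective := by
    rw [Fintype.bijective_iff_injective_and_card]
    refine ⟨?_, rfl⟩
    revert a
    simp only [Function.Injective]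
    decide +kernel
  act := by revert a; decide +kernel
  bar := by revert a; decide +kernel

theorem models_tabA : tabA.Models quandleA where
  le := le_rfl
  births := by decide +kernel
  pos := by decide +kernel
  neg := by decide +kernel
  glue := by decide +kernel
  auts := .inr fun a => ⟨autA a, isAut_autA a, by revert a; decide +kernel⟩

theorem models_tabA' : tabA'.Models quandleA where
  le := le_rfl
  births := by decide +kernel
  pos := by decide +kernel
  neg := by decide +kernel
  glue := by decide +kernel
  auts := .inl rfl

theorem models_tabR : tabR.Models quandleR where
  le := by norm_num
  births := by decide +kernel
  pos := by decide +kernel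
  neg := by decide +kernel
  glue := by decide +kernel
  auts := .inl rfl

theorem models_tabT : tabT.Models quandleT where
  le := by norm_num
  births := by decide +kernel
  pos := by decide +kernel
  neg := by decide +kernel
  glue := by decide +kernel
  auts := .inl rfl

variable {q : ℕ} {T : Tab} {Q : SymQuandle q}

/-! ### Sums over labellings up to a power of `q` -/

variable (T Q) in
/-- Up to a factor `q ^ e`, the labellings below the word `U` are those in the multiset `b`. -/
def Sums (U : List (Op × ℕ)) (b n e : ℕ) : Prop :=
  ∃ S : Multiset (List (Fin q)), Rep b S n ∧
    ∀ f, (T.auts = [] ∨ Q.Invariant f) → Q.app U f [] = q ^ e * (S.map f).sum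

theorem Sums.row (hT : T.Models Q) {U w : List (Op × ℕ)} {n m b b' e : ℕ} (h : Sums T Q U b n e)
    (hw : Leads w n m) (hn : n ≤ 4) (hm : m ≤ 4) (hb : rowOp T (opLetters w) b = b' + 1) :
    Sums T Q (U ++ w) b' m e := by
  obtain ⟨S, hS, h⟩ := h
  obtain ⟨S', hS', h'⟩ := rowOp_spec hT hw hn hm hS hb
  refine ⟨S', hS', fun f hf => ?_⟩
  rw [Q.app_append, h _ (hf.imp_right fun hf => hf.app w), h' f hf]

theorem Sums.div (hT : T.Models Q) (hq : 0 < q) {U : List (Op × ℕ)} {n b b' e : ℕ}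
    (h : Sums T Q U b n e) (hn : n ≤ 4) (hb : isMul q b b' = true) : Sums T Q U b' n (e + 1) := by
  obtain ⟨S, hS, h⟩ := h
  obtain ⟨S', rfl, hS'⟩ := isMul_spec hT.le hq hT.le hn hS hb
  refine ⟨S', hS', fun f hf => ?_⟩
  rw [h f hf, Multiset.map_nsmul, Multiset.sum_nsmul, smul_eq_mul, pow_succ, mul_assoc]

/-- Stopping the division early is harmless, because any exponent will do. The quotient is chosen
before the word `U`, so it serves all words with the same multiset. -/
theorem thin_spec (hT : T.Models Q) (hq : 0 < q) (b : ℕ) :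
    ∃ b', (∀ (k : ℕ → Bool), thin q b k = k b') ∧ ∀ U n e, n ≤ 4 → Sums T Q U b n e →
      ∃ e', Sums T Q U b' n e' := by
  have main : ∀ i b, ∃ b', (∀ (k : ℕ → Bool), Nat.rec (motive := fun _ => ℕ → Bool)
      (fun b => k b) (fun _ ih b => force (Nat.div b q) fun b' =>
        bif isMul q b b' then ih b' else k b) i b = k b') ∧
      ∀ U n e, n ≤ 4 → Sums T Q U b n e → ∃ e', Sums T Q U b' n e' := by
    intro i
    induction i with
    | zero => exact fun b => ⟨b, fun k => rfl, fun U n e _ h => ⟨e, h⟩⟩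
    | succ i ih =>
      intro b
      obtain ⟨b', h1, h2⟩ := ih (Nat.div b q)
      cases h : isMul q b (Nat.div b q)
      · exact ⟨b, fun k => by simp only [force_eq, h, cond_false], fun U n e _ h => ⟨e, h⟩⟩
      · exact ⟨b', fun k => by
          simp only [force_eq, h, cond_true] at h1 ⊢; exact h1 k,
          fun U n e hn hb => h2 U n _ hn (hb.div hT hq hn h)⟩
  exact main 6 b

/-- The two multisets are divided equally often. A common exponent is essential: only then does
equality of the final counts remain visible. -/
theorem thin₂_spec {T' : Tab} {Q' : SymQuandle q} (hT : T.Models Q) (hT' : T'.Models Q')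
    (hq : 0 < q) (b c : ℕ) :
    ∃ b' c', (∀ (k : ℕ → ℕ → Bool), thin₂ q b c k = k b' c') ∧ ∀ U n e, n ≤ 4 →
      Sums T Q U b n e → Sums T' Q' U c n e → ∃ e', Sums T Q U b' n e' ∧ Sums T' Q' U c' n e' := by
  have main : ∀ i b c, ∃ b' c', (∀ (k : ℕ → ℕ → Bool), Nat.rec (motive := fun _ => ℕ → ℕ → Bool)
      (fun b c => k b c) (fun _ ih b c => force (Nat.div b q) fun b' =>
        force (Nat.div c q) fun c' =>
        bif isMul q b b' then bif isMul q c c' then ih b' c' else k b c else k b c) i b c =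
          k b' c') ∧ ∀ U n e, n ≤ 4 → Sums T Q U b n e → Sums T' Q' U c n e →
        ∃ e', Sums T Q U b' n e' ∧ Sums T' Q' U c' n e' := by
    intro i
    induction i with
    | zero => exact fun b c => ⟨b, c, fun k => rfl, fun U n e _ h h' => ⟨e, h, h'⟩⟩
    | succ i ih =>
      intro b c
      obtain ⟨b', c', h1, h2⟩ := ih (Nat.div b q) (Nat.div c q)
      cases h : isMul q b (Nat.div b q)
      · exact ⟨b, c, fun k => by simp only [force_eq, h, cond_false],
          fun U n e _ h h' => ⟨e, h, h'⟩⟩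
      cases h' : isMul q c (Nat.div c q)
      · exact ⟨b, c, fun k => by simp only [force_eq, h, h', cond_false, cond_true],
          fun U n e _ h h' => ⟨e, h, h'⟩⟩
      · exact ⟨b', c', fun k => by
          simp only [force_eq, h, h', cond_true] at h1 ⊢; exact h1 k,
          fun U n e hn hb hc => h2 U n _ hn (hb.div hT hq hn h) (hc.div hT' hq hn h')⟩
  exact main 6 b c

end Sweep

/-! ### States and their transitions -/

/-- Numbering of the smoothings. -/
def Smoothing.idx : Smoothing → ℕ
  | .singular => 0
  | .positive => 1
  | .negative => 2

namespace Sweep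

/-- The list `s` describes the labellings below the words `U κ`, which end in `n` strands. -/
structure State (T : Tab) (U : Smoothing → List (Op × ℕ)) (s : List ℕ) (n : ℕ) : Prop where
  strands : nth 0 s 0 = n
  le : n ≤ 4
  leads : ∀ κ, Leads (U κ) 0 n
  sumsA : ∀ κ : Smoothing, ∃ e, Sums T quandleA (U κ) (nth 0 s (1 + κ.idx)) n e
  sumsRT : ∀ κ : Smoothing, ∃ e, Sums tabR quandleR (U κ) (nth 0 s (4 + 2 * κ.idx)) n e ∧
    Sums tabT quandleT (U κ) (nth 0 s (5 + 2 * κ.idx)) n e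

/-- The list `w` describes the words `W κ` from `n` to `m` strands. -/
structure Entry (W : Smoothing → List (Op × ℕ)) (w : List (List ℕ)) (n m : ℕ) : Prop where
  strands : nth 0 (nth [] w 0) 0 = m
  le : m ≤ 4
  leads : ∀ κ, Leads (W κ) n m
  eq : ∀ κ : Smoothing, nth [] w (1 + κ.idx) = opLetters (W κ)

theorem orFail_eq_true {n : ℕ} {k : ℕ → Bool} (h : orFail n k = true) :
    ∃ m, n = m + 1 ∧ k m = true := by
  cases n with
  | zero => cases h
  | succ m => exact ⟨m, rfl, h⟩

/-- The transition along `w`. -/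
def Step (T : Tab) (w : List (List ℕ)) (s s' : List ℕ) : Prop :=
  ∀ U W n m, State T U s n → Entry W w n m → State T (fun κ => U κ ++ W κ) s' m

/-- The new state depends only on the old state and the description of the row, not on the words
above. This justifies keeping one copy of equal states in the search. -/
theorem stateOp_spec (hT : T.Models quandleA) {w : List (List ℕ)} {s : List ℕ} {k : List ℕ → Bool}
    (h : stateOp T w s k = true) : ∃ s', k s' = true ∧ Step T w s s' := by
  obtain ⟨a₀, ha₀, h⟩ := orFail_eq_true h
  obtain ⟨a₁, ha₁, h⟩ := orFail_eq_true h
  obtain ⟨a₂, ha₂, h⟩ := orFail_eq_true h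
  obtain ⟨r₀, hr₀, h⟩ := orFail_eq_true h
  obtain ⟨t₀, ht₀, h⟩ := orFail_eq_true h
  obtain ⟨r₁, hr₁, h⟩ := orFail_eq_true h
  obtain ⟨t₁, ht₁, h⟩ := orFail_eq_true h
  obtain ⟨r₂, hr₂, h⟩ := orFail_eq_true h
  obtain ⟨t₂, ht₂, h⟩ := orFail_eq_true h
  obtain ⟨a₀', e, pa₀⟩ := thin_spec hT (by norm_num) a₀
  rw [e] at h
  obtain ⟨a₁', e, pa₁⟩ := thin_spec hT (by norm_num) a₁
  rw [e] at h
  obtain ⟨a₂', e, pa₂⟩ := thin_spec hT (by norm_num) a₂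
  rw [e] at h
  obtain ⟨r₀', t₀', e, p₀⟩ := thin₂_spec models_tabR models_tabT (by norm_num) r₀ t₀
  rw [e] at h
  obtain ⟨r₁', t₁', e, p₁⟩ := thin₂_spec models_tabR models_tabT (by norm_num) r₁ t₁
  rw [e] at h
  obtain ⟨r₂', t₂', e, p₂⟩ := thin₂_spec models_tabR models_tabT (by norm_num) r₂ t₂
  rw [e] at h
  refine ⟨_, h, fun U W n m hU hW => ⟨hW.strands, hW.le, fun κ => (hU.leads κ).append (hW.leads κ),
    fun κ => ?_, fun κ => ?_⟩⟩
  · obtain ⟨e, hs⟩ := hU.sumsA κ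
    have hw := hW.eq κ
    cases κ
    · exact pa₀ _ _ e hW.le (hs.row hT (hW.leads _) hU.le hW.le (hw ▸ ha₀))
    · exact pa₁ _ _ e hW.le (hs.row hT (hW.leads _) hU.le hW.le (hw ▸ ha₁))
    · exact pa₂ _ _ e hW.le (hs.row hT (hW.leads _) hU.le hW.le (hw ▸ ha₂))
  · obtain ⟨e, hr, ht⟩ := hU.sumsRT κ
    have hw := hW.eq κ
    cases κ
    · exact p₀ _ _ e hW.le (hr.row models_tabR (hW.leads _) hU.le hW.le (hw ▸ hr₀))
        (ht.row models_tabT (hW.leads _) hU.le hW.le (hw ▸ ht₀))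
    · exact p₁ _ _ e hW.le (hr.row models_tabR (hW.leads _) hU.le hW.le (hw ▸ hr₁))
        (ht.row models_tabT (hW.leads _) hU.le hW.le (hw ▸ ht₁))
    · exact p₂ _ _ e hW.le (hr.row models_tabR (hW.leads _) hU.le hW.le (hw ▸ hr₂))
        (ht.row models_tabT (hW.leads _) hU.le hW.le (hw ▸ ht₂))

theorem state_start (T : Tab) : State T (fun _ => []) start 0 := by
  have main : ∀ (q : ℕ) (T : Tab) (Q : SymQuandle q), Sums T Q [] (bit 1) 0 0 := fun q T Q =>
    ⟨{[]}, ⟨by simp [bits, enc, bit], by simp, by simp⟩, fun f _ => by simp [SymQuandle.app]⟩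
  refine ⟨rfl, by norm_num, fun κ => rfl, fun κ => ⟨0, ?_⟩, fun κ => ⟨0, ?_⟩⟩
  · cases κ <;> exact main _ _ _
  · cases κ <;> exact ⟨main _ _ _, main _ _ _⟩

end Sweep

/-! ### The test for complicated diagrams -/

/-- Conditions on the numbers of labellings, which hold if the diagram is as simple as its
resolutions. -/
def Forced (a r t : Smoothing → ℕ) : Prop :=
  (∃ j, a .positive = 8 ^ j) → (∃ j, a .negative = 8 ^ j) → r .positive = t .positive →
    r .negative = t .negative → r .singular = t .singular ∧ (a .singular = 0 ∨ ∃ j, a .singular = 8 ^ j)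

/-- The equation makes `x` a power of 2, and comparing exponents modulo 3 makes it a power of 8. -/
theorem exists_pow_of_mul {x y e e' : ℕ} (h : 8 ^ e * x = 8 ^ e' * y) (hy : ∃ j, y = 8 ^ j) :
    ∃ j, x = 8 ^ j := by
  obtain ⟨j, rfl⟩ := hy
  have h1 : x ∣ 2 ^ (3 * (e' + j)) := ⟨8 ^ e, by
    rw [mul_comm x, h, pow_mul, pow_add]; norm_num⟩
  obtain ⟨i, -, rfl⟩ := (Nat.dvd_prime_pow Nat.prime_two).1 h1
  have h2 : 2 ^ (3 * e + i) = 2 ^ (3 * (e' + j)) := by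
    rw [pow_add, pow_mul, pow_mul, pow_add]; norm_num; exact h
  have h3 := Nat.pow_right_injective le_rfl h2
  refine ⟨e' + j - e, ?_⟩
  rw [show i = 3 * (e' + j - e) by omega, pow_mul]; norm_num

/-- The test only asks whether counts by 8 labels vanish or are powers of 8, and whether two counts
by 3 labels agree. Factors `8 ^ e`, and a factor `3 ^ e` common to the latter two, change neither.
-/
theorem Forced.congr {a r t a' r' t' : Smoothing → ℕ}
    (ha : ∀ κ, ∃ e e', 8 ^ e * a κ = 8 ^ e' * a' κ)
    (hrt : ∀ κ, ∃ e e', 3 ^ e * r κ = 3 ^ e' * r' κ ∧ 3 ^ e * t κ = 3 ^ e' * t' κ)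
    (h : Forced a r t) : Forced a' r' t' := by
  have ra : ∀ κ, (∃ j, a κ = 8 ^ j) ↔ ∃ j, a' κ = 8 ^ j := fun κ => by
    obtain ⟨e, e', h⟩ := ha κ
    exact ⟨exists_pow_of_mul h.symm, exists_pow_of_mul h⟩
  have rt : ∀ κ, r κ = t κ ↔ r' κ = t' κ := fun κ => by
    obtain ⟨e, e', h1, h2⟩ := hrt κ
    constructor
    · intro h; rw [h, h2] at h1; exact (Nat.eq_of_mul_eq_mul_left (by positivity) h1).symm
    · intro h; rw [h, ← h2] at h1; exact Nat.eq_of_mul_eq_mul_left (by positivity) h1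
  have r0 : a .singular = 0 ↔ a' .singular = 0 := by
    obtain ⟨e, e', h⟩ := ha .singular
    constructor <;> intro h' <;> rw [h'] at h <;> simpa using h
  simpa only [Forced, ra, rt, r0] using h

namespace Sweep

/-- A divisor of `2 ^ 60` is a power of 2, and 2 has order 3 modulo 7, so the remainder 1 means that
the exponent is divisible by 3. -/
theorem isPow_iff {n : ℕ} (hn : n < 8 ^ 20) : isPow n = true ↔ ∃ j, n = 8 ^ j := by
  have e : isPow n = true ↔ 2 ^ 60 % n = 0 ∧ n % 7 = 1 := by
    have h1 : Nat.beq (Nat.mod 1152921504606846976 n) 0 = true ↔ 2 ^ 60 % n = 0 := by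
      rw [Nat.beq_eq]; rfl
    have h2 : Nat.beq (Nat.mod n 7) 1 = true ↔ n % 7 = 1 := by rw [Nat.beq_eq]; rfl
    rw [isPow, ← h1, ← h2]
    cases Nat.beq (Nat.mod 1152921504606846976 n) 0 <;> simp
  rw [e]
  constructor
  · rintro ⟨h1, h2⟩
    obtain ⟨i, hi, rfl⟩ := (Nat.dvd_prime_pow Nat.prime_two).1 (Nat.dvd_of_mod_eq_zero h1)
    refine ⟨i / 3, ?_⟩
    rw [← Nat.div_add_mod i 3, pow_add, pow_mul] at h2 ⊢
    have h3 : (2 ^ 3) ^ (i / 3) % 7 = 1 := by rw [Nat.pow_mod]; norm_num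
    have : i % 3 < 3 := Nat.mod_lt _ (by norm_num)
    interval_cases h : i % 3
    · norm_num
    · omega
    · omega
  · rintro ⟨j, rfl⟩
    have hj : j ≤ 20 := ((Nat.pow_lt_pow_iff_right (by norm_num)).1 hn).le
    constructor
    · rw [show 2 ^ 60 = 8 ^ 20 by norm_num]
      exact Nat.mod_eq_zero_of_dvd (pow_dvd_pow 8 hj)
    · rw [Nat.pow_mod]; norm_num

theorem inner_aux (a : ℕ) (V : List ℕ) (n : ℕ) :
    List.rec (motive := fun _ => ℕ → ℕ) (fun n => n) (fun c _ ih n => force (Nat.add n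
      (Nat.mod (Nat.shiftRight a (Nat.add 64 (Nat.mul 14 c))) 16384)) fun n => ih n) V n =
      n + ((V : Multiset ℕ).map fun c => (a >>> 64) / 16384 ^ c % 16384).sum := by
  induction V generalizing n with
  | nil => rfl
  | cons c V ih =>
    have e : Nat.mod (Nat.shiftRight a (Nat.add 64 (Nat.mul 14 c))) 16384 =
        (a >>> 64) / 16384 ^ c % 16384 := by
      change a >>> (64 + 14 * c) % 16384 = _
      rw [Nat.shiftRight_add, Nat.shiftRight_eq_div_pow _ (14 * c), pow_mul]; norm_num
    simp only [force_eq] at ih ⊢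
    rw [ih, e, ← Multiset.cons_coe, Multiset.map_cons, Multiset.sum_cons, ← Nat.add_assoc]
    rfl

variable {q : ℕ} {T : Tab} {Q : SymQuandle q}

theorem inner_spec (hq : q ≤ 8) {a b n : ℕ} {S S' : Multiset (List (Fin q))} (hS : Rep a S n)
    (hS' : Rep b S' n) (hn : n ≤ 4) : inner a b = (S'.map fun s => S.count s).sum := by
  have h1 := inner_aux a (ofBits b) 0
  have h2 : inner a b = _ := h1
  have hc : (S.map enc).card < 16384 := by rw [Multiset.card_map]; exact hS.card_lt
  rw [h2, zero_add, hS'.ofBits hq hn, Multiset.map_map, hS.eq,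
    bits_shiftRight (hS.lt hq hn) hc]
  refine congrArg Multiset.sum (Multiset.map_congr rfl fun s hs => ?_)
  rw [Function.comp, val_div_mod (fun i _ => (Multiset.count_le_card _ _).trans_lt hc)
    (hS'.lt hq hn _ (Multiset.mem_map_of_mem _ hs)),
    Multiset.count_map_eq_count' _ _ (enc_injective hq)]

theorem sum_ind (S S' : Multiset (List (Fin q))) :
    (S.map fun s => (S'.map (SymQuandle.ind s)).sum).sum = (S'.map fun s => S.count s).sum := by
  induction S using Multiset.induction_on with
  | empty => simp
  | cons s S ih =>
    simp only [Multiset.map_cons, Multiset.sum_cons, ih, Multiset.count_cons, Multiset.sum_map_add]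
    rw [add_comm]
    rfl

/-- The word is cut below `U`. The function summed over the upper labellings is invariant under
automorphisms, being derived from the empty labelling. The indicator functions used for the lower
half are not, hence the condition on `T'`. The bound, needed by `isPow`, holds since both multisets
have fewer than `2 ^ 14` elements. -/
theorem app_eq_inner (hT : T.Models Q) {T' : Tab} (h' : T'.auts = [])
    {U W : List (Op × ℕ)} {a b n e e' : ℕ} (hn : n ≤ 4) (ha : Sums T Q U a n e)
    (hb : Sums T' Q W b n e') (hW : Leads W 0 n) :
    Q.app (U ++ dualOps W) (SymQuandle.ind []) [] = q ^ (e + e') * inner a b ∧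
      inner a b < 8 ^ 20 := by
  obtain ⟨S, hS, h⟩ := ha
  obtain ⟨S', hS', hs'⟩ := hb
  have e1 := inner_spec hT.le hS hS' hn
  constructor
  · have e2 : S.map (Q.app (dualOps W) (SymQuandle.ind [])) =
        S.map fun s => q ^ e' * (S'.map (SymQuandle.ind s)).sum :=
      Multiset.map_congr rfl fun s hs => by
        rw [← hs' _ (.inl h'), Q.app_ind hW rfl (hS.length s hs)]
    rw [Q.app_append, h _ (.inr (SymQuandle.invariant_ind_nil.app _)), e1, ← sum_ind, pow_add,
      mul_assoc, e2, Multiset.sum_map_mul_left]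
  · rw [e1]
    have : (S'.map fun s => S.count s).sum ≤ (S'.map fun s => S.count s).card • 16384 :=
      Multiset.sum_le_card_nsmul _ _ fun x hx => by
        obtain ⟨s, -, rfl⟩ := Multiset.mem_map.1 hx
        exact (Multiset.count_le_card _ _).trans hS.card_lt.le
    rw [Multiset.card_map, smul_eq_mul] at this
    have := hS'.card_lt
    norm_num
    omega

/-- The number of labellings of a closed word. -/
def closedCount (Q : SymQuandle q) (W : Smoothing → List (Op × ℕ)) (κ : Smoothing) : ℕ :=
  Q.app (W κ) (SymQuandle.ind []) []

def ForcedWord (W : Smoothing → List (Op × ℕ)) : Prop :=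
  Forced (closedCount quandleA W) (closedCount quandleR W) (closedCount quandleT W)

/-- Variables stand for the inner products, so that the proof is a case split on Boolean tests and
evaluates nothing. -/
theorem pairOp_iff_aux {n m a₀ a₁ a₂ r₀ r₁ r₂ t₀ t₁ t₂ : ℕ} (hn : n = m) (h₀ : a₀ < 8 ^ 20)
    (h₁ : a₁ < 8 ^ 20) (h₂ : a₂ < 8 ^ 20) :
    (bif Nat.beq n m then
      force a₁ fun a₁ => bif isPow a₁ then
      force a₂ fun a₂ => bif isPow a₂ then
      bif Nat.beq r₁ t₁ then
      bif Nat.beq r₂ t₂ then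
      bif Nat.beq r₀ t₀ then
      force a₀ fun a₀ => bif Nat.beq a₀ 0 then true else isPow a₀
      else false else true else true else true else true
    else true) = true ↔ ((∃ j, a₁ = 8 ^ j) → (∃ j, a₂ = 8 ^ j) → r₁ = t₁ → r₂ = t₂ →
      r₀ = t₀ ∧ (a₀ = 0 ∨ ∃ j, a₀ = 8 ^ j)) := by
  rw [← isPow_iff h₀, ← isPow_iff h₁, ← isPow_iff h₂, ← Nat.beq_eq (x := r₀),
    ← Nat.beq_eq (x := r₁), ← Nat.beq_eq (x := r₂), ← Nat.beq_eq (x := a₀)]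
  simp only [force_eq, (Nat.beq_eq (x := n) (y := m)).mpr hn, cond_true]
  cases isPow a₁ <;> cases isPow a₂ <;> cases Nat.beq r₁ t₁ <;> cases Nat.beq r₂ t₂ <;>
    cases Nat.beq r₀ t₀ <;> cases Nat.beq a₀ 0 <;> simp

theorem pairOp_iff (hT : T.Models quandleA) {T' : Tab} (h' : T'.auts = []) {U W : Smoothing → List (Op × ℕ)} {s u : List ℕ} {n : ℕ}
    (hs : State T U s n) (hu : State T' W u n) :
    pairOp s u = true ↔ ForcedWord fun κ => U κ ++ dualOps (W κ) := by
  have ha : ∀ κ : Smoothing, ∃ e, closedCount quandleA (fun κ => U κ ++ dualOps (W κ)) κ =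
      8 ^ e * inner (nth 0 s (1 + κ.idx)) (nth 0 u (1 + κ.idx)) ∧
      inner (nth 0 s (1 + κ.idx)) (nth 0 u (1 + κ.idx)) < 8 ^ 20 := fun κ => by
    obtain ⟨e, h⟩ := hs.sumsA κ
    obtain ⟨e', h''⟩ := hu.sumsA κ
    exact ⟨_, app_eq_inner hT h' hs.le h h'' (hu.leads κ)⟩
  have hrt : ∀ κ : Smoothing, ∃ e, closedCount quandleR (fun κ => U κ ++ dualOps (W κ)) κ =
      3 ^ e * inner (nth 0 s (4 + 2 * κ.idx)) (nth 0 u (4 + 2 * κ.idx)) ∧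
      closedCount quandleT (fun κ => U κ ++ dualOps (W κ)) κ =
      3 ^ e * inner (nth 0 s (5 + 2 * κ.idx)) (nth 0 u (5 + 2 * κ.idx)) := fun κ => by
    obtain ⟨e, h, h1⟩ := hs.sumsRT κ
    obtain ⟨e', h'', h1'⟩ := hu.sumsRT κ
    exact ⟨e + e', (app_eq_inner models_tabR rfl hs.le h h'' (hu.leads κ)).1,
      (app_eq_inner models_tabT rfl hs.le h1 h1' (hu.leads κ)).1⟩
  have key : ForcedWord (fun κ => U κ ++ dualOps (W κ)) ↔
      Forced (fun κ => inner (nth 0 s (1 + κ.idx)) (nth 0 u (1 + κ.idx)))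
        (fun κ => inner (nth 0 s (4 + 2 * κ.idx)) (nth 0 u (4 + 2 * κ.idx)))
        (fun κ => inner (nth 0 s (5 + 2 * κ.idx)) (nth 0 u (5 + 2 * κ.idx))) :=
    ⟨Forced.congr (fun κ => ⟨0, by obtain ⟨e, h, -⟩ := ha κ; exact ⟨e, by rw [h, pow_zero, one_mul]⟩⟩)
      fun κ => ⟨0, by obtain ⟨e, h, h1⟩ := hrt κ; exact ⟨e, by rw [h, pow_zero, one_mul], by
        rw [h1, pow_zero, one_mul]⟩⟩,
     Forced.congr (fun κ => by obtain ⟨e, h, -⟩ := ha κ; exact ⟨e, 0, by rw [h, pow_zero, one_mul]⟩)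
      fun κ => by obtain ⟨e, h, h1⟩ := hrt κ; exact ⟨e, 0, by rw [h, pow_zero, one_mul], by
        rw [h1, pow_zero, one_mul]⟩⟩
  rw [key]
  exact pairOp_iff_aux (hs.strands.trans hu.strands.symm) (ha .singular).choose_spec.2
    (ha .positive).choose_spec.2 (ha .negative).choose_spec.2

end Sweep

/-! ### Completeness of the enumeration -/

namespace Sweep

def Tree.Mem (x : List ℕ) : Tree → Prop
  | .leaf => False
  | .node l y r => l.Mem x ∨ x = y ∨ r.Mem x

theorem cmp_eq {α : Type} (l l' : List ℕ) (a e c : α) :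
    cmp l l' a e c = a ∨ cmp l l' a e c = c ∨ l = l' ∧ cmp l l' a e c = e := by
  induction l generalizing l' with
  | nil => cases l' <;> simp [cmp]
  | cons x l ih =>
    cases l' with
    | nil => simp [cmp]
    | cons y l' =>
      have h : cmp (x :: l) (y :: l') a e c =
        bif Nat.beq x y then cmp l l' a e c else bif Nat.ble x y then a else c := rfl
      rw [h]
      cases h1 : Nat.beq x y
      · cases h2 : Nat.ble x y <;> simp
      · rw [cond_true, Nat.eq_of_beq_eq_true h1]
        rcases ih l' with h | h | ⟨h, h'⟩
        · exact .inl h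
        · exact .inr (.inl h)
        · exact .inr (.inr ⟨by rw [h], h'⟩)

/-- Only membership matters: no order of the tree is assumed, so the comparisons affect the speed
and the number of duplicates but never lose an element. -/
theorem Tree.ins_spec {α : Type} (x : List ℕ) (t : Tree) :
    ∃ t' : Tree, (∀ k : Tree → α, Tree.ins x t k = k t') ∧ t'.Mem x ∧ ∀ y, t.Mem y → t'.Mem y := by
  induction t with
  | leaf => exact ⟨.node .leaf x .leaf, fun k => rfl, .inr (.inl rfl), fun y hy => hy.elim⟩
  | node l y r ihl ihr =>
    obtain ⟨l', hl, hl', hl''⟩ := ihl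
    obtain ⟨r', hr, hr', hr''⟩ := ihr
    have e : ∀ k : Tree → α, Tree.ins x (.node l y r) k = cmp x y
        (fun k : Tree → α => Tree.ins x l fun l => k (.node l y r)) (fun k => k (.node l y r))
        (fun k => Tree.ins x r fun r => k (.node l y r)) k := by
      intro k
      -- A comparison commutes with applying its branches to the continuation, so the branch taken
      -- is the same for all continuations.
      have : ∀ (l l' : List ℕ) (a e c : (Tree → α) → α), cmp l l' (a k) (e k) (c k) =
          cmp l l' a e c k := by
        intro l
        induction l with
        | nil => intro l' a e c; cases l' <;> rfl
        | cons x l ih =>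
          intro l' a e c
          cases l' with
          | nil => rfl
          | cons y l' =>
            change (bif Nat.beq x y then cmp l l' (a k) (e k) (c k)
              else bif Nat.ble x y then a k else c k) = (bif Nat.beq x y then cmp l l' a e c
              else bif Nat.ble x y then a else c) k
            rw [ih]
            cases Nat.beq x y <;> cases Nat.ble x y <;> rfl
      exact this x y (fun k : Tree → α => Tree.ins x l fun l => k (.node l y r))
        (fun k => k (.node l y r)) (fun k => Tree.ins x r fun r => k (.node l y r))
    simp only [e]
    rcases cmp_eq x y (fun k : Tree → α => Tree.ins x l fun l => k (.node l y r))
      (fun k => k (.node l y r)) (fun k => Tree.ins x r fun r => k (.node l y r)) with h | h | ⟨h', h⟩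
    · exact ⟨.node l' y r, fun k => by rw [h]; exact hl _, .inl hl', fun z hz => hz.imp_left (hl'' z)⟩
    · exact ⟨.node l y r', fun k => by rw [h]; exact hr _, .inr (.inr hr'),
        fun z hz => hz.imp_right fun hz => hz.imp_right (hr'' z)⟩
    · exact ⟨.node l y r, fun k => by rw [h], .inr (.inl h'), fun z hz => hz⟩

theorem Tree.mem_toList_of_mem {x : List ℕ} {t : Tree} {acc : List (List ℕ)}
    (h : t.Mem x ∨ x ∈ acc) : x ∈ t.toList acc := by
  induction t generalizing acc with
  | leaf => exact h.resolve_left id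
  | node l y r ihl ihr =>
    refine ihl ?_
    rcases h with (h | h | h) | h
    · exact .inl h
    · exact .inr (List.mem_cons.2 (.inl h))
    · exact .inr (List.mem_cons.2 (.inr (ihr (.inl h))))
    · exact .inr (List.mem_cons.2 (.inr (ihr (.inr h))))

/-- The final value of a computation in continuation passing style is recovered from the truth of
the whole. Monotonicity keeps what was achieved for earlier elements valid in the final tree. -/
theorem collect_spec {β : Type} {f : β → Tree → (Tree → Bool) → Bool} {P : β → Tree → Prop}
    (mono : ∀ x (t t' : Tree), (∀ y, t.Mem y → t'.Mem y) → P x t → P x t') {l : List β}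
    (hf : ∀ x ∈ l, ∀ t k, f x t k = true →
      ∃ t', (∀ y, t.Mem y → t'.Mem y) ∧ P x t' ∧ k t' = true) {t : Tree} {k : Tree → Bool}
    (h : collect f l t k = true) :
    ∃ t', (∀ y, t.Mem y → t'.Mem y) ∧ (∀ x ∈ l, P x t') ∧ k t' = true := by
  induction l generalizing t with
  | nil => exact ⟨t, fun _ h => h, by simp, h⟩
  | cons x l ih =>
    obtain ⟨t₁, h1, h2, h3⟩ := hf x (by simp) t _ h
    obtain ⟨t₂, h4, h5, h6⟩ := ih (fun y hy => hf y (by simp [hy])) h3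
    refine ⟨t₂, fun y hy => h4 y (h1 y hy), fun y hy => ?_, h6⟩
    rcases List.mem_cons.1 hy with rfl | hy
    · exact mono _ _ _ h4 h2
    · exact h5 y hy

theorem rowsOp_spec {T : Tab} (hT : T.Models quandleA) {R₀ R₂ R₄ : List (List (List ℕ))}
    {L : List (List ℕ)} {k : List (List ℕ) → Bool} (h : rowsOp T R₀ R₂ R₄ L k = true) :
    ∃ L', k L' = true ∧ ∀ s ∈ L, ∀ w ∈ select R₀ R₂ R₄ (nth 0 s 0), ∃ s' ∈ L', Step T w s s' := by
  obtain ⟨t, -, ht, hk⟩ := collect_spec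
    (P := fun s t => ∀ w ∈ select R₀ R₂ R₄ (nth 0 s 0), ∃ s', t.Mem s' ∧ Step T w s s')
    (fun s t t' htt h w hw => by obtain ⟨s', h1, h2⟩ := h w hw; exact ⟨s', htt _ h1, h2⟩)
    (fun s _ t k h => collect_spec (P := fun w t => ∃ s', t.Mem s' ∧ Step T w s s')
      (fun w t t' htt ⟨s', h1, h2⟩ => ⟨s', htt _ h1, h2⟩)
      (fun w _ t k h => by
        obtain ⟨s', h1, h2⟩ := stateOp_spec hT h
        obtain ⟨t', h3, h4, h5⟩ := Tree.ins_spec (α := Bool) s' t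
        rw [h3] at h1
        exact ⟨t', h5, ⟨s', h4, h2⟩, h1⟩) h) h
  rw [forceLists_eq] at hk
  exact ⟨_, hk, fun s hs w hw => by
    obtain ⟨s', h1, h2⟩ := ht s hs w hw
    exact ⟨s', Tree.mem_toList_of_mem (.inl h1), h2⟩⟩

theorem dualLetter_opLetter (x : Op × ℕ) : dualLetter (opLetter x) = opLetter (x.1.dual, x.2) := by
  have h8 : Nat.mod (opLetter x) 8 = x.1.code := by
    change opLetter x % 8 = _
    obtain ⟨_ | _ | ⟨_ | _⟩ | _, i⟩ := x <;> simp only [opLetter, Op.code] <;> omega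
  have h2 : Nat.mod (opLetter x) 2 = x.1.code % 2 := by
    change opLetter x % 2 = _
    simp only [opLetter]; omega
  rw [dualLetter, h8, h2]
  obtain ⟨_ | _ | ⟨_ | _⟩ | _, i⟩ := x
  · change opLetter _ + 1 = _; simp only [opLetter, Op.code, Op.dual]; omega
  · change opLetter _ - 1 = _; simp only [opLetter, Op.code, Op.dual]; omega
  · simp only [opLetter, Op.code, Op.dual, Bool.not_false]; change 3 + 8 * i - 1 = _; omega
  · simp only [opLetter, Op.code, Op.dual, Bool.not_true]; change 2 + 8 * i + 1 = _; omega
  · rfl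

theorem dualWord_opLetters (w : List (Op × ℕ)) :
    dualWord (opLetters w) [] = opLetters (dualOps w) := by
  have main : ∀ l acc : List ℕ, dualWord l acc = (l.map dualLetter).reverse ++ acc := by
    intro l
    induction l with
    | nil => intro acc; rfl
    | cons x l ih =>
      intro acc
      change dualWord l (dualLetter x :: acc) = _
      rw [ih]; simp
  rw [main, opLetters, opLetters, dualOps]
  simp [dualLetter_opLetter, Function.comp_def]

theorem dual_spec {α : Type} {W : Smoothing → List (Op × ℕ)} {w : List (List ℕ)} {n m : ℕ}
    (h : Entry W w n m) (hn : n ≤ 4) : ∃ w', (∀ k : List (List ℕ) → α, dual n w k = k w') ∧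
      Entry (fun κ => dualOps (W κ)) w' m n := by
  refine ⟨[[n], dualWord (nth [] w 1) [], dualWord (nth [] w 2) [], dualWord (nth [] w 3) []],
    fun k => by simp only [dual, forceList_eq], rfl, hn, fun κ => (h.leads κ).dual,
    fun κ => ?_⟩
  cases κ
  · exact (congrArg (dualWord · []) (h.eq .singular)).trans (dualWord_opLetters _)
  · exact (congrArg (dualWord · []) (h.eq .positive)).trans (dualWord_opLetters _)
  · exact (congrArg (dualWord · []) (h.eq .negative)).trans (dualWord_opLetters _)

theorem gather_mem {β γ : Type} {f : β → List γ → (List γ → Bool) → Bool}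
    {P : β → List γ → Prop} (mono : ∀ x t t', t ⊆ t' → P x t → P x t') {l : List β}
    (hf : ∀ x ∈ l, ∀ t k, f x t k = true → ∃ t', t ⊆ t' ∧ P x t' ∧ k t' = true) {t : List γ}
    {k : List γ → Bool} (h : gather f l t k = true) :
    ∃ t', t ⊆ t' ∧ (∀ x ∈ l, P x t') ∧ k t' = true := by
  induction l generalizing t with
  | nil => exact ⟨t, fun _ h => h, by simp, h⟩
  | cons x l ih =>
    obtain ⟨t₁, h1, h2, h3⟩ := hf x (by simp) t _ h
    obtain ⟨t₂, h4, h5, h6⟩ := ih (fun y hy => hf y (by simp [hy])) h3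
    refine ⟨t₂, fun y hy => h4 (h1 hy), fun y hy => ?_, h6⟩
    rcases List.mem_cons.1 hy with rfl | hy
    · exact mono _ _ _ h4 h2
    · exact h5 y hy

/-- The words `W` are among the rows. -/
def Covers (R₀ R₂ R₄ : List (List (List ℕ))) (W : Smoothing → List (Op × ℕ)) (n m : ℕ) : Prop :=
  ∃ w ∈ select R₀ R₂ R₄ n, Entry W w n m

theorem dualsFrom_spec {m : ℕ} {R₀ R₂ R₄ : List (List (List ℕ))}
    {k : List (List (List ℕ)) → Bool} (h : dualsFrom m R₀ R₂ R₄ k = true) :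
    ∃ D, k D = true ∧ ∀ W n, n ∈ ({0, 2, 4} : Finset ℕ) → Covers R₀ R₂ R₄ W n m →
      ∃ w ∈ D, Entry (fun κ => dualOps (W κ)) w m n := by
  have one : ∀ (n : ℕ) (w : List (List ℕ)) (t : List (List (List ℕ)))
      (k : List (List (List ℕ)) → Bool), n ≤ 4 →
      (bif Nat.beq (nth 0 (nth [] w 0) 0) m then dual n w fun w => k (w :: t) else k t) = true →
      ∃ t', t ⊆ t' ∧ (∀ W, Entry W w n m → ∃ w ∈ t', Entry (fun κ => dualOps (W κ)) w m n) ∧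
        k t' = true := by
    intro n w t k hn h
    cases h1 : Nat.beq (nth 0 (nth [] w 0) 0) m
    · rw [h1] at h
      exact ⟨t, fun _ h => h, fun W hW => absurd hW.strands (Nat.ne_of_beq_eq_false h1), h⟩
    · rw [h1, cond_true] at h
      simp only [dual, forceList_eq] at h
      refine ⟨_, List.subset_cons_self _ _, fun W hW => ?_, h⟩
      obtain ⟨w', h1, h2⟩ := dual_spec (α := List (List ℕ)) hW hn
      have := h1 id
      simp only [dual, forceList_eq, id] at this
      exact ⟨w', this ▸ List.mem_cons_self, h2⟩
  have mono : ∀ (n : ℕ) (x : List (List ℕ)) (t t' : List (List (List ℕ))), t ⊆ t' →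
      (∀ W, Entry W x n m → ∃ w ∈ t, Entry (fun κ => dualOps (W κ)) w m n) →
      ∀ W, Entry W x n m → ∃ w ∈ t', Entry (fun κ => dualOps (W κ)) w m n := by
    intro n x t t' htt h W hW
    obtain ⟨w, h1, h2⟩ := h W hW
    exact ⟨w, htt h1, h2⟩
  obtain ⟨t₁, -, h1, h⟩ := gather_mem (P := fun x t => ∀ W, Entry W x 0 m →
    ∃ w ∈ t, Entry (fun κ => dualOps (W κ)) w m 0) (mono 0)
    (fun w _ t k h => one 0 w t k (by norm_num) h) h
  obtain ⟨t₂, hs₂, h2, h⟩ := gather_mem (P := fun x t => ∀ W, Entry W x 2 m →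
    ∃ w ∈ t, Entry (fun κ => dualOps (W κ)) w m 2) (mono 2)
    (fun w _ t k h => one 2 w t k (by norm_num) h) h
  obtain ⟨t₃, hs₃, h3, h⟩ := gather_mem (P := fun x t => ∀ W, Entry W x 4 m →
    ∃ w ∈ t, Entry (fun κ => dualOps (W κ)) w m 4) (mono 4)
    (fun w _ t k h => one 4 w t k (by norm_num) h) h
  refine ⟨t₃, h, fun W n hn ⟨w, hw, hW⟩ => ?_⟩
  simp only [Finset.mem_insert, Finset.mem_singleton] at hn
  rcases hn with rfl | rfl | rfl
  · obtain ⟨w', hw', hE⟩ := h1 w hw W hW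
    exact ⟨w', hs₃ (hs₂ hw'), hE⟩
  · obtain ⟨w', hw', hE⟩ := h2 w hw W hW
    exact ⟨w', hs₃ hw', hE⟩
  · exact h3 w hw W hW

theorem all_eq_true {β : Type} {f : β → Bool} {l : List β} (h : all f l = true) :
    ∀ x ∈ l, f x = true := by
  induction l with
  | nil => simp
  | cons x l ih =>
    have h' : (bif f x then all f l else false) = true := h
    cases hx : f x
    · rw [hx] at h'; cases h'
    · rw [hx] at h'
      intro y hy
      rcases List.mem_cons.1 hy with rfl | hy
      · exact hx
      · exact ih h' y hy

theorem dualOps_dualOps (w : List (Op × ℕ)) : dualOps (dualOps w) = w := by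
  simp only [dualOps, List.map_reverse, List.reverse_reverse, List.map_map]
  conv_rhs => rw [← List.map_id w]
  refine List.map_congr_left fun x _ => ?_
  obtain ⟨_ | _ | ⟨_ | _⟩ | _, i⟩ := x <;> rfl

/-- Any five fitting rows give an upper state after three of them and a lower state after the
reflections of the last two; the pair was tested. The enumeration `R` and the property `P` of rows
are abstract, so the argument uses nothing of the enumeration but its completeness. -/
theorem forcedWord_of_check {R : (List (List (List ℕ)) → List (List (List ℕ)) →
      List (List (List ℕ)) → Bool) → Bool} {P : (Smoothing → List (Op × ℕ)) → ℕ → ℕ → Prop}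
    (hR : ∀ k, R k = true → ∃ R₀ R₂ R₄, k R₀ R₂ R₄ = true ∧
      ∀ W n m, n ∈ ({0, 2, 4} : Finset ℕ) → P W n m → Covers R₀ R₂ R₄ W n m)
    (h : (R fun R₀ R₂ R₄ => forceList start fun i =>
      rowsOp tabA R₀ R₂ R₄ [i] fun L => rowsOp tabA R₀ R₂ R₄ L fun L =>
      rowsOp tabA R₀ R₂ R₄ L fun L =>
      dualsFrom 0 R₀ R₂ R₄ fun D₀ => dualsFrom 2 R₀ R₂ R₄ fun D₂ =>
      dualsFrom 4 R₀ R₂ R₄ fun D₄ =>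
      rowsOp tabA' D₀ D₂ D₄ [i] fun B => rowsOp tabA' D₀ D₂ D₄ B fun B =>
      all (fun s => all (pairOp s) B) L) = true)
    {W₁ W₂ W₃ W₄ W₅ : Smoothing → List (Op × ℕ)} {n₁ n₂ n₃ n₄ : ℕ}
    (hn₁ : n₁ ∈ ({0, 2, 4} : Finset ℕ)) (hn₂ : n₂ ∈ ({0, 2, 4} : Finset ℕ))
    (hn₃ : n₃ ∈ ({0, 2, 4} : Finset ℕ)) (hn₄ : n₄ ∈ ({0, 2, 4} : Finset ℕ))
    (h₁ : P W₁ 0 n₁) (h₂ : P W₂ n₁ n₂) (h₃ : P W₃ n₂ n₃) (h₄ : P W₄ n₃ n₄) (h₅ : P W₅ n₄ 0) :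
    ForcedWord fun κ => W₁ κ ++ W₂ κ ++ W₃ κ ++ (W₄ κ ++ W₅ κ) := by
  obtain ⟨R₀, R₂, R₄, h, hR⟩ := hR _ h
  rw [forceList_eq] at h
  obtain ⟨L₁, h, hL₁⟩ := rowsOp_spec models_tabA h
  obtain ⟨L₂, h, hL₂⟩ := rowsOp_spec models_tabA h
  obtain ⟨L₃, h, hL₃⟩ := rowsOp_spec models_tabA h
  obtain ⟨D₀, h, hD₀⟩ := dualsFrom_spec h
  obtain ⟨D₂, h, hD₂⟩ := dualsFrom_spec h
  obtain ⟨D₄, h, hD₄⟩ := dualsFrom_spec h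
  obtain ⟨B₁, h, hB₁⟩ := rowsOp_spec models_tabA' h
  obtain ⟨B₂, h, hB₂⟩ := rowsOp_spec models_tabA' h
  have hD : ∀ W n m, n ∈ ({0, 2, 4} : Finset ℕ) → m ∈ ({0, 2, 4} : Finset ℕ) → P W n m →
      ∃ w ∈ select D₀ D₂ D₄ m, Entry (fun κ => dualOps (W κ)) w m n := by
    intro W n m hn hm hP
    have := hR W n m hn hP
    simp only [Finset.mem_insert, Finset.mem_singleton] at hm
    rcases hm with rfl | rfl | rfl
    · exact hD₀ W n hn this
    · exact hD₂ W n hn this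
    · exact hD₄ W n hn this
  have z : 0 ∈ ({0, 2, 4} : Finset ℕ) := by decide
  have step : ∀ {T : Tab} {R₀ R₂ R₄ : List (List (List ℕ))} {L L' : List (List ℕ)}
      {U W : Smoothing → List (Op × ℕ)} {n m : ℕ},
      (∀ s ∈ L, ∀ w ∈ select R₀ R₂ R₄ (nth 0 s 0), ∃ s' ∈ L', Step T w s s') →
      (∃ s ∈ L, State T U s n) → Covers R₀ R₂ R₄ W n m →
      ∃ s ∈ L', State T (fun κ => U κ ++ W κ) s m := by
    rintro T R₀ R₂ R₄ L L' U W n m hL ⟨s, hs, hU⟩ ⟨w, hw, hW⟩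
    obtain ⟨s', hs', hstep⟩ := hL s hs w (by rw [hU.strands]; exact hw)
    exact ⟨s', hs', hstep _ _ _ _ hU hW⟩
  obtain ⟨s, hs, hS⟩ := step hL₃ (step hL₂ (step hL₁ ⟨_, List.mem_singleton_self _,
    state_start _⟩ (hR _ _ _ z h₁)) (hR _ _ _ hn₁ h₂)) (hR _ _ _ hn₂ h₃)
  obtain ⟨u, hu, hU⟩ := step hB₂ (step hB₁ ⟨_, List.mem_singleton_self _,
    state_start _⟩ (hD _ _ _ hn₄ z h₅)) (hD _ _ _ hn₃ hn₄ h₄)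
  -- The lower word was built from the reflections of rows five and four; reflecting it again
  -- restores the rows in their order.
  have := (pairOp_iff models_tabA rfl hS hU).1 (all_eq_true (all_eq_true h s hs) u hu)
  simpa only [List.nil_append, dualOps_append, dualOps_dualOps] using this

end Sweep

/-! ### Rows of tiles -/

/-- The tiles fit together horizontally; `r` and `r'` tell whether there are connection points at
the ends. -/
def Linked : Bool → List Tile → Bool → Prop
  | r, [], r' => r = r'
  | r, t :: ts, r' => t.hasLeft = r ∧ Linked t.hasRight ts r'

def tops (ts : List Tile) : ℕ := (ts.map fun t => t.hasTop.toNat).sum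

def bottoms (ts : List Tile) : ℕ := (ts.map fun t => t.hasBottom.toNat).sum

/-- The word of a row, with `p` further strands on the left. -/
def rowWord : List Tile → ℕ → List Event
  | [], _ => []
  | t :: ts, p => t.word.map (Event.shift p) ++ rowWord ts (p + t.hasBottom.toNat)

theorem bottoms_cons (t : Tile) (ts : List Tile) :
    bottoms (t :: ts) = t.hasBottom.toNat + bottoms ts := by simp [bottoms]

theorem tops_cons (t : Tile) (ts : List Tile) : tops (t :: ts) = t.hasTop.toNat + tops ts := by
  simp [tops]

theorem pos_le_of_mem_rowWord {ts : List Tile} {p : ℕ} {e : Event} (h : e ∈ rowWord ts p) :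
    e.pos ≤ p + bottoms ts := by
  induction ts generalizing p with
  | nil => simp [rowWord] at h
  | cons t ts ih =>
    rw [bottoms_cons]
    rcases List.mem_append.1 h with h | h
    · obtain ⟨e', he', rfl⟩ := List.mem_map.1 h
      have : e'.pos = 0 := by cases t <;> simp [Tile.word] at he' <;>
        (try rcases he' with rfl | rfl) <;> rfl
      simp only [Event.shift, this]
      omega
    · have := ih h
      omega

theorem length_rowWord (ts : List Tile) (p : ℕ) : (rowWord ts p).length ≤ 2 * ts.length := by
  induction ts generalizing p with
  | nil => simp [rowWord]
  | cons t ts ih =>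
    have h := ih (p + t.hasBottom.toNat)
    have : t.word.length ≤ 2 := by cases t <;> simp [Tile.word]
    simp only [rowWord, List.length_append, List.length_map, List.length_cons]
    omega

/-- While a row is being read, the strands are, from left to right, the `p` that have already left
through bottom sides, the one on the open right side if there is one, and those still to enter
through top sides. -/
theorem leads_rowWord (κ : Smoothing) {r : Bool} {ts : List Tile} (h : Linked r ts false) (p : ℕ) :
    Leads ((rowWord ts p).flatMap κ.resolve) (p + r.toNat + tops ts) (p + bottoms ts) := by
  induction ts generalizing r p with
  | nil => cases h; rfl
  | cons t ts ih =>
    obtain ⟨rfl, h⟩ := h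
    rw [rowWord, List.flatMap_append, tops_cons, bottoms_cons]
    refine Leads.append ?_ (by rw [← Nat.add_assoc]; exact ih h _)
    have two : ∀ {u : ℕ} (o : Op), o.ins = 2 → o.outs = 2 → Leads [(o, p)] (p + 1 + (1 + u))
        (p + 1 + 1 + u) := fun {u} o h1 h2 => ⟨u, by rw [h1]; ring, by rw [h2]; change _ = _; ring⟩
    have glue : ∀ {u : ℕ}, Leads [(.join, p), (.birth, p)] (p + 1 + (1 + u)) (p + 1 + 1 + u) :=
      fun {u} => ⟨u, by change _ = p + 2 + u; ring, u, by change p + 0 + u = p + 0 + u; rfl, by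
        change p + 2 + u = _; ring⟩
    have id : ∀ {u : ℕ}, Leads [] (p + 1 + (1 + u)) (p + 1 + 1 + u) := fun {u} => by
      change _ = _; ring
    rcases t with _ | _ | _ | _ | _ | _ | _ | _ | _ | b | m
    case rightBottom =>
      exact ⟨tops ts, by change _ = p + 0 + tops ts; simp [Tile.hasLeft, Tile.hasTop], by
        change p + 2 + tops ts = p + 1 + 1 + tops ts; ring⟩
    case leftTop =>
      exact ⟨tops ts, by change p + 1 + (1 + tops ts) = p + 2 + tops ts; ring, by
        change p + 0 + tops ts = p + 0 + 0 + tops ts; ring⟩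
    case crossing => exact two _ rfl rfl
    case twoArcs₁ => exact glue
    case marked =>
      rcases κ with _ | _ | _
      · exact two _ rfl rfl
      all_goals
        rcases m with _ | _
        · first | exact glue | exact id
        · first | exact glue | exact id
    all_goals (change _ = _; simp [Tile.hasLeft, Tile.hasTop, Tile.hasBottom, Tile.hasRight])
    all_goals ring

/-- The number of connection points of a row is even. -/
theorem even_tops_add_bottoms {r : Bool} {ts : List Tile} (h : Linked r ts false) :
    Even (r.toNat + tops ts + bottoms ts) := by
  induction ts generalizing r with
  | nil => cases h; simp [tops, bottoms]
  | cons t ts ih =>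
    obtain ⟨rfl, h⟩ := h
    have := ih h
    rw [tops_cons, bottoms_cons]
    have ht : Even (t.hasLeft.toNat + t.hasTop.toNat + t.hasBottom.toNat + t.hasRight.toNat) := by
      rcases t with _ | _ | _ | _ | _ | _ | _ | _ | _ | b | b <;> first | decide | (cases b <;> decide)
    rw [Nat.even_iff] at *
    omega

/-! ### Codes of rows -/

namespace Sweep

/-- The letter of an event. -/
def eventLetter (e : Event) : ℕ :=
  (match e.piece with
  | .birth => 0
  | .join => 1
  | .vertex (.crossing true) => 2
  | .vertex (.crossing false) => 3
  | .vertex (.marked true) => 4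
  | .vertex (.marked false) => 5) + 8 * e.pos

def wordCode (v : List Event) (w : ℕ) : ℕ := v.foldl (fun w e => 64 * w + eventLetter e) w

theorem wordCode_append (u v : List Event) (w : ℕ) :
    wordCode (u ++ v) w = wordCode v (wordCode u w) := List.foldl_append

def rowCode (r : Bool) (u p w : ℕ) : ℕ := r.toNat + 2 * (u + 8 * (p + 8 * w))

theorem exists_tile (t : Tile) : ∃ c ∈ (bif t.hasLeft then tilesOn else tilesOff),
    nth 0 c 0 = t.hasRight.toNat ∧ nth 0 c 1 = t.hasTop.toNat ∧ nth 0 c 2 = t.hasBottom.toNat ∧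
    ∀ w p, Nat.add (Nat.mul w (nth 0 c 3)) (Nat.add (nth 0 c 4) (Nat.mul p (nth 0 c 5))) =
      wordCode (t.word.map (Event.shift p)) w := by
  have pick : ∀ (L : List (List ℕ)) (x y z a b c x' y' z' : ℕ) (f : ℕ → ℕ → ℕ),
      [x, y, z, a, b, c] ∈ L → x = x' → y = y' → z = z' → (∀ w p, w * a + (b + p * c) = f w p) →
      ∃ c ∈ L, nth 0 c 0 = x' ∧ nth 0 c 1 = y' ∧ nth 0 c 2 = z' ∧
        ∀ w p, Nat.add (Nat.mul w (nth 0 c 3)) (Nat.add (nth 0 c 4) (Nat.mul p (nth 0 c 5))) =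
          f w p := fun L x y z a b c x' y' z' f h h1 h2 h3 h4 => ⟨_, h, h1, h2, h3, h4⟩
  rcases t with _ | _ | _ | _ | _ | _ | _ | _ | _ | ⟨_ | _⟩ | ⟨_ | _⟩
  · refine pick _ 0 0 0 1 0 0 _ _ _ _ (by decide) rfl rfl rfl fun w p => ?_
    simp [wordCode, Tile.word]
  · refine pick _ 0 0 1 1 0 0 _ _ _ _ (by decide) rfl rfl rfl fun w p => ?_
    simp [wordCode, Tile.word]
  · refine pick _ 1 0 1 64 0 8 _ _ _ _ (by decide) rfl rfl rfl fun w p => ?_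
    simp [wordCode, Tile.word, eventLetter, Event.shift]; ring
  · refine pick _ 1 1 0 1 0 0 _ _ _ _ (by decide) rfl rfl rfl fun w p => ?_
    simp [wordCode, Tile.word]
  · refine pick _ 0 1 0 64 1 8 _ _ _ _ (by decide) rfl rfl rfl fun w p => ?_
    simp [wordCode, Tile.word, eventLetter, Event.shift]; ring
  · refine pick _ 1 0 0 1 0 0 _ _ _ _ (by decide) rfl rfl rfl fun w p => ?_
    simp [wordCode, Tile.word]
  · refine pick _ 0 1 1 1 0 0 _ _ _ _ (by decide) rfl rfl rfl fun w p => ?_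
    simp [wordCode, Tile.word]
  -- Two letters, a join and then a birth at `p`, are appended: `64 * (64 * w + (1 + 8 * p)) + 8 *
  -- p`.
  · refine pick _ 1 1 1 4096 64 520 _ _ _ _ (by decide) rfl rfl rfl fun w p => ?_
    simp [wordCode, Tile.word, eventLetter, Event.shift]; ring
  · refine pick _ 1 1 1 1 0 0 _ _ _ _ (by decide) rfl rfl rfl fun w p => ?_
    simp [wordCode, Tile.word]
  · refine pick _ 1 1 1 64 3 8 _ _ _ _ (by decide) rfl rfl rfl fun w p => ?_
    simp [wordCode, Tile.word, eventLetter, Event.shift]; ring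
  · refine pick _ 1 1 1 64 2 8 _ _ _ _ (by decide) rfl rfl rfl fun w p => ?_
    simp [wordCode, Tile.word, eventLetter, Event.shift]; ring
  · refine pick _ 1 1 1 64 5 8 _ _ _ _ (by decide) rfl rfl rfl fun w p => ?_
    simp [wordCode, Tile.word, eventLetter, Event.shift]; ring
  · refine pick _ 1 1 1 64 4 8 _ _ _ _ (by decide) rfl rfl rfl fun w p => ?_
    simp [wordCode, Tile.word, eventLetter, Event.shift]; ring

theorem tileOp_spec {s : List ℕ} {t : Tree} {k : Tree → Bool} (h : tileOp s t k = true) :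
    ∃ t' : Tree, (∀ y, t.Mem y → t'.Mem y) ∧ (∀ (T : Tile) (u p w : ℕ),
      nth 0 s 1 = rowCode T.hasLeft u p w → u + T.hasTop.toNat ≤ 4 → p + T.hasBottom.toNat ≤ 4 →
      ∃ s', t'.Mem s' ∧ nth 0 s' 1 = rowCode T.hasRight (u + T.hasTop.toNat)
        (p + T.hasBottom.toNat) (wordCode (T.word.map (Event.shift p)) w)) ∧ k t' = true := by
  simp only [tileOp, force_eq] at h
  generalize hx : nth 0 s 1 = x at h ⊢
  obtain ⟨t', h1, h2, h3⟩ := collect_spec (P := fun c t =>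
    Nat.ble (Nat.add (Nat.mod (Nat.div x 2) 8) (nth 0 c 1)) 4 = true →
    Nat.ble (Nat.add (Nat.mod (Nat.div x 16) 8) (nth 0 c 2)) 4 = true → ∃ s', t.Mem s' ∧
      nth 0 s' 1 = Nat.add (nth 0 c 0) (Nat.mul 2 (Nat.add (Nat.add (Nat.mod (Nat.div x 2) 8)
        (nth 0 c 1)) (Nat.mul 8 (Nat.add (Nat.add (Nat.mod (Nat.div x 16) 8) (nth 0 c 2))
        (Nat.mul 8 (Nat.add (Nat.mul (Nat.div x 128) (nth 0 c 3)) (Nat.add (nth 0 c 4)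
          (Nat.mul (Nat.mod (Nat.div x 16) 8) (nth 0 c 5))))))))))
    (fun c t t' htt h h1 h2 => by obtain ⟨s', h3, h4⟩ := h h1 h2; exact ⟨s', htt _ h3, h4⟩)
    (fun c _ t k h => by
      cases h1 : Nat.ble (Nat.add (Nat.mod (Nat.div x 2) 8) (nth 0 c 1)) 4
      · rw [h1] at h
        exact ⟨t, fun _ h => h, fun h => (Bool.false_ne_true h).elim, h⟩
      cases h2 : Nat.ble (Nat.add (Nat.mod (Nat.div x 16) 8) (nth 0 c 2)) 4
      · rw [h1, h2] at h
        exact ⟨t, fun _ h => h, fun _ h => (Bool.false_ne_true h).elim, h⟩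
      rw [h1, h2, cond_true, cond_true] at h
      obtain ⟨t', h3, h4, h5⟩ := Tree.ins_spec (α := Bool) _ t
      rw [h3] at h
      exact ⟨t', h5, fun _ _ => ⟨_, h4, rfl⟩, h⟩) h
  refine ⟨t', h1, fun T u p w hT hu hp => ?_, h3⟩
  obtain ⟨c, hc, c0, c1, c2, c3⟩ := exists_tile T
  have hr : T.hasLeft.toNat < 2 := Bool.toNat_lt _
  have e1 : Nat.mod (Nat.div x 2) 8 = u := by
    change x / 2 % 8 = u; rw [hT, rowCode]; omega
  have e2 : Nat.mod (Nat.div x 16) 8 = p := by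
    change x / 16 % 8 = p; rw [hT, rowCode]; omega
  have e3 : Nat.div x 128 = w := by
    change x / 128 = w; rw [hT, rowCode]; omega
  have e4 : Nat.beq (Nat.mod x 2) 0 = !T.hasLeft := by
    have : Nat.mod x 2 = T.hasLeft.toNat := by
      change x % 2 = _; rw [hT, rowCode]; omega
    rw [this]; cases T.hasLeft <;> rfl
  have := h2 c (by rw [e4]; cases h : T.hasLeft <;> simpa [h] using hc)
    (by rw [e1, c1, Nat.ble_eq]; exact hu) (by rw [e2, c2, Nat.ble_eq]; exact hp)
  rw [e1, e2, e3, c0, c1, c2, c3] at this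
  exact this

theorem tilesOp_spec {n : ℕ} {L : List (List ℕ)} {k : List (List ℕ) → Bool}
    (h : tilesOp n L k = true) : ∃ L', k L' = true ∧ ∀ s ∈ L, ∀ (ts : List Tile) (r r' : Bool)
      (u p w : ℕ), ts.length = n → Linked r ts r' → nth 0 s 1 = rowCode r u p w →
      u + tops ts ≤ 4 → p + bottoms ts ≤ 4 → ∃ s' ∈ L', nth 0 s' 1 =
        rowCode r' (u + tops ts) (p + bottoms ts) (wordCode (rowWord ts p) w) := by
  induction n generalizing L with
  | zero =>
    refine ⟨L, h, fun s hs ts r r' u p w hl hr hx _ _ => ⟨s, hs, ?_⟩⟩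
    rw [List.length_eq_zero_iff] at hl
    subst hl
    cases hr
    exact hx
  | succ n ih =>
    obtain ⟨t, -, h1, h2⟩ := collect_spec (f := tileOp) (P := fun s t => ∀ (T : Tile) (u p w : ℕ),
      nth 0 s 1 = rowCode T.hasLeft u p w → u + T.hasTop.toNat ≤ 4 → p + T.hasBottom.toNat ≤ 4 →
      ∃ s', t.Mem s' ∧ nth 0 s' 1 = rowCode T.hasRight (u + T.hasTop.toNat)
        (p + T.hasBottom.toNat) (wordCode (T.word.map (Event.shift p)) w))
      (fun s t t' htt h T u p w h1 h2 h3 => by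
        obtain ⟨s', h4, h5⟩ := h T u p w h1 h2 h3; exact ⟨s', htt _ h4, h5⟩)
      (fun s _ t k h => tileOp_spec h) h
    rw [forceLists_eq] at h2
    obtain ⟨L', h3, h4⟩ := ih h2
    refine ⟨L', h3, fun s hs ts r r' u p w hl hr hx hu hp => ?_⟩
    rcases ts with _ | ⟨T, ts⟩
    · cases hl
    obtain ⟨rfl, hr⟩ := hr
    rw [tops_cons] at hu ⊢
    rw [bottoms_cons] at hp ⊢
    obtain ⟨s', h5, h6⟩ := h1 s hs T u p w hx (by omega) (by omega)
    obtain ⟨s'', h7, h8⟩ := h4 s' (Tree.mem_toList_of_mem (.inl h5)) ts _ r' _ _ _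
      (Nat.succ.inj hl) hr h6 (by omega) (by omega)
    refine ⟨s'', h7, ?_⟩
    rw [h8, rowWord, wordCode_append, Nat.add_assoc, Nat.add_assoc]

end Sweep

namespace Sweep

theorem eventLetter_lt {e : Event} (h : e.pos ≤ 4) : eventLetter e < 64 := by
  obtain ⟨_ | _ | ⟨_ | _⟩ | ⟨_ | _⟩, i⟩ := e <;> simp only [eventLetter] at h ⊢ <;> omega

theorem one_le_wordCode (v : List Event) : 1 ≤ wordCode v 1 := by
  induction v using List.reverseRecOn with
  | nil => exact le_rfl
  | append_singleton v e ih =>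
    rw [wordCode_append]
    simp only [wordCode, List.foldl_cons, List.foldl_nil] at ih ⊢
    omega

theorem letters_spec {α : Type} (n : ℕ) {v : List Event} (hv : v.length ≤ n)
    (hp : ∀ e ∈ v, e.pos ≤ 4) (k : List ℕ → α) :
    letters n (wordCode v 1) k = k (v.map eventLetter).reverse := by
  induction n generalizing v k with
  | zero => rw [List.length_eq_zero_iff.1 (Nat.le_zero.1 hv)]; rfl
  | succ n ih =>
    rcases List.eq_nil_or_concat v with rfl | ⟨v, e, rfl⟩
    · rfl
    · have h1 := one_le_wordCode v
      have h2 := eventLetter_lt (hp e (by simp))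
      have h3 : wordCode (v ++ [e]) 1 = 64 * wordCode v 1 + eventLetter e := wordCode_append _ _ _
      have e1 : Nat.ble (wordCode (v ++ [e]) 1) 1 = false := by
        rw [Bool.eq_false_iff, Ne, Nat.ble_eq]; omega
      have e2 : Nat.mod (wordCode (v ++ [e]) 1) 64 = eventLetter e := by
        change wordCode (v ++ [e]) 1 % 64 = _; omega
      have e3 : Nat.div (wordCode (v ++ [e]) 1) 64 = wordCode v 1 := by
        change wordCode (v ++ [e]) 1 / 64 = _; omega
      have e4 : ∀ w (k : List ℕ → α), letters (n + 1) w k = bif Nat.ble w 1 then k [] else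
        force (Nat.mod w 64) fun x => force (Nat.div w 64) fun w =>
          letters n w fun l => k (x :: l) := fun w k => rfl
      rw [List.concat_eq_append, e4, e1, e2, e3, cond_false, force_eq, force_eq,
        ih (by simpa using hv) fun e he => hp e (by simp [he])]
      simp

/-- The list of states is not known to contain only codes of rows. For an arbitrary number it
suffices that the computation hands some list to its continuation. -/
theorem exists_letters {α : Type} (n w : ℕ) : ∃ l, ∀ k : List ℕ → α, letters n w k = k l := by
  induction n generalizing w with
  | zero => exact ⟨[], fun k => rfl⟩
  | succ n ih =>
    have e : ∀ k : List ℕ → α, letters (n + 1) w k = bif Nat.ble w 1 then k [] else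
      force (Nat.mod w 64) fun x => force (Nat.div w 64) fun w =>
        letters n w fun l => k (x :: l) := fun k => rfl
    simp only [e, force_eq]
    cases Nat.ble w 1
    · obtain ⟨l, hl⟩ := ih (Nat.div w 64)
      exact ⟨_, fun k => hl _⟩
    · exact ⟨[], fun k => rfl⟩

theorem exists_smooth {α : Type} (κ : ℕ) (w : List ℕ) :
    ∃ l, ∀ k : List ℕ → α, smooth κ w k = k l := by
  induction w with
  | nil => exact ⟨[], fun k => rfl⟩
  | cons x w ih =>
    obtain ⟨l, hl⟩ := ih
    have e : ∀ k : List ℕ → α, smooth κ (x :: w) k = smooth κ w fun l =>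
        force (Nat.mod x 8) fun t => force (Nat.sub x t) fun y =>
        bif Nat.ble 4 t then
          bif Nat.beq κ 0 then force (Nat.add y 4) fun x => k (x :: l) else
          bif Nat.beq (Nat.add t κ) 6 then force (Nat.succ y) fun z => k (y :: z :: l) else k l
        else force x fun x => k (x :: l) := fun k => rfl
    simp only [e, hl, force_eq]
    cases Nat.ble 4 (Nat.mod x 8)
    · exact ⟨_, fun k => rfl⟩
    cases Nat.beq κ 0
    · cases Nat.beq (Nat.add (Nat.mod x 8) κ) 6
      · exact ⟨_, fun k => rfl⟩
      · exact ⟨_, fun k => rfl⟩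
    · exact ⟨_, fun k => rfl⟩

theorem smooth_spec {α : Type} (κ : Smoothing) (v : List Event) (k : List ℕ → α) :
    smooth κ.idx (v.map eventLetter).reverse k = k (opLetters (v.flatMap κ.resolve)) := by
  induction v using List.reverseRecOn generalizing k with
  | nil => rfl
  | append_singleton v e ih =>
    have e1 : ∀ (x : ℕ) (w : List ℕ) (k : List ℕ → α), smooth κ.idx (x :: w) k =
      smooth κ.idx w fun l =>
        force (Nat.mod x 8) fun t => force (Nat.sub x t) fun y =>
        bif Nat.ble 4 t then
          bif Nat.beq κ.idx 0 then force (Nat.add y 4) fun x => k (x :: l) else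
          bif Nat.beq (Nat.add t κ.idx) 6 then force (Nat.succ y) fun z => k (y :: z :: l) else k l
        else force x fun x => k (x :: l) := fun x w k => rfl
    simp only [List.map_append, List.map_cons, List.map_nil, List.reverse_append,
      List.reverse_cons, List.reverse_nil, List.nil_append, List.singleton_append, e1, ih,
      List.flatMap_append, List.flatMap_cons, List.flatMap_nil, List.append_nil, force_eq]
    have e2 : ∀ u w, opLetters (u ++ w) = opLetters w ++ opLetters u := by
      intro u w; simp [opLetters]
    rw [e2]
    obtain ⟨p, i⟩ := e
    have m : ∀ t, t < 8 → Nat.mod (t + 8 * i) 8 = t := by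
      intro t ht; change (t + 8 * i) % 8 = t; omega
    have s : ∀ t, Nat.sub (t + 8 * i) t = 8 * i := by
      intro t; change t + 8 * i - t = _; omega
    rcases p with _ | _ | ⟨_ | _⟩ | ⟨_ | _⟩
    · simp only [eventLetter, m 0 (by norm_num)]; rfl
    · simp only [eventLetter, m 1 (by norm_num)]; rfl
    · simp only [eventLetter, m 3 (by norm_num)]; rfl
    · simp only [eventLetter, m 2 (by norm_num)]; rfl
    all_goals
      generalize opLetters (v.flatMap κ.resolve) = l
      have keep : k ((8 * i + 4) :: l) = k ((4 + 8 * i) :: l) := by rw [Nat.add_comm]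
      have cut : k (8 * i :: (8 * i + 1) :: l) = k ((0 + 8 * i) :: (1 + 8 * i) :: l) := by
        rw [Nat.zero_add, Nat.add_comm 1]
    · simp only [eventLetter, m 5 (by norm_num), s 5]
      rcases κ with _ | _ | _
      · exact keep
      · exact cut
      · rfl
    · simp only [eventLetter, m 4 (by norm_num), s 4]
      rcases κ with _ | _ | _
      · exact keep
      · rfl
      · exact cut

/-- The words of the rows of an `N`-mosaic with `n` strands above and `m` strands below. -/
def IsRow (N : ℕ) (W : Smoothing → List (Op × ℕ)) (n m : ℕ) : Prop :=
  ∃ ts : List Tile, ts.length = N ∧ Linked false ts false ∧ tops ts = n ∧ bottoms ts = m ∧ m ≤ 4 ∧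
    W = fun κ => (rowWord ts 0).flatMap κ.resolve

theorem wordsFrom_spec {N n : ℕ} (hN : N ≤ 8) (hn : n ≤ 4) {L : List (List ℕ)}
    {k : List (List (List ℕ)) → Bool} (h : wordsFrom n L k = true)
    (hL : ∀ ts : List Tile, ts.length = N → Linked false ts false → tops ts ≤ 4 → bottoms ts ≤ 4 →
      ∃ s ∈ L, nth 0 s 1 = rowCode false (tops ts) (bottoms ts) (wordCode (rowWord ts 0) 1)) :
    ∃ R, k R = true ∧ ∀ W m, IsRow N W n m → ∃ w ∈ R, Entry W w n m := by
  obtain ⟨R, -, h1, h2⟩ := gather_mem (P := fun s R => ∀ ts : List Tile, ts.length = N →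
      Linked false ts false → tops ts = n → bottoms ts ≤ 4 →
      nth 0 s 1 = rowCode false (tops ts) (bottoms ts) (wordCode (rowWord ts 0) 1) →
      ∃ w ∈ R, Entry (fun κ => (rowWord ts 0).flatMap κ.resolve) w n (bottoms ts))
    (fun s t t' htt h ts h1 h2 h3 h4 h5 => by
      obtain ⟨w, hw, hE⟩ := h ts h1 h2 h3 h4 h5; exact ⟨w, htt hw, hE⟩)
    (fun s _ t k h => by
      simp only [force_eq] at h
      generalize hx : nth 0 s 1 = x at h ⊢
      cases h0 : Nat.beq (Nat.mod x 16) (Nat.mul 2 n)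
      · rw [h0] at h
        refine ⟨t, fun _ h => h, fun ts _ _ h3 h4 h5 => ?_, h⟩
        refine absurd ?_ (Nat.ne_of_beq_eq_false h0)
        change x % 16 = 2 * n
        rw [h5, rowCode, Bool.toNat_false]; omega
      · rw [h0, cond_true] at h
        obtain ⟨w, hw⟩ := exists_letters (α := Bool) 16 (Nat.div x 128)
        obtain ⟨w₀, hw₀⟩ := exists_smooth (α := Bool) 0 w
        obtain ⟨w₁, hw₁⟩ := exists_smooth (α := Bool) 1 w
        obtain ⟨w₂, hw₂⟩ := exists_smooth (α := Bool) 2 w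
        rw [hw, smooths, hw₀, hw₁, hw₂] at h
        refine ⟨_, List.subset_cons_self _ _, fun ts h3 h4 h5 h6 h7 => ⟨_, List.mem_cons_self, ?_⟩, h⟩
        have e1 : Nat.mod (Nat.div x 16) 8 = bottoms ts := by
          change x / 16 % 8 = _; rw [h7, rowCode, Bool.toNat_false]; omega
        have e2 : Nat.div x 128 = wordCode (rowWord ts 0) 1 := by
          change x / 128 = _; rw [h7, rowCode, Bool.toNat_false]; omega
        -- Two descriptions of the list handed to the continuation are compared by taking equality
        -- with `w` as the continuation. Sixteen letters suffice, as a row has at most eight tiles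
        -- with at most two pieces each.
        have e3 : w = ((rowWord ts 0).map eventLetter).reverse := by
          by_contra hne
          have h8 := hw fun l => decide (l = w)
          rw [e2, letters_spec 16 ((length_rowWord ts 0).trans (by omega)) fun e he =>
            (pos_le_of_mem_rowWord he).trans (by omega)] at h8
          simp [Ne.symm hne] at h8
        have e4 : ∀ (κ : Smoothing) (w' : List ℕ), (∀ k : List ℕ → Bool, smooth κ.idx w k = k w') →
            w' = opLetters ((rowWord ts 0).flatMap κ.resolve) := by
          intro κ w' h8
          by_contra hne
          have h9 := h8 fun l => decide (l = w')
          rw [e3, smooth_spec] at h9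
          simp [Ne.symm hne] at h9
        refine ⟨e1, h6, fun κ => ?_, fun κ => ?_⟩
        · have := leads_rowWord κ h4 0
          simpa [h5] using this
        · cases κ
          · exact e4 .singular w₀ hw₀
          · exact e4 .positive w₁ hw₁
          · exact e4 .negative w₂ hw₂) h
  refine ⟨R, h2, ?_⟩
  rintro W m ⟨ts, hl, hlk, rfl, rfl, hm, rfl⟩
  obtain ⟨s, hs, hx⟩ := hL ts hl hlk hn hm
  exact h1 s hs ts hl hlk rfl hm hx

theorem rowWords_spec {N : ℕ} (hN : N ≤ 8) {k : List (List (List ℕ)) → List (List (List ℕ)) →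
    List (List (List ℕ)) → Bool} (h : rowWords N k = true) :
    ∃ R₀ R₂ R₄, k R₀ R₂ R₄ = true ∧ ∀ W n m, n ∈ ({0, 2, 4} : Finset ℕ) → IsRow N W n m →
      Covers R₀ R₂ R₄ W n m := by
  obtain ⟨L, h, hL⟩ := tilesOp_spec h
  have hL' : ∀ ts : List Tile, ts.length = N → Linked false ts false → tops ts ≤ 4 →
      bottoms ts ≤ 4 →
      ∃ s ∈ L, nth 0 s 1 = rowCode false (tops ts) (bottoms ts) (wordCode (rowWord ts 0) 1) := by
    intro ts h1 h2 h3 h4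
    simpa using hL _ (List.mem_singleton_self _) ts false false 0 0 1 h1 h2 rfl (by omega) (by omega)
  obtain ⟨R₀, h, h0⟩ := wordsFrom_spec hN (by norm_num) h hL'
  obtain ⟨R₂, h, h2⟩ := wordsFrom_spec hN (by norm_num) h hL'
  obtain ⟨R₄, h, h4⟩ := wordsFrom_spec hN (by norm_num) h hL'
  refine ⟨R₀, R₂, R₄, h, fun W n m hn hW => ?_⟩
  simp only [Finset.mem_insert, Finset.mem_singleton] at hn
  rcases hn with rfl | rfl | rfl
  · exact h0 W m hW
  · exact h2 W m hW
  · exact h4 W m hW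

/-! ### Stacks of five rows -/

/-- Consecutive rows fit together. -/
def Stacked : ℕ → List (List Tile) → ℕ → Prop
  | n, [], m => n = m
  | n, ts :: L, m => tops ts = n ∧ Linked false ts false ∧ Stacked (bottoms ts) L m

def rowsWord (L : List (List Tile)) : List Event := L.flatMap fun ts => rowWord ts 0

theorem bottoms_le (ts : List Tile) : bottoms ts ≤ ts.length := by
  induction ts with
  | nil => simp [bottoms]
  | cons t ts ih => rw [bottoms_cons, List.length_cons]; have := Bool.toNat_le t.hasBottom; omega

/-- Every diagram on a `5`-mosaic is as simple as its resolutions. -/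
theorem forcedWord_of_stacked {L : List (List Tile)} (hL : L.length = 5)
    (h5 : ∀ ts ∈ L, ts.length = 5) (h : Stacked 0 L 0) :
    ForcedWord fun κ => (rowsWord L).flatMap κ.resolve := by
  obtain ⟨r₁, r₂, r₃, r₄, r₅, rfl⟩ : ∃ a b c d e, L = [a, b, c, d, e] := by
    rcases L with _ | ⟨a, _ | ⟨b, _ | ⟨c, _ | ⟨d, _ | ⟨e, _ | ⟨f, L⟩⟩⟩⟩⟩⟩ <;> simp at hL
    exact ⟨a, b, c, d, e, rfl⟩
  obtain ⟨t₁, l₁, t₂, l₂, t₃, l₃, t₄, l₄, t₅, l₅, b₅⟩ := h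
  -- Five columns leave room for five strands between rows, but parity leaves 0, 2 or 4, the numbers
  -- that the search covers.
  have le : ∀ ts : List Tile, Linked false ts false → Even (tops ts) → ts.length = 5 →
      Even (bottoms ts) ∧ bottoms ts ≤ 4 := by
    intro ts h1 h2 h3
    have h4 := even_tops_add_bottoms h1
    have h5 := bottoms_le ts
    rw [Nat.even_iff] at *
    simp only [Bool.toNat_false] at h4
    omega
  have mem : ∀ n, Even n → n ≤ 4 → n ∈ ({0, 2, 4} : Finset ℕ) := by
    intro n h1 h2
    rw [Nat.even_iff] at h1
    interval_cases n <;> simp_all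
  simp only [List.mem_cons, List.not_mem_nil, or_false, forall_eq_or_imp, forall_eq] at h5
  obtain ⟨e₁, c₁⟩ := le _ l₁ (t₁ ▸ Even.zero) h5.1
  obtain ⟨e₂, c₂⟩ := le _ l₂ (t₂ ▸ e₁) h5.2.1
  obtain ⟨e₃, c₃⟩ := le _ l₃ (t₃ ▸ e₂) h5.2.2.1
  obtain ⟨e₄, c₄⟩ := le _ l₄ (t₄ ▸ e₃) h5.2.2.2.1
  have := forcedWord_of_check (R := rowWords 5) (P := IsRow 5)
    (fun k hk => rowWords_spec (by norm_num) hk) check_eq_true (mem _ e₁ c₁) (mem _ e₂ c₂)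
    (mem _ e₃ c₃) (mem _ e₄ c₄) ⟨r₁, h5.1, l₁, t₁, rfl, c₁, rfl⟩
    ⟨r₂, h5.2.1, l₂, t₂, rfl, c₂, rfl⟩ ⟨r₃, h5.2.2.1, l₃, t₃, rfl, c₃, rfl⟩
    ⟨r₄, h5.2.2.2.1, l₄, t₄, rfl, c₄, rfl⟩ ⟨r₅, h5.2.2.2.2, l₅, t₅, b₅, by norm_num, rfl⟩
  simpa only [rowsWord, List.flatMap_cons, List.flatMap_nil, List.append_nil, List.flatMap_append,
    List.append_assoc] using this

end Sweep

/-! ### From mosaics to stacks of rows -/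

namespace Sweep

theorem rowWord_ofFn {n : ℕ} (f : Fin n → Tile) (p : ℕ) : rowWord (List.ofFn f) p =
    (List.finRange n).flatMap fun c => (f c).word.map (Event.shift (p +
      (Finset.univ.filter fun c' : Fin n => c' < c ∧ (f c').hasBottom = true).card)) := by
  induction n generalizing p with
  | zero => rfl
  | succ n ih =>
    rw [List.ofFn_succ, rowWord, ih, List.finRange_succ, List.flatMap_cons, List.flatMap_map]
    congr 1
    · simp
    · refine List.flatMap_congr fun c _ => ?_
      congr 2
      simp only [Finset.card_filter, Fin.sum_univ_succ, Fin.succ_lt_succ_iff, Fin.succ_pos,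
        true_and]
      cases (f 0).hasBottom <;> simp [Nat.add_assoc]

theorem linked_ofFn {n : ℕ} (f : Fin n → Tile) (r : Bool) (h0 : n = 0 → r = false)
    (h1 : ∀ h : 0 < n, (f ⟨0, h⟩).hasLeft = r)
    (h2 : ∀ i (h : i + 1 < n), (f ⟨i + 1, h⟩).hasLeft = (f ⟨i, by omega⟩).hasRight)
    (h3 : ∀ i (h : i < n), i + 1 = n → (f ⟨i, h⟩).hasRight = false) :
    Linked r (List.ofFn f) false := by
  induction n generalizing r with
  | zero => exact h0 rfl
  | succ n ih =>
    rw [List.ofFn_succ]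
    refine ⟨h1 (by omega), ih (fun i => f i.succ) _ (fun h => ?_) (fun h => ?_) (fun i h => ?_)
      fun i h e => ?_⟩
    · subst h; exact h3 0 (by omega) rfl
    · exact h2 0 (by omega)
    · exact h2 (i + 1) (by omega)
    · exact h3 (i + 1) (by omega) (by omega)

theorem stacked_ofFn {n : ℕ} (R : Fin n → List Tile) (m : ℕ) (h0 : n = 0 → m = 0)
    (hl : ∀ i, Linked false (R i) false) (h1 : ∀ h : 0 < n, tops (R ⟨0, h⟩) = m)
    (h2 : ∀ i (h : i + 1 < n), tops (R ⟨i + 1, h⟩) = bottoms (R ⟨i, by omega⟩))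
    (h3 : ∀ i (h : i < n), i + 1 = n → bottoms (R ⟨i, h⟩) = 0) :
    Stacked m (List.ofFn R) 0 := by
  induction n generalizing m with
  | zero => exact h0 rfl
  | succ n ih =>
    rw [List.ofFn_succ]
    refine ⟨h1 (by omega), hl 0, ih (fun i => R i.succ) _ (fun h => ?_) (fun i => hl _)
      (fun h => ?_) (fun i h => ?_) fun i h e => ?_⟩
    · subst h; exact h3 0 (by omega) rfl
    · exact h2 0 (by omega)
    · exact h2 (i + 1) (by omega)
    · exact h3 (i + 1) (by omega) (by omega)

theorem tops_ofFn {n : ℕ} (f : Fin n → Tile) : tops (List.ofFn f) = ∑ i, (f i).hasTop.toNat := by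
  rw [tops, List.map_ofFn, List.sum_ofFn]; rfl

theorem bottoms_ofFn {n : ℕ} (f : Fin n → Tile) :
    bottoms (List.ofFn f) = ∑ i, (f i).hasBottom.toNat := by
  rw [bottoms, List.map_ofFn, List.sum_ofFn]; rfl

theorem exists_stacked {n : ℕ} {M : Mosaic n} (hM : M.SuitablyConnected) :
    ∃ L : List (List Tile), L.length = n ∧ (∀ ts ∈ L, ts.length = n) ∧ Stacked 0 L 0 ∧
      M.word = rowsWord L := by
  refine ⟨List.ofFn fun r => List.ofFn (M r), by simp, ?_, ?_, ?_⟩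
  · intro ts hts
    rw [List.mem_ofFn] at hts
    obtain ⟨r, rfl⟩ := hts
    simp
  · have bool : ∀ {a b : Bool}, (a = true → b = true) → (b = true → a = true) → a = b := by decide
    refine stacked_ofFn _ 0 (fun _ => rfl) (fun r => ?_) (fun h => ?_) (fun i h => ?_) fun i h e => ?_
    · refine linked_ofFn _ false (fun _ => rfl) (fun h => ?_) (fun i h => ?_) fun i h e => ?_
      · by_contra hc
        obtain ⟨c', h1, -⟩ := (hM r ⟨0, h⟩).1 (by simpa using hc)
        simp at h1
      · refine bool (fun h' => ?_) fun h' => ?_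
        · obtain ⟨c', h1, h2⟩ := (hM r ⟨i + 1, h⟩).1 h'
          rwa [show c' = ⟨i, by omega⟩ from Fin.ext (by simpa using h1)] at h2
        · obtain ⟨c', h1, h2⟩ := (hM r ⟨i, by omega⟩).2.1 h'
          rwa [show c' = ⟨i + 1, h⟩ from Fin.ext h1] at h2
      · by_contra hc
        obtain ⟨c', h1, -⟩ := (hM r ⟨i, h⟩).2.1 (by simpa using hc)
        have := c'.2
        simp only at h1
        omega
    · rw [tops_ofFn]
      refine Finset.sum_eq_zero fun c _ => ?_
      rw [Bool.toNat_eq_zero]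
      by_contra hc
      obtain ⟨c', h1, -⟩ := (hM ⟨0, h⟩ c).2.2.1 (by simpa using hc)
      simp at h1
    · rw [tops_ofFn, bottoms_ofFn]
      refine Finset.sum_congr rfl fun c _ => congrArg _ (bool (fun h' => ?_) fun h' => ?_)
      · obtain ⟨c', h1, h2⟩ := (hM ⟨i + 1, h⟩ c).2.2.1 h'
        rwa [show c' = ⟨i, by omega⟩ from Fin.ext (by simpa using h1)] at h2
      · obtain ⟨c', h1, h2⟩ := (hM ⟨i, by omega⟩ c).2.2.2 h'
        rwa [show c' = ⟨i + 1, h⟩ from Fin.ext h1] at h2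
    · rw [bottoms_ofFn]
      refine Finset.sum_eq_zero fun c _ => ?_
      rw [Bool.toNat_eq_zero]
      by_contra hc
      obtain ⟨c', h1, -⟩ := (hM ⟨i, h⟩ c).2.2.2 (by simpa using hc)
      have := c'.2
      simp only at h1
      omega
  · rw [Mosaic.word, rowsWord, List.ofFn_eq_map, List.flatMap_map]
    refine List.flatMap_congr fun r _ => ?_
    rw [rowWord_ofFn]
    refine List.flatMap_congr fun c _ => ?_
    rw [Nat.zero_add]
    rfl

theorem replicate_empty (k : ℕ) : tops (List.replicate k .empty) = 0 ∧
    bottoms (List.replicate k .empty) = 0 ∧ Linked false (List.replicate k .empty) false ∧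
    ∀ p, rowWord (List.replicate k .empty) p = [] := by
  induction k with
  | zero => exact ⟨rfl, rfl, rfl, fun p => rfl⟩
  | succ k ih =>
    obtain ⟨h1, h2, h3, h4⟩ := ih
    rw [List.replicate_succ, tops_cons, bottoms_cons, h1, h2]
    exact ⟨rfl, rfl, ⟨rfl, h3⟩, fun p => by rw [rowWord, h4]; rfl⟩

theorem append_empty (k : ℕ) (ts : List Tile) :
    tops (ts ++ List.replicate k .empty) = tops ts ∧
    bottoms (ts ++ List.replicate k .empty) = bottoms ts ∧
    (∀ r, Linked r ts false → Linked r (ts ++ List.replicate k .empty) false) ∧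
    ∀ p, rowWord (ts ++ List.replicate k .empty) p = rowWord ts p := by
  obtain ⟨h1, h2, h3, h4⟩ := replicate_empty k
  induction ts with
  | nil => exact ⟨h1, h2, fun r hr => by cases hr; exact h3, h4⟩
  | cons t ts ih =>
    obtain ⟨i1, i2, i3, i4⟩ := ih
    rw [List.cons_append, tops_cons, bottoms_cons, tops_cons, bottoms_cons, i1, i2]
    exact ⟨rfl, rfl, fun r hr => ⟨hr.1, i3 _ hr.2⟩, fun p => by rw [rowWord, rowWord, i4]⟩

/-- Empty tiles on the right and empty rows below contribute no pieces, so one search for the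
largest size covers the smaller ones. -/
theorem pad_stacked {L : List (List Tile)} {n k : ℕ} (hL : ∀ ts ∈ L, ts.length = n)
    (i : ℕ) (h : Stacked i L 0) : ∃ L' : List (List Tile), L'.length = L.length + k ∧
      (∀ ts ∈ L', ts.length = n + k) ∧ Stacked i L' 0 ∧ rowsWord L' = rowsWord L := by
  induction L generalizing i with
  | nil =>
    cases h
    obtain ⟨h1, h2, h3, h4⟩ := replicate_empty (n + k)
    refine ⟨List.replicate k (List.replicate (n + k) .empty), by simp, ?_, ?_, ?_⟩
    · intro ts hts; rw [List.eq_of_mem_replicate hts, List.length_replicate]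
    · generalize n + k = l at *
      induction k with
      | zero => rfl
      | succ k ih => rw [List.replicate_succ]; exact ⟨h1, h3, by rw [h2]; exact ih⟩
    · generalize n + k = l at *
      induction k with
      | zero => rfl
      | succ k ih => rw [List.replicate_succ]; simp [rowsWord, h4]
  | cons ts L ih =>
    obtain ⟨t1, t2, t3⟩ := h
    obtain ⟨L', h1, h2, h3, h4⟩ := ih (fun ts hts => hL ts (by simp [hts])) _ t3
    obtain ⟨a1, a2, a3, a4⟩ := append_empty k ts
    refine ⟨(ts ++ List.replicate k .empty) :: L', ?_, ?_, ?_, ?_⟩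
    · simp only [List.length_cons, h1]; omega
    · intro r hr
      rcases List.mem_cons.1 hr with rfl | hr
      · simp [hL ts (by simp)]
      · exact h2 r hr
    · exact ⟨a1.trans t1, a3 _ t2, by rw [a2]; exact h3⟩
    · simp only [rowsWord, List.flatMap_cons, a4] at h4 ⊢; rw [h4]

theorem exists_stacked_of_le {n N : ℕ} (hn : n ≤ N) {M : Mosaic n} (hM : M.SuitablyConnected) :
    ∃ L : List (List Tile), L.length = N ∧ (∀ ts ∈ L, ts.length = N) ∧ Stacked 0 L 0 ∧
      M.word = rowsWord L := by
  obtain ⟨L, h1, h2, h3, h4⟩ := exists_stacked hM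
  obtain ⟨L', h5, h6, h7, h8⟩ := pad_stacked (k := N - n) h2 0 h3
  rw [h1, Nat.add_sub_cancel' hn] at h5
  rw [Nat.add_sub_cancel' hn] at h6
  exact ⟨L', h5, h6, h7, by rw [h8, h4]⟩

/-- The exponents in `SameCounts` are the same for all quandles; the test needs this for the
dihedral and the trivial one. -/
theorem ForcedWord.of_sameCounts {v w : List Event} (h : SameCounts v w)
    (hv : ForcedWord fun κ => v.flatMap κ.resolve) : ForcedWord fun κ => w.flatMap κ.resolve := by
  obtain ⟨a, b, ha, hb, -, h⟩ := h
  exact Forced.congr (fun κ => ⟨a κ, b κ, h 8 quandleA κ⟩)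
    (fun κ => ⟨a κ, b κ, h 3 quandleR κ, h 3 quandleT κ⟩) hv

/-- A diagram that is more complicated than its resolutions does not fit on a `5`-mosaic. -/
theorem six_le_of_represents {D : Diagram} (hD : ¬ForcedWord fun κ => D.word.flatMap κ.resolve)
    {n : ℕ} {M : Mosaic n} (h : M.Represents D.toLink) : 6 ≤ n := by
  by_contra hn
  obtain ⟨hM, E, hE, hED⟩ := h
  obtain ⟨L, h1, h2, h3, h4⟩ := exists_stacked_of_le (N := 5) (by omega) hM
  have := forcedWord_of_stacked h1 h2 h3
  rw [← h4, ← hE] at this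
  exact hD (this.of_sameCounts (sameCounts_of_toLink_eq hED))

/-! ### The diagrams of the table -/

/-- The description of a word with `m` strands below it. -/
def entry (m : ℕ) (v : List Event) : List (List ℕ) :=
  [[m], opLetters (v.flatMap Smoothing.singular.resolve),
    opLetters (v.flatMap Smoothing.positive.resolve),
    opLetters (v.flatMap Smoothing.negative.resolve)]

theorem leads_of_run (κ : Smoothing) {v : List Event} {n m : ℕ} (h : run v n = some m) :
    Leads (v.flatMap κ.resolve) n m := by
  induction v generalizing n with
  | nil => exact Option.some.inj h
  | cons e v ih =>
    simp only [run] at h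
    split at h
    · rename_i hle
      rw [List.flatMap_cons]
      refine Leads.append ?_ (ih h)
      obtain ⟨k, hk⟩ := Nat.exists_eq_add_of_le hle
      subst hk
      have e1 : e.pos + e.piece.ins + k - e.piece.ins + e.piece.outs = e.pos + e.piece.outs + k := by
        omega
      rw [e1]
      obtain ⟨_ | _ | _ | m, i⟩ := e
      · exact ⟨k, rfl, rfl⟩
      · exact ⟨k, rfl, rfl⟩
      · exact ⟨k, rfl, rfl⟩
      · rcases κ with _ | _ | _
        · exact ⟨k, rfl, rfl⟩
        all_goals rcases m with _ | _ <;> first | exact ⟨k, rfl, k, rfl, rfl⟩ | exact rfl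
    · cases h

theorem entry_spec {v : List Event} {n m : ℕ} (h : run v n = some m) (hm : m ≤ 4) :
    Entry (fun κ => v.flatMap κ.resolve) (entry m v) n m :=
  ⟨rfl, hm, fun κ => leads_of_run κ h, fun κ => by cases κ <;> rfl⟩

/-- Whether the diagram of a word is seen to be more complicated than its resolutions. -/
def isComplicated (v : List Event) : Bool :=
  forceList start fun i => stateOp tabA (entry 2 (v.take 1)) i fun s =>
    stateOp tabA (entry 0 (v.drop 1)) s fun s => !pairOp s start

/-- The cut after the first birth is for efficiency: its eight labellings by 3-cycles are equivalent
under automorphisms, so after thinning the rest of the word starts from a single one. -/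
theorem not_forcedWord {v : List Event} (h1 : run (v.take 1) 0 = some 2)
    (h2 : run (v.drop 1) 2 = some 0) (h : isComplicated v = true) :
    ¬ForcedWord fun κ => v.flatMap κ.resolve := by
  rw [isComplicated, forceList_eq] at h
  obtain ⟨s, h, hs⟩ := stateOp_spec models_tabA h
  obtain ⟨u, h, hu⟩ := stateOp_spec models_tabA h
  have := hu _ _ _ _ (hs _ _ _ _ (state_start _) (entry_spec h1 (by norm_num)))
    (entry_spec h2 (by norm_num))
  have key := pairOp_iff models_tabA (T' := tabA') rfl this (state_start _)
  simp only [List.nil_append, ← List.flatMap_append, List.take_append_drop, dualOps, List.map_nil,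
    List.reverse_nil, List.append_nil] at key
  rw [← key]
  simpa using h

end Sweep

open Sweep
-- Neither quandle alone would do. The spun figure-eight knot has only constant labellings by
-- transpositions, as the knot has determinant 5. A non-orientable component admits no labelling by
-- 3-cycles at all, since in the alternating group of degree 4 a 3-cycle is not conjugate to its
-- inverse.
set_option maxRecDepth 100000 in
theorem isComplicated_word (K : Yoshikawa) : K ∈ ([.k0_1, .k2_1_p1, .k2_1_m1] : List Yoshikawa) ∨
    isComplicated K.word = true := by
  cases K
  case k0_1 => exact .inl (by decide)
  case k2_1_p1 => exact .inl (by decide)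
  case k2_1_m1 => exact .inl (by decide)
  all_goals exact .inr (by decide +kernel)

namespace Sweep

/-! ### The sphere test and very small mosaics -/

/-- The number of labellings by three labels without any relation. -/
def colorings (w : List Event) (κ : Smoothing) : ℕ :=
  len (wordOp tabT (opLetters (w.flatMap κ.resolve)) [1]) 0

theorem count_quandleT {w : List Event} (h : run w 0 = some 0) (κ : Smoothing) :
    quandleT.count κ w = colorings w κ := by
  obtain ⟨S, h1, h2, h3⟩ := wordOp_spec models_tabT (leads_of_run κ h) (S := {[]})
    (by simp) (V := [1]) rfl
  have h4 := h3 fun t => if t = [] then 1 else 0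
  rw [Multiset.map_singleton, Multiset.sum_singleton] at h4
  rw [colorings, len_eq, zero_add, ← Multiset.coe_card, h1, Multiset.card_map,
    SymQuandle.count, SymQuandle.total, h4,
    Multiset.map_congr rfl fun s hs => if_pos (List.length_eq_zero_iff.1 (h2 s hs))]
  simp

/-- All rows of `n` tiles. -/
def tileRows : ℕ → Bool → List (List Tile)
  | 0, r => if r = false then [[]] else []
  | n + 1, r => ([.empty, .leftBottom, .rightBottom, .rightTop, .leftTop, .horizontal, .vertical,
      .twoArcs₁, .twoArcs₂, .crossing true, .crossing false, .marked true, .marked false].filter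
      fun t : Tile => t.hasLeft = r).flatMap fun t => (tileRows n t.hasRight).map (t :: ·)

theorem mem_tileRows {n : ℕ} {r : Bool} {ts : List Tile} (h : Linked r ts false)
    (hn : ts.length = n) : ts ∈ tileRows n r := by
  induction n generalizing r ts with
  | zero => rw [List.length_eq_zero_iff] at hn; subst hn; cases h; simp [tileRows]
  | succ n ih =>
    rcases ts with _ | ⟨t, ts⟩
    · cases hn
    obtain ⟨rfl, h⟩ := h
    refine List.mem_flatMap.2 ⟨t, List.mem_filter.2 ⟨?_, by simp⟩,
      List.mem_map.2 ⟨ts, ih h (Nat.succ.inj hn), rfl⟩⟩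
    rcases t with _ | _ | _ | _ | _ | _ | _ | _ | _ | ⟨_ | _⟩ | ⟨_ | _⟩ <;> simp

/-- The words of the rows of three tiles with `n` strands above and `m` strands below. -/
def shortWords (n m : ℕ) : List (List Event) :=
  (((tileRows 3 false).filter fun ts => tops ts = n ∧ bottoms ts = m).map fun ts =>
    rowWord ts 0).dedup

/-- The word has other than three labellings or describes a sphere. -/
def isSpherical (w : List Event) : Bool :=
  !(colorings w .singular == 3) ||
    colorings w .positive * colorings w .negative == 9 * 3 ^ marks w

/-- By parity at most two strands run between the rows of a 3-mosaic, so few words remain.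
Labellings by the trivial quandle count components: three labellings mean a connected surface, and
the components of both resolutions minus the marked vertices give its Euler characteristic, which is
2 for a sphere. -/
theorem isSpherical_of_short : ∀ n ∈ [0, 2], ∀ m ∈ [0, 2], ∀ u ∈ shortWords 0 n,
    ∀ v ∈ shortWords n m, ∀ w ∈ shortWords m 0, isSpherical (u ++ (v ++ w)) = true := by
  decide +kernel

theorem isSpherical_of_stacked {L : List (List Tile)} (hL : L.length = 3)
    (h3 : ∀ ts ∈ L, ts.length = 3) (h : Stacked 0 L 0) : isSpherical (rowsWord L) = true := by
  obtain ⟨r₁, r₂, r₃, rfl⟩ : ∃ a b c, L = [a, b, c] := by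
    rcases L with _ | ⟨a, _ | ⟨b, _ | ⟨c, _ | ⟨d, L⟩⟩⟩⟩ <;> simp at hL
    exact ⟨a, b, c, rfl⟩
  obtain ⟨t₁, l₁, t₂, l₂, t₃, l₃, b₃⟩ := h
  have le : ∀ ts : List Tile, Linked false ts false → tops ts ∈ [0, 2] → ts.length = 3 →
      bottoms ts ∈ [0, 2] := by
    intro ts h1 h2 h3
    have h4 := even_tops_add_bottoms h1
    have h5 := bottoms_le ts
    rw [Nat.even_iff] at h4
    simp only [Bool.toNat_false, List.mem_cons, List.not_mem_nil, or_false] at *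
    omega
  simp only [List.mem_cons, List.not_mem_nil, or_false, forall_eq_or_imp, forall_eq] at h3
  have e₁ := le _ l₁ (t₁ ▸ by simp) h3.1
  have e₂ := le _ l₂ (t₂ ▸ e₁) h3.2.1
  have mem : ∀ {ts : List Tile} {n m : ℕ}, Linked false ts false → ts.length = 3 → tops ts = n →
      bottoms ts = m → rowWord ts 0 ∈ shortWords n m := fun {ts n m} h1 h2 h3 h4 =>
    List.mem_dedup.2 (List.mem_map.2 ⟨ts, List.mem_filter.2 ⟨mem_tileRows h1 h2, by
      simp [h3, h4]⟩, rfl⟩)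
  have := isSpherical_of_short _ e₁ _ e₂ _ (mem l₁ h3.1 t₁ rfl) _ (mem l₂ h3.2.1 t₂ rfl) _
    (mem l₃ h3.2.2 t₃ b₃)
  simpa [rowsWord] using this

/-- The relation between the exponents and the numbers of marked vertices in `SameCounts` is the
invariance of the Euler characteristic. -/
theorem isSpherical_congr {D E : Diagram} (h : SameCounts D.word E.word)
    (hD : isSpherical D.word = true) : isSpherical E.word = true := by
  obtain ⟨a, b, ha, hb, hm, h⟩ := h
  have h' := fun κ => h 3 quandleT κ
  simp only [count_quandleT D.closed, count_quandleT E.closed] at h'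
  have h0 := h' .singular
  rw [ha, hb, pow_zero, one_mul, one_mul] at h0
  simp only [isSpherical, Bool.or_eq_true, Bool.not_eq_true', beq_eq_false_iff_ne, beq_iff_eq,
    ← h0] at hD ⊢
  refine hD.imp_right fun hD => ?_
  have h1 := h' .positive
  have h2 := h' .negative
  have hp : 0 < 3 ^ (b .positive + b .negative) := by positivity
  refine Nat.eq_of_mul_eq_mul_left hp ?_
  calc
    _ = (3 ^ b .positive * colorings E.word .positive) *
        (3 ^ b .negative * colorings E.word .negative) := by ring
    _ = 3 ^ (a .positive + a .negative) *
        (colorings D.word .positive * colorings D.word .negative) := by rw [← h1, ← h2]; ring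
    _ = 9 * 3 ^ (marks D.word + a .positive + a .negative) := by rw [hD]; ring
    _ = _ := by rw [hm]; ring

/-- A connected surface other than a sphere does not fit on a `3`-mosaic. -/
theorem four_le_of_represents {D : Diagram} (hD : isSpherical D.word = false) {n : ℕ}
    {M : Mosaic n} (h : M.Represents D.toLink) : 4 ≤ n := by
  by_contra hn
  obtain ⟨hM, E, hE, hED⟩ := h
  obtain ⟨L, h1, h2, h3, h4⟩ := exists_stacked_of_le (N := 3) (by omega) hM
  have := isSpherical_of_stacked h1 h2 h3
  rw [← h4, ← hE] at this
  rw [isSpherical_congr (sameCounts_of_toLink_eq hED) this] at hD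
  cases hD

theorem isSpherical_word : isSpherical Yoshikawa.k2_1_p1.word = false ∧
    isSpherical Yoshikawa.k2_1_m1.word = false := by decide +kernel

/-- A single tile has no neighbours and must be empty. The empty word has one labelling by three
labels, a circle has three. -/
theorem two_le_of_represents {n : ℕ} {M : Mosaic n}
    (h : M.Represents Yoshikawa.k0_1.diagram.toLink) : 2 ≤ n := by
  by_contra hn
  obtain ⟨hM, E, hE, hED⟩ := h
  obtain ⟨L, h1, h2, h3, h4⟩ := exists_stacked_of_le (N := 1) (by omega) hM
  have hw : E.word = [] := by
    obtain ⟨r, rfl⟩ := List.length_eq_one_iff.1 h1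
    obtain ⟨t, rfl⟩ := List.length_eq_one_iff.1 (h2 r (by simp))
    obtain ⟨h5, ⟨h6, h7⟩, h8⟩ := h3
    change bottoms [t] = 0 at h8
    change t.hasRight = false at h7
    rw [hE, h4]
    rcases t with _ | _ | _ | _ | _ | _ | _ | _ | _ | _ | _ <;>
      simp [tops, bottoms, Tile.hasTop, Tile.hasBottom, Tile.hasLeft, Tile.hasRight,
        rowsWord, rowWord, Tile.word] at *
  obtain ⟨a, b, ha, hb, -, h⟩ := sameCounts_of_toLink_eq hED
  have := h 3 quandleT .singular
  rw [count_quandleT E.closed, count_quandleT Yoshikawa.k0_1.diagram.closed, hw, ha, hb] at this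
  revert this
  decide +kernel

end Sweep

/-! ### Planar isotopy of words -/

theorem run_birth_cons (k m : ℕ) (w : List Event) :
    run (birth k :: w) m = if k ≤ m then run w (m + 2) else none := rfl

theorem run_join_cons (k m : ℕ) (w : List Event) :
    run (join k :: w) m = if k + 2 ≤ m then run w (m - 2) else none := rfl

theorem run_vertex_cons (x : Vertex) (k m : ℕ) (w : List Event) :
    run (vertex x k :: w) m = if k + 2 ≤ m then run w m else none := by
  change (if k + 2 ≤ m then run w (m - 2 + 2) else none) = _
  split_ifs with h
  · rw [Nat.sub_add_cancel (by omega)]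
  · rfl

theorem run_nil (m : ℕ) : run [] m = some m := rfl

/-- Below `m` strands the words `v` and `w` are interchangeable up to isotopy. -/
def IsotopicAt (m : ℕ) (v w : List Event) : Prop :=
  run v m = run w m ∧ ∀ (u z : List Event) (hv : run (u ++ (v ++ z)) 0 = some 0)
    (hw : run (u ++ (w ++ z)) 0 = some 0), run u 0 = some m →
    (Diagram.mk _ hv).toLink = (Diagram.mk _ hw).toLink

namespace IsotopicAt

variable {m m' k : ℕ} {u v w x z l r : List Event}

theorem refl (m : ℕ) (v : List Event) : IsotopicAt m v v := ⟨rfl, fun _ _ _ _ _ => rfl⟩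

theorem symm (h : IsotopicAt m v w) : IsotopicAt m w v :=
  ⟨h.1.symm, fun u z hv hw hu => (h.2 u z hw hv hu).symm⟩

theorem trans (h : IsotopicAt m v w) (h' : IsotopicAt m w x) : IsotopicAt m v x := by
  refine ⟨h.1.trans h'.1, fun u z hv hx hu => ?_⟩
  have hw : run (u ++ (w ++ z)) 0 = some 0 := by
    simpa only [run_append, hu, Option.bind_some, h.1] using hv
  exact (h.2 u z hv hw hu).trans (h'.2 u z hw hx hu)

/-- Words that cannot be run are related vacuously, which avoids hypotheses on the number of strands
in the lemmas below. -/
theorem of_eq_none (hv : run v m = none) (hw : run w m = none) : IsotopicAt m v w := by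
  refine ⟨hv.trans hw.symm, fun u z h _ hu => ?_⟩
  simp [run_append, hu, hv] at h

theorem append_right (h : IsotopicAt m v w) (x : List Event) :
    IsotopicAt m (v ++ x) (w ++ x) := by
  refine ⟨by simp only [run_append, h.1], fun u z hv hw hu => ?_⟩
  simpa only [List.append_assoc] using
    h.2 u (x ++ z) (by simpa using hv) (by simpa using hw) hu

theorem append_left (hx : run x m = some m') (h : IsotopicAt m' v w) :
    IsotopicAt m (x ++ v) (x ++ w) := by
  refine ⟨by simp only [run_append, hx, Option.bind_some, h.1], fun u z hv hw hu => ?_⟩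
  simpa only [List.append_assoc] using
    h.2 (u ++ x) z (by simpa using hv) (by simpa using hw) (by simp [run_append, hu, hx])

theorem append_left_of_isSome {n : ℕ} (hx : run (x ++ v) m = some n)
    (h : ∀ m', run v m' = some n → IsotopicAt m' v w) : IsotopicAt m (x ++ v) (x ++ w) := by
  rw [run_append] at hx
  obtain ⟨m', h1, h2⟩ := Option.bind_eq_some_iff.1 hx
  exact append_left h1 (h m' h2)

theorem of_localMove (h : LocalMove l r) (k : ℕ)
    (hr : run (l.map (Event.shift k)) m = run (r.map (Event.shift k)) m) :
    IsotopicAt m (l.map (Event.shift k)) (r.map (Event.shift k)) :=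
  ⟨hr, fun u z _ _ _ => Quot.sound ⟨u, l, r, z, k, h, by simp, by simp⟩⟩

theorem slide (e f : Piece) (k d m : ℕ) :
    IsotopicAt m [⟨e, k⟩, ⟨f, k + e.outs + d⟩] [⟨f, k + e.ins + d⟩, ⟨e, k⟩] := by
  have := of_localMove (LocalMove.slide e f d) k (m := m)
  simp only [List.map_cons, List.map_nil, Event.shift, add_zero, ← add_assoc] at this
  refine this ?_
  simp only [run]
  split_ifs <;> first | rfl | omega | (congr 1; omega)

theorem zigzag_left (h : k + 1 ≤ m) : IsotopicAt m [] [birth (k + 1), join k] := by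
  refine of_localMove LocalMove.zigzag_left k ?_
  simp only [List.map_nil, List.map_cons, Event.shift, add_zero, run_birth_cons, run_join_cons,
    run_nil]
  split_ifs <;> first | rfl | omega

theorem zigzag_right (h : k + 1 ≤ m) : IsotopicAt m [] [birth k, join (k + 1)] := by
  refine of_localMove LocalMove.zigzag_right k ?_
  simp only [List.map_nil, List.map_cons, Event.shift, add_zero, run_birth_cons, run_join_cons,
    run_nil]
  split_ifs <;> first | rfl | omega

theorem turn_join (x : Vertex) (k m : ℕ) :
    IsotopicAt m [vertex x (k + 1), join k] [vertex x.rot k, join (k + 1)] := by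
  refine of_localMove (LocalMove.turn_join x) k ?_
  simp only [List.map_nil, List.map_cons, Event.shift, add_zero, run_vertex_cons, run_join_cons,
    run_nil]
  split_ifs <;> rfl

/-- An S-bend is created below the left leg of the vertex, its birth is slid above the vertex, and
the remaining join then turns the vertex by a quarter turn. -/
theorem turn_right (x : Vertex) (k m : ℕ) :
    IsotopicAt m [vertex x k] [birth k, vertex x.rot (k + 1), join (k + 2)] := by
  by_cases h : k + 2 ≤ m
  · have h0 : run [vertex x k] m = some m := by
      rw [run_vertex_cons, if_pos h, run_nil]
    have h1 := append_left h0 (zigzag_right (k := k) (m := m) (by omega))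
    have h2 := (slide .birth (.vertex x) k 0 m).symm.append_right [join (k + 1)]
    have hb : run [birth k] m = some (m + 2) := by
      rw [run_birth_cons, if_pos (by omega), run_nil]
    have h3 := append_left hb (turn_join x (k + 1) (m + 2))
    exact (h1.trans h2).trans h3
  · apply of_eq_none <;> simp only [run_birth_cons, run_vertex_cons, run_join_cons] <;>
      split_ifs <;> first | rfl | omega

theorem _root_.MarkedGraph.Vertex.rot_rot (x : Vertex) : x.rot.rot = x := by
  cases x <;> simp [Vertex.rot]

/-- The mirror image of `turn_right`, with the bend on the right leg and the quarter turn read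
backwards. -/
theorem turn_left (x : Vertex) (k m : ℕ) :
    IsotopicAt m [vertex x k] [birth (k + 2), vertex x.rot (k + 1), join k] := by
  by_cases h : k + 2 ≤ m
  · have h0 : run [vertex x k] m = some m := by
      rw [run_vertex_cons, if_pos h, run_nil]
    have h1 := append_left h0 (zigzag_left (k := k + 1) (m := m) (by omega))
    have h2 := (slide (.vertex x) .birth k 0 m).append_right [join (k + 1)]
    have hb : run [birth (k + 2)] m = some (m + 2) := by
      rw [run_birth_cons, if_pos (by omega), run_nil]
    have h3 := append_left hb (turn_join x.rot k (m + 2)).symm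
    rw [Vertex.rot_rot] at h3
    exact (h1.trans h2).trans h3
  · apply of_eq_none <;> simp only [run_birth_cons, run_vertex_cons, run_join_cons] <;>
      split_ifs <;> rfl

end IsotopicAt

/-! ### Turning vertices and straightening strands -/

/-- A vertex turned clockwise by `n` quarter turns. -/
def turnRight : ℕ → Vertex → ℕ → List Event
  | 0, x, k => [vertex x k]
  | n + 1, x, k => birth k :: (turnRight n x.rot (k + 1) ++ [join (k + 2)])

/-- A vertex turned counterclockwise by `n` quarter turns. -/
def turnLeft : ℕ → Vertex → ℕ → List Event
  | 0, x, k => [vertex x k]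
  | n + 1, x, k => birth (k + 2) :: (turnLeft n x.rot (k + 1) ++ [join k])

def turn (x : Vertex) (k : ℕ) : ℤ → List Event
  | .ofNat n => turnRight n x k
  | .negSucc n => turnLeft (n + 1) x k

/-- The vertices of a word, in their order, turned by the given numbers of quarter turns. -/
def turnAll : List Event → List ℤ → List Event
  | ⟨.vertex x, k⟩ :: w, n :: l => turn x k n ++ turnAll w l
  | e :: w, l => e :: turnAll w l
  | [], _ => []

/-- `e` and `f` form a bent strand. -/
def isZigzag (e f : Event) : Bool :=
  match e.piece, f.piece with
  | .birth, .join => Nat.beq (e.pos + 1) f.pos || Nat.beq (f.pos + 1) e.pos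
  | _, _ => false

/-- Lifts `f` above `e` if it is on the right of `e`. -/
def liftRight (e f : Event) : Option (Event × Event) :=
  bif Nat.ble (e.pos + e.piece.outs) f.pos then
    some (⟨f.piece, f.pos - e.piece.outs + e.piece.ins⟩, e)
  else none

/-- Lifts `f` above `e` if it is on the left of `e`. -/
def liftLeft (e f : Event) : Option (Event × Event) :=
  bif Nat.ble (f.pos + f.piece.ins) e.pos then
    some (f, ⟨e.piece, e.pos - f.piece.ins + f.piece.outs⟩)
  else none

/-- Carries the first piece down, lifting pieces above it, and drops bent strands. -/
def sweepDown (σ : Event → Event → Option (Event × Event)) : Option Event → List Event → List Event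
  | none, [] => []
  | some e, [] => [e]
  | none, f :: w => sweepDown σ (some f) w
  | some e, f :: w =>
    match σ e f with
    | some (f', e') => f' :: sweepDown σ (some e') w
    | none => bif isZigzag e f then sweepDown σ none w else e :: sweepDown σ (some f) w

/-- A normal form of a connected word under sliding and straightening. -/
def simplify (w : List Event) : List Event :=
  (sweepDown liftRight none)^[40] <| (sweepDown liftLeft none)^[40] <|
    (sweepDown liftRight none)^[40] w

theorem isotopicAt_turnRight (n : ℕ) (x : Vertex) (k m : ℕ) :
    IsotopicAt m [vertex x k] (turnRight n x k) := by
  induction n generalizing x k m with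
  | zero => exact .refl _ _
  | succ n ih =>
    refine (IsotopicAt.turn_right x k m).trans ?_
    by_cases h : k ≤ m
    · have hb : run [birth k] m = some (m + 2) := by
        rw [run_birth_cons, if_pos (by omega), run_nil]
      exact .append_left hb ((ih x.rot (k + 1) (m + 2)).append_right [join (k + 2)])
    · apply IsotopicAt.of_eq_none <;> simp [run, turnRight, Piece.ins, h]

theorem isotopicAt_turnLeft (n : ℕ) (x : Vertex) (k m : ℕ) :
    IsotopicAt m [vertex x k] (turnLeft n x k) := by
  induction n generalizing x k m with
  | zero => exact .refl _ _
  | succ n ih =>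
    refine (IsotopicAt.turn_left x k m).trans ?_
    by_cases h : k + 2 ≤ m
    · have hb : run [birth (k + 2)] m = some (m + 2) := by
        rw [run_birth_cons, if_pos (by omega), run_nil]
      exact .append_left hb ((ih x.rot (k + 1) (m + 2)).append_right [join k])
    · apply IsotopicAt.of_eq_none <;> simp [run, turnLeft, Piece.ins, h]

theorem isotopicAt_turn (x : Vertex) (k m : ℕ) (n : ℤ) :
    IsotopicAt m [vertex x k] (turn x k n) := by
  cases n
  exacts [isotopicAt_turnRight _ _ _ _, isotopicAt_turnLeft _ _ _ _]

theorem isotopicAt_turnAll (w : List Event) (l : List ℤ) (m m' : ℕ) (h : run w m = some m') :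
    IsotopicAt m w (turnAll w l) := by
  induction w, l using turnAll.induct generalizing m with
  | case1 x k w n l ih =>
    rw [turnAll]
    exact (IsotopicAt.append_left_of_isSome (x := [vertex x k]) h ih).trans
      ((isotopicAt_turn x k m n).append_right _)
  | case2 e w l _ ih =>
    rw [turnAll.eq_2 _ _ _ (by assumption)]
    exact IsotopicAt.append_left_of_isSome (x := [e]) h ih
  | case3 => exact .refl _ _

theorem isotopicAt_of_liftRight {e f e' f' : Event} (h : liftRight e f = some (f', e')) (m : ℕ) :
    IsotopicAt m [e, f] [f', e'] := by
  obtain ⟨e, i⟩ := e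
  obtain ⟨f, j⟩ := f
  simp only [liftRight, cond_eq_ite, Nat.ble_eq, Option.ite_none_right_eq_some, Option.some.injEq,
    Prod.mk.injEq] at h
  obtain ⟨h, rfl, rfl⟩ := h
  obtain ⟨d, rfl⟩ := Nat.exists_eq_add_of_le h
  have h := IsotopicAt.slide e f i d m
  rwa [show i + e.ins + d = i + e.outs + d - e.outs + e.ins by omega] at h

theorem isotopicAt_of_liftLeft {e f e' f' : Event} (h : liftLeft e f = some (f', e')) (m : ℕ) :
    IsotopicAt m [e, f] [f', e'] := by
  obtain ⟨e, i⟩ := e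
  obtain ⟨f, j⟩ := f
  simp only [liftLeft, cond_eq_ite, Nat.ble_eq, Option.ite_none_right_eq_some, Option.some.injEq,
    Prod.mk.injEq] at h
  obtain ⟨h, rfl, rfl⟩ := h
  obtain ⟨d, rfl⟩ := Nat.exists_eq_add_of_le h
  have h := (IsotopicAt.slide f e j d m).symm
  rwa [show j + f.outs + d = j + f.ins + d - f.ins + f.outs by omega] at h

theorem isotopicAt_of_isZigzag {e f : Event} (h : isZigzag e f = true) {m m' : ℕ}
    (hr : run [e, f] m = some m') : IsotopicAt m [e, f] [] := by
  obtain ⟨e, i⟩ := e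
  obtain ⟨f, j⟩ := f
  cases e <;> cases f <;> simp [isZigzag] at h
  have hm : i ≤ m ∧ j ≤ m := by
    simp only [run_birth_cons, run_join_cons] at hr
    split_ifs at hr
    omega
  rcases h with h | h
  · subst h
    exact (IsotopicAt.zigzag_right hm.2).symm
  · subst h
    exact (IsotopicAt.zigzag_left hm.1).symm

/-- The optional event is the piece being carried down. Where it meets a piece it can neither pass
nor cancel, it is put down and that piece is carried on. -/
theorem isotopicAt_sweepDown {σ : Event → Event → Option (Event × Event)}
    (hσ : ∀ e f e' f', σ e f = some (f', e') → ∀ m, IsotopicAt m [e, f] [f', e'])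
    (o : Option Event) (w : List Event) (m m' : ℕ) (h : run (o.toList ++ w) m = some m') :
    IsotopicAt m (o.toList ++ w) (sweepDown σ o w) := by
  induction w generalizing o m with
  | nil => cases o <;> exact .refl _ _
  | cons f w ih =>
    cases o with
    | none => exact ih (some f) m h
    | some e =>
      simp only [sweepDown]
      split
      next f' e' he =>
        have h1 := (hσ e f e' f' he m).append_right w
        refine h1.trans ?_
        have h2 : run (f' :: e' :: w) m = some m' := by rw [← h]; exact h1.1.symm
        exact IsotopicAt.append_left_of_isSome (x := [f']) h2 (ih (some e'))
      next =>
        cases hz : isZigzag e f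
        · exact IsotopicAt.append_left_of_isSome (x := [e]) h (ih (some f))
        · have h0 := h
          rw [show (some e).toList ++ f :: w = [e, f] ++ w from rfl, run_append] at h0
          obtain ⟨a, ha, -⟩ := Option.bind_eq_some_iff.1 h0
          have h1 := (isotopicAt_of_isZigzag hz ha).append_right w
          exact h1.trans (ih none m (by rw [← h]; exact h1.1.symm))

theorem isotopicAt_iterate {f : List Event → List Event} {m m' : ℕ}
    (hf : ∀ w, run w m = some m' → IsotopicAt m w (f w)) (N : ℕ) (w : List Event)
    (h : run w m = some m') : IsotopicAt m w (f^[N] w) := by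
  induction N generalizing w with
  | zero => exact .refl _ _
  | succ N ih => exact (hf w h).trans (ih _ ((hf w h).1 ▸ h))

/-- Every step is an isotopy, so correctness needs neither that 40 rounds suffice nor that the
result is a normal form. -/
theorem isotopicAt_simplify (w : List Event) (m m' : ℕ) (h : run w m = some m') :
    IsotopicAt m w (simplify w) := by
  have hR := isotopicAt_iterate (m := m) (m' := m') (isotopicAt_sweepDown
    (fun _ _ _ _ => isotopicAt_of_liftRight) none · m m') 40
  have hL := isotopicAt_iterate (m := m) (m' := m') (isotopicAt_sweepDown
    (fun _ _ _ _ => isotopicAt_of_liftLeft) none · m m') 40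
  have h1 := hR w h
  have h2 := h1.trans (hL _ (h1.1 ▸ h))
  exact h2.trans (hR _ (h2.1 ▸ h))

/-- The turned table diagram and the mosaic are isotopic to the same simplified word. How the turns
`l` were found plays no role. -/
theorem Mosaic.represents_of_simplify_eq {n : ℕ} {M : Mosaic n} {D : Diagram} {l : List ℤ}
    (hM : M.SuitablyConnected) (hr : run M.word 0 = some 0)
    (h : simplify (turnAll D.word l) = simplify M.word) : M.Represents D.toLink := by
  refine ⟨hM, ⟨M.word, hr⟩, rfl, ?_⟩
  have h1 := isotopicAt_turnAll D.word l 0 0 D.closed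
  have h2 := h1.trans (isotopicAt_simplify _ 0 0 (h1.1 ▸ D.closed))
  rw [h] at h2
  have h3 := h2.trans (isotopicAt_simplify _ 0 0 hr).symm
  have h4 := h3.2 [] [] (by simpa using D.closed) (by simpa using hr) rfl
  simpa using h4.symm

/-! ### Explicit mosaics for the table -/

namespace Tile

abbrev o : Tile := .empty
abbrev lb : Tile := .leftBottom
abbrev rb : Tile := .rightBottom
abbrev rt : Tile := .rightTop
abbrev lt : Tile := .leftTop
abbrev hl : Tile := .horizontal
abbrev vl : Tile := .vertical
abbrev a₁ : Tile := .twoArcs₁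
abbrev a₂ : Tile := .twoArcs₂
abbrev cp : Tile := .crossing true
abbrev cn : Tile := .crossing false
abbrev mp : Tile := .marked true
abbrev mn : Tile := .marked false

end Tile

namespace Yoshikawa

open Tile

/-- The size of the mosaic `K.mosaic`. -/
def size : Yoshikawa → ℕ
  | .k0_1 => 2
  | .k2_1_p1 | .k2_1_m1 => 4
  | .k6_1_0_p1 | .k7_1_0_m2 | .k8_1_p1_p1 | .k8_1_m1_m1 | .k10_2_0_p1 => 6
  | .k8_1 | .k9_1 | .k9_1_0_p1 | .k9_1_p1_m2 | .k10_1 | .k10_2 | .k10_1_0_p1 | .k10_1_p1_p1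
  | .k10_2_0_m2 | .k10_1_m1_m1 => 7
  | _ => 8

/-- A mosaic for each surface-link in the table. -/
def mosaic : (K : Yoshikawa) → Mosaic K.size
  | .k0_1 =>
    !![rb, lb;
      rt, lt]
  | .k2_1_p1 =>
    !![o, rb, hl, lb;
      rb, mp, lb, vl;
      rt, mp, lt, vl;
      o, rt, hl, lt]
  | .k2_1_m1 =>
    !![o, rb, hl, lb;
      rb, mn, lb, vl;
      rt, cp, lt, vl;
      o, rt, hl, lt]
  | .k6_1_0_p1 =>
    !![rb, hl, lb, rb, hl, lb;
      vl, rb, mp, cp, lb, vl;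
      vl, rt, mp, cn, a₁, lt;
      vl, o, rt, cn, a₂, lb;
      vl, o, o, rt, cn, lt;
      rt, hl, hl, hl, lt, o]
  | .k7_1_0_m2 =>
    !![o, o, rb, lb, o, o;
      o, rb, mp, mp, hl, lb;
      rb, cn, cn, a₂, lb, vl;
      vl, rt, cp, cn, lt, vl;
      vl, rb, cp, a₁, hl, lt;
      rt, lt, rt, lt, o, o]
  | .k8_1 =>
    !![rb, hl, hl, lb, rb, lb, o;
      vl, o, rb, cn, lt, rt, lb;
      vl, rb, cn, a₁, lb, rb, lt;
      rt, a₂, cp, a₁, cn, a₂, lb;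
      rb, a₁, mn, a₁, cp, a₁, lt;
      vl, rt, mn, cp, lt, rt, lb;
      rt, hl, lt, rt, hl, hl, lt]
  | .k8_1_p1_p1 =>
    !![rb, hl, lb, rb, lb, o;
      vl, rb, cp, a₁, mp, lb;
      vl, rt, cn, mn, a₁, lt;
      vl, rb, mp, cp, cn, lb;
      vl, rt, mp, a₂, lt, vl;
      rt, hl, lt, rt, hl, lt]
  | .k8_1_m1_m1 =>
    !![o, rb, hl, hl, lb, o;
      rb, cp, lb, rb, cn, lb;
      rt, a₂, mp, cn, a₁, lt;
      rb, cn, cp, cn, mn, lb;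
      vl, rt, lt, rt, a₁, lt;
      rt, hl, hl, hl, lt, o]
  | .k9_1 =>
    !![rb, hl, hl, lb, rb, lb, o;
      vl, rb, hl, a₂, a₁, cp, lb;
      vl, vl, rb, cp, cp, a₁, lt;
      rt, a₂, cp, a₂, a₂, a₂, lb;
      rb, mn, a₁, cp, a₁, cn, lt;
      rt, mn, cp, a₂, lt, vl, o;
      o, rt, lt, rt, hl, lt, o]
  | .k9_1_0_p1 =>
    !![o, o, rb, hl, lb, o, o;
      o, rb, a₁, hl, a₂, lb, o;
      rb, mp, lt, rb, cn, a₂, lb;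
      vl, vl, rb, cn, cp, a₁, lt;
      rt, mp, cn, cp, a₂, cn, lb;
      o, rt, a₂, lt, rt, cp, lt;
      o, o, rt, hl, hl, lt, o]
  | .k9_1_p1_m2 =>
    !![o, o, rb, hl, hl, lb, o;
      o, rb, cn, lb, o, rt, lb;
      rb, a₁, a₁, mn, lb, rb, lt;
      rt, cp, mp, a₁, cp, cn, lb;
      o, rt, a₂, cp, lt, vl, vl;
      o, o, rt, mp, hl, mp, lt;
      o, o, o, rt, hl, lt, o]
  | .k10_1 =>
    !![o, rb, lb, rb, hl, lb, o;
      rb, cn, a₂, a₁, hl, cp, lb;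
      vl, rt, a₂, cp, lb, vl, vl;
      vl, rb, a₂, a₁, cp, lt, vl;
      rt, cn, cp, cn, mp, lb, vl;
      rb, lt, rt, cp, mp, lt, vl;
      rt, hl, hl, lt, rt, hl, lt]
  | .k10_2 =>
    !![o, o, rb, lb, rb, lb, o;
      rb, hl, cp, a₂, mp, a₂, lb;
      vl, rb, cn, a₁, cp, a₁, lt;
      rt, a₂, cp, a₁, a₁, cp, lb;
      rb, cp, mn, cn, cp, lt, vl;
      rt, a₂, a₁, a₂, lt, rb, lt;
      o, rt, lt, rt, hl, lt, o]
  | .k10_3 =>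
    !![rb, hl, hl, hl, lb, o, o, o;
      vl, rb, lb, rb, a₂, lb, rb, lb;
      rt, cn, cp, a₁, cn, a₂, a₁, lt;
      rb, cp, mp, cn, lt, rt, a₂, lb;
      rt, cn, cn, a₂, lb, rb, a₁, lt;
      rb, a₁, a₁, cn, a₁, mn, lt, o;
      rt, a₂, lt, rt, lt, rt, lb, o;
      o, rt, hl, hl, hl, hl, lt, o]
  | .k10_1_p1 =>
    !![o, rb, hl, hl, lb, rb, hl, lb;
      rb, cn, lb, rb, mp, lt, o, vl;
      rt, a₂, cn, a₂, mp, lb, rb, lt;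
      rb, a₁, a₂, cn, a₁, cp, a₂, lb;
      rt, mn, a₂, mp, a₁, cn, lt, vl;
      o, rt, a₂, a₁, cn, lt, o, vl;
      rb, hl, a₁, lt, rt, lb, o, vl;
      rt, hl, lt, o, o, rt, hl, lt]
  | .k10_1_0_p1 =>
    !![o, rb, lb, rb, lb, o, o;
      rb, a₁, cp, cp, cn, lb, o;
      vl, vl, rt, mp, a₂, cn, lb;
      rt, cp, lb, rt, mn, cp, lt;
      rb, a₁, lt, rb, cn, lt, o;
      vl, rt, hl, cn, lt, o, o;
      rt, hl, hl, lt, o, o, o]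
  | .k10_2_0_p1 =>
    !![o, o, rb, lb, o, o;
      rb, hl, cn, cp, lb, o;
      vl, rb, cn, cp, mn, lb;
      rt, a₂, cp, cn, mn, lt;
      o, rt, cp, cn, lt, o;
      o, o, rt, lt, o, o]
  | .k10_1_p1_p1 =>
    !![rb, hl, hl, lb, rb, lb, o;
      rt, lb, rb, cn, a₁, a₂, lb;
      rb, a₁, cn, mn, a₁, a₁, lt;
      rt, mp, cp, a₁, cn, mp, lb;
      rb, lt, rt, mn, cp, a₁, lt;
      rt, lb, o, rt, cn, lt, o;
      o, rt, hl, hl, lt, o, o]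
  | .k10_1_0_0_p1 =>
    !![rb, hl, hl, hl, hl, hl, hl, lb;
      rt, hl, lb, rb, hl, lb, o, vl;
      rb, hl, a₁, cp, hl, a₂, lb, vl;
      vl, rb, a₁, a₁, lb, vl, vl, vl;
      vl, vl, rt, cn, cp, cp, a₁, lt;
      rt, cp, hl, cp, cn, a₂, a₂, lb;
      rb, lt, rb, mp, mp, a₂, cn, lt;
      rt, hl, lt, rt, lt, rt, lt, o]
  | .k10_1_0_m2 =>
    !![o, o, o, o, o, o, o, o;
      o, o, o, o, o, o, o, o;
      o, rb, hl, hl, lb, rb, lb, o;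
      rb, cp, lb, rb, cn, a₁, a₂, lb;
      rt, mn, a₂, cp, a₂, cn, cp, lt;
      o, rt, a₂, a₂, cp, cp, a₂, lb;
      o, o, rt, mp, lt, rt, cp, lt;
      o, o, o, rt, hl, hl, lt, o]
  | .k10_2_0_m2 =>
    !![rb, hl, hl, lb, rb, lb, o;
      rt, lb, rb, cn, a₁, a₂, lb;
      rb, a₁, cn, cp, a₁, a₁, lt;
      rt, cn, mp, a₁, cn, mn, lb;
      rb, lt, rt, cn, cp, a₁, lt;
      rt, lb, o, rt, cn, lt, o;
      o, rt, hl, hl, lt, o, o]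
  | .k10_1_m1_m1 =>
    !![rb, hl, hl, lb, rb, lb, o;
      rt, lb, rb, cn, a₁, a₂, lb;
      rb, a₁, cn, cp, a₁, a₁, lt;
      rt, cn, mp, a₁, cn, cp, lb;
      rb, lt, rt, cn, cp, a₁, lt;
      rt, lb, o, rt, mp, lt, o;
      o, rt, hl, hl, lt, o, o]
  | .k10_1_m2_m2 =>
    !![o, o, o, o, o, o, o, o;
      o, o, o, o, o, o, o, o;
      rb, hl, hl, hl, hl, lb, o, o;
      rt, lb, rb, lb, rb, cp, hl, lb;
      rb, mp, cp, mn, cp, a₁, lb, vl;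
      rt, a₂, a₁, cn, mp, mp, cn, lt;
      o, rt, cn, lt, rt, lt, rt, lb;
      o, o, rt, hl, hl, hl, hl, lt]

/-- Quarter turns of the vertices that take the diagrams in the table to the mosaics. -/
def turns : Yoshikawa → List ℤ
  | .k0_1 => []
  | .k2_1_p1 => [0, -3]
  | .k2_1_m1 => [0, -3]
  | .k6_1_0_p1 => [0, 1, 2, 1, 0, 0]
  | .k7_1_0_m2 => [0, -1, -1, -1, -2, -3, -3]
  | .k8_1 => [1, 1, 0, -1, 0, 0, 1, 1]
  | .k8_1_p1_p1 => [1, 2, 2, 2, 2, 1, 2, 3]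
  | .k8_1_m1_m1 => [-1, -1, -2, -2, 1, 0, 0, -2]
  | .k9_1 => [-1, -1, -1, -2, -1, -2, -1, -1, -2]
  | .k9_1_0_p1 => [2, 2, 2, 2, 1, 0, 1, 0, -1]
  | .k9_1_p1_m2 => [2, 2, 2, 0, 0, -1, -1, 1, 0]
  | .k10_1 => [-1, 0, -1, -1, 0, -1, -1, -2, -3, -2]
  | .k10_2 => [-1, 1, 0, -1, -2, 1, 1, 1, 1, 1]
  | .k10_3 => [-1, -1, -1, 0, -1, -1, -1, -2, -2, -4]
  | .k10_1_p1 => [-1, -1, -2, -2, -3, -2, -2, -2, -2, -2]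
  | .k10_1_0_p1 => [-1, 0, 0, 1, 2, 2, 1, 2, 0, -1]
  | .k10_2_0_p1 => [1, 1, 1, 1, 1, 1, 0, 0, -1, -1]
  | .k10_1_p1_p1 => [-2, -2, -1, -1, -1, 1, 1, 0, -1, -1]
  | .k10_1_0_0_p1 => [-2, -1, 1, 1, 2, 2, 2, 0, 0, 0]
  | .k10_1_0_m2 => [-1, 0, -1, -2, -2, -2, -2, 0, -1, -1]
  | .k10_2_0_m2 => [-2, -2, -1, -1, -1, 1, 1, 0, -1, -1]
  | .k10_1_m1_m1 => [-2, -2, -1, -1, -1, 1, 1, 0, -1, -1]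
  | .k10_1_m2_m2 => [-1, -1, 0, -1, -1, 2, 1, 1, 1, 0]

theorem represents_mosaic (K : Yoshikawa) : K.mosaic.Represents K.diagram.toLink := by
  refine Mosaic.represents_of_simplify_eq (l := K.turns) ?_ ?_ ?_
  · unfold Mosaic.SuitablyConnected
    cases K <;> decide +kernel
  · cases K <;> decide +kernel
  · cases K <;> decide +kernel

end Yoshikawa

/-! ### The bounds for mosaic numbers -/

namespace Yoshikawa

theorem m_le_size (K : Yoshikawa) : K.m ≤ K.size :=
  Nat.sInf_le ⟨K.mosaic, K.represents_mosaic⟩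

theorem exists_mosaic_m (K : Yoshikawa) : ∃ M : Mosaic K.m, M.Represents K.diagram.toLink :=
  Nat.sInf_mem (s := {n | ∃ M : Mosaic n, M.Represents K.diagram.toLink})
    ⟨K.size, K.mosaic, K.represents_mosaic⟩

theorem six_le_m (K : Yoshikawa) (hK : K ∉ [k0_1, k2_1_p1, k2_1_m1]) : 6 ≤ K.m := by
  have h1 : run (K.word.take 1) 0 = some 2 := by cases K <;> rfl
  have h2 : run (K.word.drop 1) 2 = some 0 := by cases K <;> rfl
  have h := Sweep.not_forcedWord h1 h2 ((isComplicated_word K).resolve_left hK)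
  obtain ⟨M, hM⟩ := K.exists_mosaic_m
  exact Sweep.six_le_of_represents (D := K.diagram) h hM

theorem four_le_m (K : Yoshikawa) (hK : Sweep.isSpherical K.word = false) : 4 ≤ K.m := by
  obtain ⟨M, hM⟩ := K.exists_mosaic_m
  exact Sweep.four_le_of_represents hK hM

theorem two_le_m : 2 ≤ k0_1.m := by
  obtain ⟨M, hM⟩ := k0_1.exists_mosaic_m
  exact Sweep.two_le_of_represents hM

end Yoshikawa

end MarkedGraph

end

theorem mainTheorem2 :
    MarkedGraph.Yoshikawa.k0_1.m = 2 ∧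
    (∀ K ∈ ({.k2_1_p1, .k2_1_m1} : Set MarkedGraph.Yoshikawa), K.m = 4) ∧
    MarkedGraph.Yoshikawa.k6_1_0_p1.m ∈ ({5, 6} : Set ℕ) ∧
    (∀ K ∈ ({.k7_1_0_m2, .k8_1_p1_p1, .k8_1_m1_m1, .k10_2_0_p1} : Set MarkedGraph.Yoshikawa),
      K.m = 6) ∧
    (∀ K ∈ ({.k8_1, .k9_1, .k9_1_0_p1, .k9_1_p1_m2, .k10_1, .k10_2, .k10_1_0_p1, .k10_1_p1_p1,
        .k10_2_0_m2, .k10_1_m1_m1} : Set MarkedGraph.Yoshikawa),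
      K.m ∈ ({6, 7} : Set ℕ)) ∧
    (∀ K ∈ ({.k10_3, .k10_1_p1, .k10_1_0_0_p1, .k10_1_0_m2, .k10_1_m2_m2} :
        Set MarkedGraph.Yoshikawa),
      K.m ∈ ({6, 7, 8} : Set ℕ)) := by
  have hs : ∀ K : MarkedGraph.Yoshikawa, K.m ≤ K.size := MarkedGraph.Yoshikawa.m_le_size
  refine ⟨?_, ?_, ?_, ?_, ?_, ?_⟩
  · exact (hs .k0_1).antisymm MarkedGraph.Yoshikawa.two_le_m
  · rintro K (rfl | rfl)
    · exact (hs .k2_1_p1).antisymm (MarkedGraph.Yoshikawa.four_le_m _ MarkedGraph.Sweep.isSpherical_word.1)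
    · exact (hs .k2_1_m1).antisymm (MarkedGraph.Yoshikawa.four_le_m _ MarkedGraph.Sweep.isSpherical_word.2)
  -- The general lower bound decides this case: the mosaic number is 6.
  · exact Or.inr ((hs .k6_1_0_p1).antisymm (MarkedGraph.Yoshikawa.six_le_m _ (by simp)))
  · intro K hK
    simp only [Set.mem_insert_iff, Set.mem_singleton_iff] at hK
    have h6 : 6 ≤ K.m := K.six_le_m (by rcases hK with rfl | rfl | rfl | rfl <;> simp)
    have h : K.size = 6 := by rcases hK with rfl | rfl | rfl | rfl <;> rfl
    exact ((hs K).trans_eq h).antisymm h6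
  · intro K hK
    simp only [Set.mem_insert_iff, Set.mem_singleton_iff] at hK ⊢
    have h6 : 6 ≤ K.m := K.six_le_m (by
      rcases hK with rfl | rfl | rfl | rfl | rfl | rfl | rfl | rfl | rfl | rfl <;> simp)
    have h : K.size = 7 := by
      rcases hK with rfl | rfl | rfl | rfl | rfl | rfl | rfl | rfl | rfl | rfl <;> rfl
    have := hs K
    omega
  · intro K hK
    simp only [Set.mem_insert_iff, Set.mem_singleton_iff] at hK ⊢
    have h6 : 6 ≤ K.m := K.six_le_m (by rcases hK with rfl | rfl | rfl | rfl | rfl <;> simp)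
    have h : K.size = 8 := by rcases hK with rfl | rfl | rfl | rfl | rfl <;> rfl
    have := hs K
    omega
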